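/- **Setup.** Let $F\subset\mathbb R$ be a real quadratic field with ring of integers $\mathcal O_F$, different $\mathfrak d$ and Galois conjugation $\lambda\mapsto\lambda'$. Write $\mathbf e(z)=e^{2\pi i z}$, $\tau=u+iv\in\mathcal H$ and $d\mu(\tau)=\frac{du\,dv}{v^2}$, and let $\Gamma=\mathrm{SL}_2(\mathbb Z)$. For an integer $\kappa\ge1$ let $\varepsilon_\kappa$ be the smallest totally positive unit of $\mathcal O_F$ with $\varepsilon_\kappa>1$ and $\varepsilon_\kappa-1\in\kappa\mathfrak d$. For a nonzero fractional ideal $\mathfrak a$ put $N=\mathrm{Nm}(\mathfrak a)/\kappa$ and $(x,y)_{F}=(x_1y_2+x_2y_1)/N$ on $\mathbb R^2\supset F$ (where $\lambda\mapsto(\lambda,\lambda')$). Let $L=\mathfrak a$ with the form $\mathrm{Nm}/N$, and let $L^\vee$ be its dual lattice. *Hecke's theta function.* Put $Z(t)=\sqrt N(e^t,-e^{-t})$ and $Z^\perp(t)=\sqrt N(e^t,e^{-t})$. For $h\in L^\vee/L$ let $$\vartheta_{L,h}(\tau)=\int_0^{\log\varepsilon_\kappa}\sqrt v\sum_{\lambda\in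 h}(\lambda,Z^\perp(t))_F\;\mathbf e\Big(\tfrac{(\lambda,Z^\perp(t))_F^2}{4}\tau-\tfrac{(\lambda,Z(t))_F^2}{4}\overline\tau\Big)dt,$$ $$\|\vartheta_L\|^2_{\mathrm{Pet}}=\int_{\Gamma\backslash\mathcal H}v\sum_{h\in L^\vee/L}|\vartheta_{L,h}(\tau)|^2\,d\mu(\tau).$$ *The invariant $\tilde\Psi$.* On $M_2(\mathbb R)$ let $(\cdot,\cdot)$ be the bilinear form of $Q=\det/N$. Let $$M_{\mathfrak a,\kappa}=\left\{\begin{pmatrix}\lambda_1&\lambda_2\\ \lambda_2'&\lambda_1'\end{pmatrix}:\lambda_1,\lambda_2\in L^\vee,\ \lambda_1-\lambda_2\in L\right\},$$ $$X(t)=\sqrt N\begin{pmatrix}e^t&0\\0&-e^{-t}\end{pmatrix},\quad Y(t_0)=\sqrt N\begin{pmatrix}0&e^{t_0}\\e^{-t_0}&0\end{pmatrix},\quad X^\perp(t)=\sqrt N\begin{pmatrix}e^t&0\\0&e^{-t}\end{pmatrix},\quad Y^\perp(t_0)=\sqrt N\begin{pmatrix}0&e^{t_0}\\-e^{-t_0}&0\end{pmatrix},$$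 let $Q(x_{w^\perp})=\frac{(x,X^\perp(t))^2+(x,Y^\perp(t_0))^2}{4}$ and $Q(x_w)=-\frac{(x,X(t))^2+(x,Y(t_0))^2}{4}$, and $$\Theta_{M}(\tau,t,t_0)=-\sum_{x\in M_{\mathfrak a,\kappa}}(x,X(t))\,(x,Y^\perp(t_0))\;\mathbf e\big(Q(x_{w^\perp})\tau+Q(x_w)\overline\tau\big).$$ For a narrow ideal class $\mathcal A$ of $F$ represented by a fractional ideal $\mathfrak a$ let $$\tilde\Psi(\mathcal A,\kappa)=\int_0^{\log\varepsilon_\kappa}\int_{\Gamma\backslash\mathcal H}v^2\,\Theta_{M_{\mathfrak a,\kappa}}(\tau,t,0)\,d\mu(\tau)\,dt .$$ **Proposition 2.2.** Let $\mathfrak a\subset\mathcal O_F$ be a nonzero integral ideal, $\kappa\ge1$ an integer and $L=L_{\mathfrak a,\kappa}$. Then $$\|\vartheta_L\|^2_{\mathrm{Pet}}=\tilde\Psi([\mathfrak a\mathfrak d],\kappa)\,\log\varepsilon_\kappa ,$$ whichever fractional ideal in the narrow class $[\mathfrak a\mathfrak d]$ is used to compute $\tilde\Psi$. All series and integrals that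 define the two sides converge absolutely. -/

import Mathlib

noncomputable section

namespace HeckeTheta

open MeasureTheory UpperHalfPlane
open scoped nonZeroDivisors NumberField Modular

/-- `𝐞(z) = exp(2πiz)`. -/
def e (z : ℂ) : ℂ := Complex.exp (2 * Real.pi * Complex.I * z)

/-! ### The plane `F ⊗ ℝ ≅ ℝ²` with the form `Nm / N` -/

/-- The bilinear form `(x, y) = (x₁ y₂ + x₂ y₁) / N` on `ℝ²` attached to the quadratic form
`Q(x) = x₁ x₂ / N`. -/
def planeBil (N : ℝ) (x y : ℝ × ℝ) : ℝ := (x.1 * y.2 + x.2 * y.1) / N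

/-- `Z(t) = √N (eᵗ, -e⁻ᵗ)`, which spans a negative line. -/
def Z (N t : ℝ) : ℝ × ℝ := (√N * Real.exp t, -(√N * Real.exp (-t)))

/-- `Z^⊥(t) = √N (eᵗ, e⁻ᵗ)`, which spans the orthogonal complement of `Z(t)`. -/
def Zperp (N t : ℝ) : ℝ × ℝ := (√N * Real.exp t, √N * Real.exp (-t))

section Lattice

variable {F : Type*} [Field F] [NumberField F] (σ σ' : F →+* ℝ)

/-- The embedding `F → F ⊗ ℝ ≅ ℝ²`, `x ↦ (x, x')`. Here `σ` is the fixed embedding of the real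
quadratic field `F` into `ℝ`, and `σ'` is the other one, so that `σ' x` is the Galois
conjugate `x'` regarded as a real number. -/
def emb (x : F) : ℝ × ℝ := (σ x, σ' x)

/-- The rational number `N = Nm(𝔞) / κ`, as a real number. -/
def levelN (𝔞 : FractionalIdeal (𝓞 F)⁰ F) (κ : ℕ) : ℝ :=
  ((FractionalIdeal.absNorm 𝔞 : ℚ) : ℝ) / κ

/-- The additive group of the lattice `L = L_{𝔞,κ}`, that is, of `𝔞`. -/
def lattice (𝔞 : FractionalIdeal (𝓞 F)⁰ F) : AddSubgroup F :=
  (𝔞 : Submodule (𝓞 F) F).toAddSubgroup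

/-- The dual lattice `L^∨ = {μ ∈ F : (λ, μ) ∈ ℤ for all λ ∈ L}` of `L = (𝔞, Nm / N)`. -/
def dualLattice (𝔞 : FractionalIdeal (𝓞 F)⁰ F) (κ : ℕ) : AddSubgroup F where
  carrier := {μ | ∀ l ∈ lattice 𝔞, ∃ n : ℤ,
    planeBil (levelN 𝔞 κ) (emb σ σ' l) (emb σ σ' μ) = n}
  zero_mem' := fun l _ => ⟨0, by simp [planeBil, emb]⟩
  add_mem' := by
    intro a b ha hb l hl
    obtain ⟨m, hm⟩ := ha l hl
    obtain ⟨n, hn⟩ := hb l hl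
    refine ⟨m + n, ?_⟩
    push_cast
    rw [← hm, ← hn]
    simp only [planeBil, emb, map_add]
    ring
  neg_mem' := by
    intro a ha l hl
    obtain ⟨m, hm⟩ := ha l hl
    refine ⟨-m, ?_⟩
    push_cast
    rw [← hm]
    simp only [planeBil, emb, map_neg]
    ring

/-- The discriminant group `L^∨ / L`. -/
abbrev DiscGroup (𝔞 : FractionalIdeal (𝓞 F)⁰ F) (κ : ℕ) : Type _ :=
  dualLattice σ σ' 𝔞 κ ⧸ (lattice 𝔞).addSubgroupOf (dualLattice σ σ' 𝔞 κ)

/-- The elements of `L^∨` in the coset `h ∈ L^∨ / L`. -/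
abbrev Coset (𝔞 : FractionalIdeal (𝓞 F)⁰ F) (κ : ℕ) (h : DiscGroup σ σ' 𝔞 κ) : Type _ :=
  {l : dualLattice σ σ' 𝔞 κ // (QuotientAddGroup.mk l : DiscGroup σ σ' 𝔞 κ) = h}

/-- `ε_κ`: the smallest totally positive unit `ε` of `F` with `ε > 1` and `ε - 1 ∈ κ𝔡`, where
`𝔡` is the different of `F`, as a real number through the embedding `σ`. -/
def epsUnit (κ : ℕ) : ℝ :=
  sInf {x : ℝ | ∃ u : (𝓞 F)ˣ, x = σ ((u : 𝓞 F) : F) ∧ 1 < σ ((u : 𝓞 F) : F) ∧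
    0 < σ' ((u : 𝓞 F) : F) ∧
    (u : 𝓞 F) - 1 ∈ Ideal.span {(κ : 𝓞 F)} * differentIdeal ℤ (𝓞 F)}

/-- `𝔟` and `𝔠` lie in the same narrow ideal class: `𝔟 = μ𝔠` with `μ ∈ F` totally positive. -/
def SameNarrowClass (𝔟 𝔠 : FractionalIdeal (𝓞 F)⁰ F) : Prop :=
  ∃ μ : F, 0 < σ μ ∧ 0 < σ' μ ∧ 𝔟 = FractionalIdeal.spanSingleton (𝓞 F)⁰ μ * 𝔠

/-! ### Hecke's theta function -/

/-- The term of the theta kernel that belongs to `λ ∈ F`: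
`(λ, Z^⊥(t)) 𝐞((λ, Z^⊥(t))² τ / 4 - (λ, Z(t))² τ̄ / 4)`. -/
def kernelTerm (N : ℝ) (τ : ℍ) (t : ℝ) (l : F) : ℂ :=
  (planeBil N (emb σ σ' l) (Zperp N t) : ℂ) *
    e (((planeBil N (emb σ σ' l) (Zperp N t) ^ 2 / 4 : ℝ) : ℂ) * (τ : ℂ) -
      ((planeBil N (emb σ σ' l) (Z N t) ^ 2 / 4 : ℝ) : ℂ) * (starRingEnd ℂ) (τ : ℂ))

/-- The theta kernel `Θ_L(τ, t)`, as the vector of its values on the cosets `h ∈ L^∨ / L`. -/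
def thetaKernel (𝔞 : FractionalIdeal (𝓞 F)⁰ F) (κ : ℕ) (τ : ℍ) (t : ℝ)
    (h : DiscGroup σ σ' 𝔞 κ) : ℂ :=
  (√τ.im : ℂ) * ∑' l : Coset σ σ' 𝔞 κ h,
    kernelTerm σ σ' (levelN 𝔞 κ) τ t ((l : dualLattice σ σ' 𝔞 κ) : F)

/-- Hecke's theta function `ϑ_L(τ)`: the integral of `Θ_L(τ, t) dt` over the fundamental domain
`[0, log ε_κ)` for the translations by multiples of `log ε_κ`. -/
def heckeTheta (𝔞 : FractionalIdeal (𝓞 F)⁰ F) (κ : ℕ) (τ : ℍ) (h : DiscGroup σ σ' 𝔞 κ) : ℂ :=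
  ∫ t in (0 : ℝ)..Real.log (epsUnit σ σ' κ), thetaKernel σ σ' 𝔞 κ τ t h

/-- The Petersson integrand `v |ϑ_L(τ)|²`, where `|·|` is the `ℓ²`-norm on `ℂ^{L^∨ / L}`. -/
def peterssonIntegrand (𝔞 : FractionalIdeal (𝓞 F)⁰ F) (κ : ℕ) (τ : ℍ) : ℝ :=
  τ.im * ∑' h : DiscGroup σ σ' 𝔞 κ, ‖heckeTheta σ σ' 𝔞 κ τ h‖ ^ 2

/-- `‖ϑ_L‖²_Pet`: the integral of `v |ϑ_L(τ)|²` over the standard fundamental domain of `SL₂(ℤ)`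
with respect to the invariant measure `du dv / v²`, which is the volume of `ℍ`. -/
def peterssonNormSq (𝔞 : FractionalIdeal (𝓞 F)⁰ F) (κ : ℕ) : ℝ :=
  ∫ τ in 𝒟, peterssonIntegrand σ σ' 𝔞 κ τ

end Lattice

/-! ### The quadratic space of signature `(2, 2)` -/

/-- The bilinear form on `M₂(ℝ)` attached to the quadratic form `Q = det / N`. -/
def matBil (N : ℝ) (x y : Matrix (Fin 2) (Fin 2) ℝ) : ℝ :=
  ((x + y).det - x.det - y.det) / N

/-- `X(t)`. -/
def X (N t : ℝ) : Matrix (Fin 2) (Fin 2) ℝ :=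
  !![√N * Real.exp t, 0; 0, -(√N * Real.exp (-t))]

/-- `Y(t₀)`. -/
def Y (N t₀ : ℝ) : Matrix (Fin 2) (Fin 2) ℝ :=
  !![0, √N * Real.exp t₀; √N * Real.exp (-t₀), 0]

/-- `X^⊥(t)`. -/
def Xperp (N t : ℝ) : Matrix (Fin 2) (Fin 2) ℝ :=
  !![√N * Real.exp t, 0; 0, √N * Real.exp (-t)]

/-- `Y^⊥(t₀)`. -/
def Yperp (N t₀ : ℝ) : Matrix (Fin 2) (Fin 2) ℝ :=
  !![0, √N * Real.exp t₀; -(√N * Real.exp (-t₀)), 0]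

/-- `Q(x_{w^⊥})`, where `x_{w^⊥}` is the projection of `x` to the positive plane spanned by
`X^⊥(t)` and `Y^⊥(t₀)`. -/
def Qpos (N t t₀ : ℝ) (x : Matrix (Fin 2) (Fin 2) ℝ) : ℝ :=
  (matBil N x (Xperp N t) ^ 2 + matBil N x (Yperp N t₀) ^ 2) / 4

/-- `Q(x_w)`, where `x_w` is the projection of `x` to the negative plane spanned by
`X(t)` and `Y(t₀)`. -/
def Qneg (N t t₀ : ℝ) (x : Matrix (Fin 2) (Fin 2) ℝ) : ℝ :=
  -((matBil N x (X N t) ^ 2 + matBil N x (Y N t₀) ^ 2) / 4)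

/-- `φ_{τ,w}(x) = -(x, X(t)) (x, Y^⊥(t₀)) 𝐞(Q(x_{w^⊥}) τ + Q(x_w) τ̄)`.
For `x` with rows `(λ₁, λ₂)` and `(λ₂', λ₁')` the polynomial factor is
`(λ₁, Z(t)) (λ₂, Z(t₀))` in terms of the form on `F`. -/
def siegelTerm (N : ℝ) (τ : ℍ) (t t₀ : ℝ) (x : Matrix (Fin 2) (Fin 2) ℝ) : ℂ :=
  ((-(matBil N x (X N t) * matBil N x (Yperp N t₀)) : ℝ) : ℂ) *
    e ((Qpos N t t₀ x : ℂ) * (τ : ℂ) + (Qneg N t t₀ x : ℂ) * (starRingEnd ℂ) (τ : ℂ))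

section Invariant

variable {F : Type*} [Field F] [NumberField F] (σ σ' : F →+* ℝ)

/-- The lattice `M = M_{𝔞,κ}` of the matrices with rows `(λ₁, λ₂)` and `(λ₂', λ₁')`, where
`λ₁, λ₂ ∈ L^∨` and `λ₁ - λ₂ ∈ L`. -/
def latticeM (𝔞 : FractionalIdeal (𝓞 F)⁰ F) (κ : ℕ) : Set (Matrix (Fin 2) (Fin 2) ℝ) :=
  {x | ∃ l₁ ∈ dualLattice σ σ' 𝔞 κ, ∃ l₂ ∈ dualLattice σ σ' 𝔞 κ,
    l₁ - l₂ ∈ lattice 𝔞 ∧ x = !![σ l₁, σ l₂; σ' l₂, σ' l₁]}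

/-- The theta function `Θ_M(τ, t, t₀)` of signature `(2, 2)`. -/
def siegelTheta (𝔞 : FractionalIdeal (𝓞 F)⁰ F) (κ : ℕ) (τ : ℍ) (t t₀ : ℝ) : ℂ :=
  ∑' x : latticeM σ σ' 𝔞 κ, siegelTerm (levelN 𝔞 κ) τ t t₀ (x : Matrix (Fin 2) (Fin 2) ℝ)

/-- The integrand `v² Θ_M(τ, t, t₀)` of the theta lift. -/
def liftIntegrand (𝔞 : FractionalIdeal (𝓞 F)⁰ F) (κ : ℕ) (t t₀ : ℝ) (τ : ℍ) : ℂ :=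
  (τ.im : ℂ) ^ 2 * siegelTheta σ σ' 𝔞 κ τ t t₀

/-- The theta lift `Φ(w(t, t₀))`, an integral over `SL₂(ℤ) \ ℍ` with respect to `du dv / v²`. -/
def thetaLift (𝔞 : FractionalIdeal (𝓞 F)⁰ F) (κ : ℕ) (t t₀ : ℝ) : ℂ :=
  ∫ τ in 𝒟, liftIntegrand σ σ' 𝔞 κ t t₀ τ

/-- The cycle integral `I(t₀)` of the theta lift. -/
def cycleIntegral (𝔞 : FractionalIdeal (𝓞 F)⁰ F) (κ : ℕ) (t₀ : ℝ) : ℂ :=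
  ∫ t in (0 : ℝ)..Real.log (epsUnit σ σ' κ), thetaLift σ σ' 𝔞 κ t t₀

/-- `Ψ̃(𝔟, κ) = I(0)`, computed with the representative `𝔟` of a narrow ideal class. -/
def psiTilde (𝔟 : FractionalIdeal (𝓞 F)⁰ F) (κ : ℕ) : ℂ := cycleIntegral σ σ' 𝔟 κ 0

end Invariant

end HeckeTheta

end

noncomputable section

namespace HeckeTheta

open MeasureTheory Complex
open scoped Real

/-- The coordinate of `p` along the positive line, `(p, Z^⊥(t))` for the form `xy`. -/
def posCoord (p : ℝ × ℝ) (t : ℝ) : ℝ := p.1 * Real.exp (-t) + p.2 * Real.exp t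

/-- The coordinate of `p` along the negative line, `(p, Z(t))` for the form `xy`. -/
def negCoord (p : ℝ × ℝ) (t : ℝ) : ℝ := -(p.1 * Real.exp (-t)) + p.2 * Real.exp t

/-- The majorant of the form `xy` attached to `t`. -/
def majorant (p : ℝ × ℝ) (t : ℝ) : ℝ := (posCoord p t ^ 2 + negCoord p t ^ 2) / 2

/-- The squared Euclidean length. -/
def normSq2 (p : ℝ × ℝ) : ℝ := p.1 ^ 2 + p.2 ^ 2

/-- The exponential factor of the theta kernel of signature `(2, 2)`. -/
def pairExp (p q : ℝ × ℝ) (u v t s : ℝ) : ℂ :=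
  cexp (2 * π * I * u * ((q.1 * q.2 - p.1 * p.2 : ℝ) : ℂ) -
    ((π * v * (majorant p t + majorant q s) : ℝ) : ℂ))

lemma hasDerivAt_posCoord (p : ℝ × ℝ) (t : ℝ) :
    HasDerivAt (posCoord p) (negCoord p t) t := by
  have h1 : HasDerivAt (fun t : ℝ => Real.exp (-t)) (-Real.exp (-t)) t := by
    simpa using (hasDerivAt_neg t).exp
  have := (h1.const_mul p.1).add ((Real.hasDerivAt_exp t).const_mul p.2)
  convert! this using 1
  simp [negCoord]

lemma hasDerivAt_negCoord (p : ℝ × ℝ) (t : ℝ) :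
    HasDerivAt (negCoord p) (posCoord p t) t := by
  have h1 : HasDerivAt (fun t : ℝ => Real.exp (-t)) (-Real.exp (-t)) t := by
    simpa using (hasDerivAt_neg t).exp
  have := (h1.const_mul p.1).neg.add ((Real.hasDerivAt_exp t).const_mul p.2)
  convert! this using 1
  simp [posCoord]

lemma hasDerivAt_majorant (p : ℝ × ℝ) (t : ℝ) :
    HasDerivAt (majorant p) (2 * posCoord p t * negCoord p t) t := by
  have := (((hasDerivAt_posCoord p t).pow 2).add ((hasDerivAt_negCoord p t).pow 2)).div_const 2
  convert! this using 1
  ring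

lemma posCoord_sq_sub_negCoord_sq (p : ℝ × ℝ) (t : ℝ) :
    posCoord p t ^ 2 - negCoord p t ^ 2 = 4 * (p.1 * p.2) := by
  have : Real.exp (-t) * Real.exp t = 1 := by rw [← Real.exp_add]; simp
  simp only [posCoord, negCoord]
  linear_combination 4 * (p.1 * p.2) * this

lemma majorant_eq (p : ℝ × ℝ) (t : ℝ) :
    majorant p t = p.1 ^ 2 * Real.exp (-(2 * t)) + p.2 ^ 2 * Real.exp (2 * t) := by
  have h1 : Real.exp (2 * t) = Real.exp t ^ 2 := by rw [← Real.exp_nat_mul]; norm_num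
  have h2 : Real.exp (-(2 * t)) = Real.exp (-t) ^ 2 := by
    rw [← Real.exp_nat_mul]; congr 1; push_cast; ring
  rw [h1, h2]
  simp only [majorant, posCoord, negCoord]
  ring

lemma majorant_nonneg (p : ℝ × ℝ) (t : ℝ) : 0 ≤ majorant p t := by
  unfold majorant; positivity

lemma normSq2_nonneg (p : ℝ × ℝ) : 0 ≤ normSq2 p := by
  unfold normSq2; positivity

lemma le_majorant {R : ℝ} (p : ℝ × ℝ) {t : ℝ} (ht : |t| ≤ R) :
    Real.exp (-(2 * R)) * normSq2 p ≤ majorant p t := by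
  rw [majorant_eq, normSq2]
  have := abs_le.1 ht
  have h1 : Real.exp (-(2 * R)) ≤ Real.exp (-(2 * t)) := Real.exp_le_exp.2 (by linarith)
  have h2 : Real.exp (-(2 * R)) ≤ Real.exp (2 * t) := Real.exp_le_exp.2 (by linarith)
  nlinarith [sq_nonneg p.1, sq_nonneg p.2, mul_le_mul_of_nonneg_left h1 (sq_nonneg p.1),
    mul_le_mul_of_nonneg_left h2 (sq_nonneg p.2)]

lemma majorant_eq_zero {p : ℝ × ℝ} (hp : normSq2 p = 0) (t : ℝ) : majorant p t = 0 := by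
  have h1 : p.1 = 0 := by unfold normSq2 at hp; nlinarith [sq_nonneg p.1, sq_nonneg p.2]
  have h2 : p.2 = 0 := by unfold normSq2 at hp; nlinarith [sq_nonneg p.1, sq_nonneg p.2]
  simp [majorant_eq, h1, h2]

lemma norm_pairExp (p q : ℝ × ℝ) (u v t s : ℝ) :
    ‖pairExp p q u v t s‖ = Real.exp (-(π * v * (majorant p t + majorant q s))) := by
  rw [pairExp, Complex.norm_exp]
  congr 1
  simp [Complex.sub_re, Complex.mul_re]

/-! ### The three kernels and their derivatives -/

/-- The kernel of weight one in both variables. -/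
def wTerm (p q : ℝ × ℝ) (u v t s : ℝ) : ℂ :=
  ((posCoord p t * posCoord q s : ℝ) : ℂ) * pairExp p q u v t s

/-- The kernel whose `∂/∂τ` is, up to a `t`-derivative, the `s`-derivative of `wTerm`. -/
def kTerm (p q : ℝ × ℝ) (u v t s : ℝ) : ℂ :=
  ((v * (posCoord p t * negCoord q s) : ℝ) : ℂ) * pairExp p q u v t s

/-- The kernel with both polynomial factors taken along the negative lines. -/
def nTerm (p q : ℝ × ℝ) (u v t s : ℝ) : ℂ :=
  ((negCoord p t * negCoord q s : ℝ) : ℂ) * pairExp p q u v t s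

/-- `∂/∂s` of `wTerm`. -/
def wTermDs (p q : ℝ × ℝ) (u v t s : ℝ) : ℂ :=
  ((posCoord p t * negCoord q s * (1 - 2 * π * v * posCoord q s ^ 2) : ℝ) : ℂ) *
    pairExp p q u v t s

/-- `∂/∂t` of `nTerm`. -/
def nTermDt (p q : ℝ × ℝ) (u v t s : ℝ) : ℂ :=
  ((posCoord p t * negCoord q s * (1 - 2 * π * v * negCoord p t ^ 2) : ℝ) : ℂ) *
    pairExp p q u v t s

/-- `∂/∂u` of `kTerm`. -/
def kTermDu (p q : ℝ × ℝ) (u v t s : ℝ) : ℂ :=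
  ((v * (posCoord p t * negCoord q s) * (2 * π * (q.1 * q.2 - p.1 * p.2)) : ℝ) : ℂ) * I *
    pairExp p q u v t s

/-- `∂/∂v` of `kTerm`. -/
def kTermDv (p q : ℝ × ℝ) (u v t s : ℝ) : ℂ :=
  ((posCoord p t * negCoord q s * (1 - π * v * (majorant p t + majorant q s)) : ℝ) : ℂ) *
    pairExp p q u v t s

lemma wTermDs_add_nTermDt (p q : ℝ × ℝ) (u v t s : ℝ) :
    wTermDs p q u v t s + nTermDt p q u v t s =
      2 * I * (kTermDu p q u v t s - I * kTermDv p q u v t s) := by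
  have h1 := posCoord_sq_sub_negCoord_sq p t
  have h2 := posCoord_sq_sub_negCoord_sq q s
  have h1' : p.1 * p.2 = (posCoord p t ^ 2 - negCoord p t ^ 2) / 4 := by linarith
  have h2' : q.1 * q.2 = (posCoord q s ^ 2 - negCoord q s ^ 2) / 4 := by linarith
  simp only [wTermDs, nTermDt, kTermDu, kTermDv, h1', h2', majorant]
  push_cast
  linear_combination (
    (-2 * (posCoord p t : ℂ) * negCoord q s * pairExp p q u v t s *
      (v * π * ((posCoord q s : ℂ) ^ 2 - negCoord q s ^ 2 - posCoord p t ^ 2 + negCoord p t ^ 2)/2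
       - 1 + π * v * ((posCoord p t : ℂ) ^ 2 + negCoord p t ^ 2 + posCoord q s ^ 2
       + negCoord q s ^ 2) / 2))) * I_sq

lemma hasDerivAt_pairExp_s (p q : ℝ × ℝ) (u v t s : ℝ) :
    HasDerivAt (fun s => pairExp p q u v t s)
      (((-(2 * π * v * posCoord q s * negCoord q s) : ℝ) : ℂ) * pairExp p q u v t s) s := by
  have h := (((hasDerivAt_majorant q s).const_add (majorant p t)).const_mul (π * v)).ofReal_comp
  have := (h.const_sub (2 * π * I * u * ((q.1 * q.2 - p.1 * p.2 : ℝ) : ℂ))).cexp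
  convert! this using 1
  rw [pairExp]
  push_cast
  ring

lemma hasDerivAt_pairExp_t (p q : ℝ × ℝ) (u v t s : ℝ) :
    HasDerivAt (fun t => pairExp p q u v t s)
      (((-(2 * π * v * posCoord p t * negCoord p t) : ℝ) : ℂ) * pairExp p q u v t s) t := by
  have h := (((hasDerivAt_majorant p t).add_const (majorant q s)).const_mul (π * v)).ofReal_comp
  have := (h.const_sub (2 * π * I * u * ((q.1 * q.2 - p.1 * p.2 : ℝ) : ℂ))).cexp
  convert! this using 1
  rw [pairExp]
  push_cast
  ring

lemma hasDerivAt_wTerm (p q : ℝ × ℝ) (u v t s : ℝ) :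
    HasDerivAt (fun s => wTerm p q u v t s) (wTermDs p q u v t s) s := by
  have := (((hasDerivAt_posCoord q s).const_mul (posCoord p t)).ofReal_comp).mul
    (hasDerivAt_pairExp_s p q u v t s)
  convert! this using 1
  rw [wTermDs]
  push_cast
  ring

lemma hasDerivAt_nTerm (p q : ℝ × ℝ) (u v t s : ℝ) :
    HasDerivAt (fun t => nTerm p q u v t s) (nTermDt p q u v t s) t := by
  have := (((hasDerivAt_negCoord p t).mul_const (negCoord q s)).ofReal_comp).mul
    (hasDerivAt_pairExp_t p q u v t s)
  convert! this using 1
  rw [nTermDt]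
  push_cast
  ring

lemma hasFDerivAt_kTerm (p q : ℝ × ℝ) (z : ℝ × ℝ) (t s : ℝ) :
    HasFDerivAt (fun z : ℝ × ℝ => kTerm p q z.1 z.2 t s)
      ((ContinuousLinearMap.fst ℝ ℝ ℝ).smulRight (kTermDu p q z.1 z.2 t s) +
        (ContinuousLinearMap.snd ℝ ℝ ℝ).smulRight (kTermDv p q z.1 z.2 t s)) z := by
  have hu : HasFDerivAt (fun z : ℝ × ℝ => (z.1 : ℂ))
      (ofRealCLM.comp (ContinuousLinearMap.fst ℝ ℝ ℝ)) z :=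
    (ofRealCLM.comp (ContinuousLinearMap.fst ℝ ℝ ℝ)).hasFDerivAt
  have hv : HasFDerivAt (fun z : ℝ × ℝ => (z.2 : ℂ))
      (ofRealCLM.comp (ContinuousLinearMap.snd ℝ ℝ ℝ)) z :=
    (ofRealCLM.comp (ContinuousLinearMap.snd ℝ ℝ ℝ)).hasFDerivAt
  have he := ((hu.const_mul (2 * π * I * ((q.1 * q.2 - p.1 * p.2 : ℝ) : ℂ))).sub
    (hv.const_mul ((π * (majorant p t + majorant q s) : ℝ) : ℂ))).cexp
  have := (hv.mul_const ((posCoord p t * negCoord q s : ℝ) : ℂ)).mul he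
  refine (this.congr_fderiv ?_).congr_of_eventuallyEq (Filter.Eventually.of_forall fun z => ?_)
  · ext
    · simp [kTermDu, pairExp]
      ring_nf
    · simp [kTermDv, pairExp]
      ring_nf
  · simp only [kTerm, pairExp, Pi.mul_apply, Pi.sub_apply]
    push_cast
    ring_nf

/-! ### Bounds -/

/-- A common bound for the kernels and their derivatives. -/
def pairBound (p q : ℝ × ℝ) (v t s : ℝ) : ℝ :=
  13 * (1 + v) * (majorant p t + majorant q s) * (1 + v * (majorant p t + majorant q s)) *
    Real.exp (-(π * v * (majorant p t + majorant q s)))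

lemma posCoord_sq_le (p : ℝ × ℝ) (t : ℝ) : posCoord p t ^ 2 ≤ 2 * majorant p t := by
  unfold majorant; nlinarith [sq_nonneg (negCoord p t)]

lemma negCoord_sq_le (p : ℝ × ℝ) (t : ℝ) : negCoord p t ^ 2 ≤ 2 * majorant p t := by
  unfold majorant; nlinarith [sq_nonneg (posCoord p t)]

lemma abs_mul_le_half_add_sq {a b m n : ℝ} (ha : a ^ 2 ≤ 2 * m) (hb : b ^ 2 ≤ 2 * n) :
    |a * b| ≤ m + n := by
  rw [abs_le]; constructor <;> nlinarith [sq_nonneg (a + b), sq_nonneg (a - b)]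

lemma norm_mul_pairExp_le {p q : ℝ × ℝ} {u v t s x : ℝ}
    (hx : |x| ≤ 13 * (1 + v) * (majorant p t + majorant q s) *
      (1 + v * (majorant p t + majorant q s))) :
    ‖(x : ℂ) * pairExp p q u v t s‖ ≤ pairBound p q v t s := by
  rw [norm_mul, norm_pairExp, pairBound, Complex.norm_real, Real.norm_eq_abs]
  gcongr

lemma norm_wTerm_le (p q : ℝ × ℝ) {v : ℝ} (hv : 0 < v) (u t s : ℝ) :
    ‖wTerm p q u v t s‖ ≤ pairBound p q v t s := by
  refine norm_mul_pairExp_le ((abs_mul_le_half_add_sq (posCoord_sq_le p t)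
    (posCoord_sq_le q s)).trans ?_)
  have := majorant_nonneg p t
  have := majorant_nonneg q s
  set m := majorant p t + majorant q s
  have hm : 0 ≤ m := by positivity
  have : 0 ≤ v * m := by positivity
  nlinarith [mul_nonneg hm this, mul_nonneg this this, mul_nonneg hv.le (mul_nonneg this hm)]

lemma norm_nTerm_le (p q : ℝ × ℝ) {v : ℝ} (hv : 0 < v) (u t s : ℝ) :
    ‖nTerm p q u v t s‖ ≤ pairBound p q v t s := by
  refine norm_mul_pairExp_le ((abs_mul_le_half_add_sq (negCoord_sq_le p t)
    (negCoord_sq_le q s)).trans ?_)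
  have := majorant_nonneg p t
  have := majorant_nonneg q s
  set m := majorant p t + majorant q s
  have hm : 0 ≤ m := by positivity
  have : 0 ≤ v * m := by positivity
  nlinarith [mul_nonneg hm this, mul_nonneg this this, mul_nonneg hv.le (mul_nonneg this hm)]

lemma norm_kTerm_le (p q : ℝ × ℝ) {v : ℝ} (hv : 0 < v) (u t s : ℝ) :
    ‖kTerm p q u v t s‖ ≤ pairBound p q v t s := by
  refine norm_mul_pairExp_le ?_
  rw [abs_mul, abs_of_pos hv]
  refine (mul_le_mul_of_nonneg_left (abs_mul_le_half_add_sq (posCoord_sq_le p t)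
    (negCoord_sq_le q s)) hv.le).trans ?_
  have := majorant_nonneg p t
  have := majorant_nonneg q s
  set m := majorant p t + majorant q s
  have hm : 0 ≤ m := by positivity
  have : 0 ≤ v * m := by positivity
  nlinarith [mul_nonneg hm this, mul_nonneg this this, mul_nonneg hv.le (mul_nonneg this hm)]

lemma abs_one_sub_le {v m y : ℝ} (hv : 0 < v) (hy : 0 ≤ y) (hym : y ≤ 2 * m) :
    |1 - 2 * π * v * y| ≤ 13 * (1 + v * m) := by
  have := Real.pi_pos
  have h3 := Real.pi_lt_d2
  have h1 : 0 ≤ v * y := by positivity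
  have h2 : v * y ≤ 2 * (v * m) := by nlinarith
  rw [abs_le]; constructor <;> nlinarith

lemma norm_wTermDs_le (p q : ℝ × ℝ) {v : ℝ} (hv : 0 < v) (u t s : ℝ) :
    ‖wTermDs p q u v t s‖ ≤ pairBound p q v t s := by
  refine norm_mul_pairExp_le ?_
  have hp := majorant_nonneg p t
  have hq := majorant_nonneg q s
  have h1 := abs_mul_le_half_add_sq (posCoord_sq_le p t) (negCoord_sq_le q s)
  have h2 := abs_one_sub_le (m := majorant p t + majorant q s) hv (sq_nonneg (posCoord q s))
    (by linarith [posCoord_sq_le q s])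
  rw [abs_mul]
  set m := majorant p t + majorant q s
  have hm : 0 ≤ m := by positivity
  refine (mul_le_mul h1 h2 (abs_nonneg _) hm).trans ?_
  have : 0 ≤ v * m := by positivity
  nlinarith [mul_nonneg hm this, mul_nonneg this this, mul_nonneg hv.le (mul_nonneg this hm)]

lemma norm_nTermDt_le (p q : ℝ × ℝ) {v : ℝ} (hv : 0 < v) (u t s : ℝ) :
    ‖nTermDt p q u v t s‖ ≤ pairBound p q v t s := by
  refine norm_mul_pairExp_le ?_
  have hp := majorant_nonneg p t
  have hq := majorant_nonneg q s
  have h1 := abs_mul_le_half_add_sq (posCoord_sq_le p t) (negCoord_sq_le q s)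
  have h2 := abs_one_sub_le (m := majorant p t + majorant q s) hv (sq_nonneg (negCoord p t))
    (by linarith [negCoord_sq_le p t])
  rw [abs_mul]
  set m := majorant p t + majorant q s
  have hm : 0 ≤ m := by positivity
  refine (mul_le_mul h1 h2 (abs_nonneg _) hm).trans ?_
  have : 0 ≤ v * m := by positivity
  nlinarith [mul_nonneg hm this, mul_nonneg this this, mul_nonneg hv.le (mul_nonneg this hm)]

lemma norm_kTermDv_le (p q : ℝ × ℝ) {v : ℝ} (hv : 0 < v) (u t s : ℝ) :
    ‖kTermDv p q u v t s‖ ≤ pairBound p q v t s := by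
  refine norm_mul_pairExp_le ?_
  have hp := majorant_nonneg p t
  have hq := majorant_nonneg q s
  have h1 := abs_mul_le_half_add_sq (posCoord_sq_le p t) (negCoord_sq_le q s)
  rw [abs_mul]
  set m := majorant p t + majorant q s
  have hm : 0 ≤ m := by positivity
  have h2 := abs_one_sub_le (m := m) (y := m / 2) hv (by positivity) (by linarith)
  rw [show 2 * π * v * (m / 2) = π * v * m by ring] at h2
  refine (mul_le_mul h1 h2 (abs_nonneg _) hm).trans ?_
  have : 0 ≤ v * m := by positivity
  nlinarith [mul_nonneg hm this, mul_nonneg this this, mul_nonneg hv.le (mul_nonneg this hm)]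

lemma norm_kTermDu_le (p q : ℝ × ℝ) {v : ℝ} (hv : 0 < v) (u t s : ℝ) :
    ‖kTermDu p q u v t s‖ ≤ pairBound p q v t s := by
  rw [kTermDu, mul_right_comm, norm_mul, Complex.norm_I, mul_one]
  refine norm_mul_pairExp_le ?_
  have hp := majorant_nonneg p t
  have hq := majorant_nonneg q s
  have h1 := abs_mul_le_half_add_sq (posCoord_sq_le p t) (negCoord_sq_le q s)
  have e1 := posCoord_sq_sub_negCoord_sq p t
  have e2 := posCoord_sq_sub_negCoord_sq q s
  have h2 : |q.1 * q.2 - p.1 * p.2| ≤ majorant p t + majorant q s := by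
    have := posCoord_sq_le p t
    have := posCoord_sq_le q s
    have := negCoord_sq_le p t
    have := negCoord_sq_le q s
    rw [abs_le]
    constructor <;> nlinarith [sq_nonneg (posCoord p t), sq_nonneg (posCoord q s),
      sq_nonneg (negCoord p t), sq_nonneg (negCoord q s)]
  rw [abs_mul, abs_mul, abs_mul (2 * π), abs_of_pos hv, abs_of_pos Real.two_pi_pos]
  set m := majorant p t + majorant q s
  have hm : 0 ≤ m := by positivity
  have h3 : 2 * π ≤ 13 := by linarith [Real.pi_lt_d2]
  calc v * |posCoord p t * negCoord q s| * (2 * π * |q.1 * q.2 - p.1 * p.2|)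
      ≤ v * m * (13 * m) := by gcongr
    _ ≤ _ := by
      have : 0 ≤ v * m := by positivity
      nlinarith [mul_nonneg hm this, mul_nonneg this this, mul_nonneg hv.le (mul_nonneg this hm)]

lemma pairBound_eq_zero {p q : ℝ × ℝ} (h : normSq2 p + normSq2 q = 0) (v t s : ℝ) :
    pairBound p q v t s = 0 := by
  have hp := normSq2_nonneg p
  have hq := normSq2_nonneg q
  rw [pairBound, majorant_eq_zero (by linarith : normSq2 p = 0),
    majorant_eq_zero (by linarith : normSq2 q = 0)]
  simp

lemma pairBound_le {v₀ R δ : ℝ} (hv₀ : 0 < v₀) {p q : ℝ × ℝ}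
    (hpq : normSq2 p + normSq2 q = 0 ∨ δ ≤ normSq2 p + normSq2 q) {v t s : ℝ} (hv : v₀ ≤ v)
    (ht : |t| ≤ R) (hs : |s| ≤ R) :
    pairBound p q v t s ≤ 26 * (1 + 1 / v₀) *
      Real.exp (-(v₀ * Real.exp (-(2 * R)) * (normSq2 p + normSq2 q))) *
      Real.exp (-(Real.exp (-(2 * R)) * δ * v)) := by
  rcases hpq with h | h
  · rw [pairBound_eq_zero h]; positivity
  have hp := majorant_nonneg p t
  have hq := majorant_nonneg q s
  have h1 := le_majorant p ht
  have h2 := le_majorant q hs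
  rw [pairBound]
  set m := majorant p t + majorant q s
  set r := normSq2 p + normSq2 q
  set c := Real.exp (-(2 * R))
  have hc : 0 < c := Real.exp_pos _
  have hv' : 0 < v := hv₀.trans_le hv
  have hm : 0 ≤ m := by positivity
  have hr : 0 ≤ r := add_nonneg (normSq2_nonneg p) (normSq2_nonneg q)
  have hmr : c * r ≤ m := by simp only [r, m]; linarith
  have hvm : 0 ≤ v * m := by positivity
  have h5 : v * m * (1 + v * m) ≤ 2 * Real.exp (v * m) := by
    have := Real.quadratic_le_exp_of_nonneg hvm
    nlinarith
  have h6 : (1 + v) ≤ (1 + 1 / v₀) * v := by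
    have : 1 ≤ 1 / v₀ * v := by rw [one_div_mul_eq_div, le_div_iff₀ hv₀]; linarith
    linarith
  have h7 : Real.exp (v * m) * Real.exp (-(π * v * m)) ≤
      Real.exp (-(v₀ * c * r)) * Real.exp (-(c * δ * v)) := by
    rw [← Real.exp_add, ← Real.exp_add]
    apply Real.exp_le_exp.2
    have e1 : c * δ * v ≤ v * m := by nlinarith [mul_le_mul_of_nonneg_left h hc.le]
    have e2 : v₀ * c * r ≤ v * m := by
      calc v₀ * c * r = v₀ * (c * r) := by ring
        _ ≤ v * m := mul_le_mul hv hmr (by positivity) hv'.le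
    nlinarith [Real.pi_gt_three]
  calc 13 * (1 + v) * m * (1 + v * m) * Real.exp (-(π * v * m))
      ≤ 13 * ((1 + 1 / v₀) * v) * m * (1 + v * m) * Real.exp (-(π * v * m)) := by gcongr
    _ = 13 * (1 + 1 / v₀) * (v * m * (1 + v * m)) * Real.exp (-(π * v * m)) := by ring
    _ ≤ 13 * (1 + 1 / v₀) * (2 * Real.exp (v * m)) * Real.exp (-(π * v * m)) := by gcongr
    _ = 26 * (1 + 1 / v₀) * (Real.exp (v * m) * Real.exp (-(π * v * m))) := by ring
    _ ≤ 26 * (1 + 1 / v₀) * (Real.exp (-(v₀ * c * r)) * Real.exp (-(c * δ * v))) := by gcongr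
    _ = _ := by ring

/-- A family of pairs of vectors over which all Gaussian series converge. -/
def GaussSummable {ι : Type*} (p q : ι → ℝ × ℝ) : Prop :=
  ∀ c : ℝ, 0 < c → Summable fun i => Real.exp (-(c * (normSq2 (p i) + normSq2 (q i))))

lemma GaussSummable.exists_gap {ι : Type*} {p q : ι → ℝ × ℝ} (h : GaussSummable p q) :
    ∃ δ : ℝ, 0 < δ ∧ ∀ i, normSq2 (p i) + normSq2 (q i) = 0 ∨
      δ ≤ normSq2 (p i) + normSq2 (q i) := by
  set r : ι → ℝ := fun i => normSq2 (p i) + normSq2 (q i)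
  have hr : ∀ i, 0 ≤ r i := fun i => add_nonneg (normSq2_nonneg _) (normSq2_nonneg _)
  have hfin : {i | r i < 1}.Finite := by
    have h1 := (h 1 one_pos).tendsto_cofinite_zero
    have h2 := h1.eventually (gt_mem_nhds (Real.exp_pos (-1)))
    rw [Filter.eventually_cofinite] at h2
    refine h2.subset fun i hi => ?_
    simp only [Set.mem_ofPred_eq, not_lt] at hi ⊢
    exact Real.exp_le_exp.2 (by simp only [r] at hi; linarith)
  have hfin2 : (insert 1 (r '' {i | r i < 1 ∧ r i ≠ 0})).Finite :=
    ((hfin.subset fun i hi => hi.1).image r).insert 1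
  obtain ⟨δ, hδ, hmin⟩ := hfin2.exists_minimal ⟨1, Set.mem_insert _ _⟩
  have hle : ∀ x ∈ insert 1 (r '' {i | r i < 1 ∧ r i ≠ 0}), δ ≤ x := fun x hx => by
    rcases le_total δ x with h | h
    · exact h
    · exact hmin hx h
  refine ⟨δ, ?_, fun i => ?_⟩
  · rcases hδ with rfl | ⟨i, hi, rfl⟩
    · exact one_pos
    · exact lt_of_le_of_ne (hr i) (Ne.symm hi.2)
  · by_cases h0 : r i = 0
    · exact Or.inl h0
    · right
      by_cases h1 : r i < 1
      · exact hle _ (Set.mem_insert_of_mem _ ⟨i, ⟨h1, h0⟩, rfl⟩)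
      · exact (hle 1 (Set.mem_insert _ _)).trans (not_lt.1 h1)

lemma GaussSummable.exists_bound {ι : Type*} {p q : ι → ℝ × ℝ} (h : GaussSummable p q)
    {v₀ : ℝ} (hv₀ : 0 < v₀) (R : ℝ) :
    ∃ (g : ι → ℝ) (c : ℝ), Summable g ∧ (∀ i, 0 ≤ g i) ∧ 0 < c ∧ ∀ i v t s, v₀ ≤ v → |t| ≤ R →
      |s| ≤ R → pairBound (p i) (q i) v t s ≤ g i * Real.exp (-(c * v)) := by
  obtain ⟨δ, hδ, hgap⟩ := h.exists_gap
  exact ⟨fun i => 26 * (1 + 1 / v₀) * Real.exp (-(v₀ * Real.exp (-(2 * R)) *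
    (normSq2 (p i) + normSq2 (q i)))), Real.exp (-(2 * R)) * δ,
    (h _ (by positivity)).mul_left _, fun i => by positivity, by positivity,
    fun i v t s hv ht hs => pairBound_le hv₀ (hgap i) hv ht hs⟩

end HeckeTheta

end

noncomputable section

namespace HeckeTheta

open MeasureTheory Complex Set Filter Topology
open scoped Real

/-! ### Stokes' theorem on the standard fundamental domain -/

/-- The standard fundamental domain of `SL₂(ℤ)` as a subset of the plane. -/
def fdPlane : Set (ℝ × ℝ) := {z | |z.1| ≤ 1 / 2 ∧ 1 ≤ z.1 ^ 2 + z.2 ^ 2 ∧ 0 < z.2}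

/-- The lower boundary of the fundamental domain, as a graph. -/
def arc (u : ℝ) : ℝ := √(1 - u ^ 2)

lemma sq_arc {u : ℝ} (hu : |u| ≤ 1 / 2) : arc u ^ 2 = 1 - u ^ 2 := by
  rw [arc, Real.sq_sqrt]
  have := sq_abs u
  nlinarith [abs_nonneg u]

lemma half_lt_arc {u : ℝ} (hu : |u| ≤ 1 / 2) : 1 / 2 < arc u := by
  have := sq_abs u
  rw [arc]
  apply Real.lt_sqrt_of_sq_lt
  nlinarith [abs_nonneg u]

lemma arc_neg (u : ℝ) : arc (-u) = arc u := by simp [arc]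

lemma continuous_arc : Continuous arc := by unfold arc; fun_prop

lemma hasDerivAt_arc {u : ℝ} (hu : |u| ≤ 1 / 2) : HasDerivAt arc (-u / arc u) u := by
  have h0 : 1 - u ^ 2 ≠ 0 := by
    have := half_lt_arc hu
    have := sq_arc hu
    nlinarith
  have := (((hasDerivAt_id u).pow 2).const_sub 1).sqrt (by simpa using h0)
  convert! this using 1
  simp only [arc, id, Pi.pow_apply]
  field_simp
  norm_num
  ring

lemma measurableSet_fdPlane : MeasurableSet fdPlane := by
  have h1 : Measurable fun z : ℝ × ℝ => |z.1| := by fun_prop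
  have h2 : Measurable fun z : ℝ × ℝ => z.1 ^ 2 + z.2 ^ 2 := by fun_prop
  exact (measurableSet_le h1 measurable_const).inter
    ((measurableSet_le measurable_const h2).inter (measurableSet_lt measurable_const
      measurable_snd))

lemma half_lt_of_mem_fdPlane {z : ℝ × ℝ} (hz : z ∈ fdPlane) : 1 / 2 < z.2 := by
  obtain ⟨h1, h2, h3⟩ := hz
  have := sq_abs z.1
  nlinarith [abs_nonneg z.1]

lemma fdPlane_subset : fdPlane ⊆ Icc (-(1 / 2)) (1 / 2) ×ˢ Ioi (1 / 2) := fun _ hz =>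
  ⟨abs_le.1 hz.1, half_lt_of_mem_fdPlane hz⟩

lemma integrableOn_exp_strip (C : ℝ) {c : ℝ} (hc : 0 < c) :
    IntegrableOn (fun z : ℝ × ℝ => C * Real.exp (-(c * z.2)))
      (Icc (-(1 / 2)) (1 / 2) ×ˢ Ioi (1 / 2)) := by
  rw [IntegrableOn, Measure.volume_eq_prod, ← Measure.prod_restrict]
  have h1 : Integrable (fun _ : ℝ => C) (volume.restrict (Icc (-(1 / 2) : ℝ) (1 / 2))) :=
    integrable_const _
  have h2 : IntegrableOn (fun v : ℝ => Real.exp (-c * v)) (Ioi (1 / 2)) :=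
    integrableOn_exp_mul_Ioi (by linarith) _
  simpa [neg_mul] using! h1.mul_prod h2

lemma integrableOn_fdPlane {E : Type*} [NormedAddCommGroup E] {f : ℝ × ℝ → E} {C c : ℝ}
    (hc : 0 < c) (hf : ContinuousOn f {z | 1 / 2 < z.2})
    (hb : ∀ z : ℝ × ℝ, 1 / 2 < z.2 → ‖f z‖ ≤ C * Real.exp (-(c * z.2))) :
    IntegrableOn f fdPlane := by
  refine Integrable.mono' ((integrableOn_exp_strip C hc).mono_set fdPlane_subset) ?_ ?_
  · exact (hf.mono fun z hz => half_lt_of_mem_fdPlane hz).aestronglyMeasurable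
      measurableSet_fdPlane
  · exact (ae_restrict_iff' measurableSet_fdPlane).2
      (Eventually.of_forall fun z hz => hb z (half_lt_of_mem_fdPlane hz))

lemma setIntegral_fdPlane {f : ℝ × ℝ → ℂ} (hf : IntegrableOn f fdPlane) :
    ∫ z in fdPlane, f z =
      ∫ u in Icc (-(1 / 2) : ℝ) (1 / 2), ∫ s in Ioi (0 : ℝ), f (u, arc u + s) := by
  rw [← integral_indicator measurableSet_fdPlane, Measure.volume_eq_prod, integral_prod _
    ((integrable_indicator_iff measurableSet_fdPlane).2 hf),
    ← integral_indicator measurableSet_Icc]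
  congr 1
  ext u
  by_cases hu : u ∈ Icc (-(1 / 2) : ℝ) (1 / 2)
  · rw [indicator_of_mem hu]
    have hu' : |u| ≤ 1 / 2 := abs_le.2 hu
    have h1 : ∀ v, fdPlane.indicator f (u, v) = (Ici (arc u)).indicator (fun v => f (u, v)) v := by
      intro v
      have : (u, v) ∈ fdPlane ↔ v ∈ Ici (arc u) := by
        have h1 := half_lt_arc hu'
        have h2 := sq_arc hu'
        simp only [fdPlane, Set.mem_ofPred_eq, mem_Ici]
        constructor
        · rintro ⟨-, h3, h4⟩
          nlinarith
        · intro h3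
          exact ⟨hu', by nlinarith, by linarith⟩
      by_cases h : (u, v) ∈ fdPlane
      · rw [indicator_of_mem h, indicator_of_mem (this.1 h)]
      · rw [indicator_of_notMem h, indicator_of_notMem (fun h' => h (this.2 h'))]
    simp_rw [h1]
    rw [integral_indicator measurableSet_Ici, integral_Ici_eq_integral_Ioi]
    have := (measurePreserving_add_left volume (arc u)).setIntegral_preimage_emb
      (measurableEmbedding_addLeft _) (fun v => f (u, v)) (Ioi (arc u))
    simpa using this.symm
  · rw [indicator_of_notMem hu]
    have : ∀ v, fdPlane.indicator f (u, v) = 0 := fun v =>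
      indicator_of_notMem (fun h => hu (abs_le.1 h.1)) _
    simp [this]

/-- Stokes' theorem for the one-form `F dτ̄` on the standard fundamental domain of `SL₂(ℤ)`. -/
theorem integral_fdPlane_del_eq_zero {F Fu Fv : ℝ × ℝ → ℂ} {C c : ℝ} (hc : 0 < c)
    (hF : ∀ z : ℝ × ℝ, 1 / 2 < z.2 → HasFDerivAt F
      ((ContinuousLinearMap.fst ℝ ℝ ℝ).smulRight (Fu z) +
        (ContinuousLinearMap.snd ℝ ℝ ℝ).smulRight (Fv z)) z)
    (hFu : ContinuousOn Fu {z | 1 / 2 < z.2}) (hFv : ContinuousOn Fv {z | 1 / 2 < z.2})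
    (bF : ∀ z : ℝ × ℝ, 1 / 2 < z.2 → ‖F z‖ ≤ C * Real.exp (-(c * z.2)))
    (bFu : ∀ z : ℝ × ℝ, 1 / 2 < z.2 → ‖Fu z‖ ≤ C * Real.exp (-(c * z.2)))
    (bFv : ∀ z : ℝ × ℝ, 1 / 2 < z.2 → ‖Fv z‖ ≤ C * Real.exp (-(c * z.2)))
    (hT : ∀ u v, F (u + 1, v) = F (u, v))
    (hS : ∀ u v : ℝ, u ^ 2 + v ^ 2 = 1 → 0 < v → F (-u, v) = (u - I * v) ^ 2 * F (u, v)) :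
    ∫ z in fdPlane, (Fu z - I * Fv z) = 0 := by
  have hC : 0 ≤ C := by
    have := (norm_nonneg _).trans (bF (0, 1) (by norm_num))
    exact nonneg_of_mul_nonneg_left this (Real.exp_pos _)
  -- the derivatives of `F` in the coordinates `(u, v - arc u)`
  have hgu : ∀ u : ℝ, |u| ≤ 1 / 2 → ∀ s : ℝ, 0 < s → HasDerivAt (fun u => F (u, arc u + s))
      (Fu (u, arc u + s) + (-u / arc u : ℝ) * Fv (u, arc u + s)) u := by
    intro u hu s hs
    have h1 := half_lt_arc hu
    have := (hF (u, arc u + s) (by simp only; linarith)).comp_hasDerivAt u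
      ((hasDerivAt_id u).prodMk ((hasDerivAt_arc hu).add_const s))
    simpa using! this
  have hgs : ∀ u : ℝ, |u| ≤ 1 / 2 → ∀ s : ℝ, 0 ≤ s → HasDerivAt (fun s => F (u, arc u + s))
      (Fv (u, arc u + s)) s := by
    intro u hu s hs
    have h1 := half_lt_arc hu
    have := (hF (u, arc u + s) (by simp only; linarith)).comp_hasDerivAt s
      ((hasDerivAt_const s u).prodMk ((hasDerivAt_id s).const_add (arc u)))
    simpa using! this
  -- slices are integrable
  have hslice : ∀ {f : ℝ × ℝ → ℂ}, ContinuousOn f {z | 1 / 2 < z.2} →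
      (∀ z : ℝ × ℝ, 1 / 2 < z.2 → ‖f z‖ ≤ C * Real.exp (-(c * z.2))) →
      ∀ u : ℝ, |u| ≤ 1 / 2 → IntegrableOn (fun s => f (u, arc u + s)) (Ioi 0) := by
    intro f hf hb u hu
    have h1 := half_lt_arc hu
    refine Integrable.mono' ((integrableOn_exp_mul_Ioi (a := -c) (by linarith) 0).const_mul C)
      ?_ ?_
    · refine ContinuousOn.aestronglyMeasurable ?_ measurableSet_Ioi
      refine hf.comp (by fun_prop) fun s hs => ?_
      simp only [mem_Ioi, mem_ofPred_eq] at hs ⊢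
      linarith
    · refine (ae_restrict_iff' measurableSet_Ioi).2 (Eventually.of_forall fun s hs => ?_)
      simp only [mem_Ioi] at hs
      refine (hb _ (by simp only; linarith)).trans ?_
      refine mul_le_mul_of_nonneg_left (Real.exp_le_exp.2 ?_) hC
      simp only
      nlinarith
  have htend : ∀ u : ℝ, |u| ≤ 1 / 2 → Tendsto (fun s => F (u, arc u + s)) atTop (𝓝 0) := by
    intro u hu
    have h1 := half_lt_arc hu
    have hexp : Tendsto (fun s : ℝ => C * Real.exp (-(c * s))) atTop (𝓝 0) := by
      have := (Real.tendsto_exp_neg_atTop_nhds_zero.comp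
        (tendsto_id.const_mul_atTop hc)).const_mul C
      simpa using! this
    refine squeeze_zero_norm' ?_ hexp
    filter_upwards [eventually_gt_atTop 0] with s hs
    refine (bF _ (by simp only; linarith)).trans ?_
    refine mul_le_mul_of_nonneg_left (Real.exp_le_exp.2 ?_) hC
    simp only
    nlinarith
  have hvint : ∀ u : ℝ, |u| ≤ 1 / 2 →
      ∫ s in Ioi (0 : ℝ), Fv (u, arc u + s) = -F (u, arc u) := by
    intro u hu
    have := integral_Ioi_of_hasDerivAt_of_tendsto' (a := 0) (fun s hs => hgs u hu s hs)
      (hslice hFv bFv u hu) (htend u hu)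
    simpa using this
  set G : ℝ → ℝ → ℂ := fun u s => Fu (u, arc u + s) + (-u / arc u : ℝ) * Fv (u, arc u + s)
  set B : ℝ → ℂ := fun u => ((u / arc u : ℝ) - I) * F (u, arc u)
  have hinner : ∀ u ∈ Icc (-(1 / 2) : ℝ) (1 / 2),
      ∫ s in Ioi (0 : ℝ), (Fu (u, arc u + s) - I * Fv (u, arc u + s)) =
        (∫ s in Ioi (0 : ℝ), G u s) - B u := by
    intro u hu
    have hu' : |u| ≤ 1 / 2 := abs_le.2 hu
    have i1 := hslice hFu bFu u hu'
    have i2 := hslice hFv bFv u hu'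
    simp only [G, B]
    rw [integral_sub i1 (i2.const_mul _), integral_add i1 (i2.const_mul _),
      integral_const_mul, integral_const_mul, hvint u hu']
    push_cast
    ring
  have hint : IntegrableOn (fun z => Fu z - I * Fv z) fdPlane :=
    (integrableOn_fdPlane hc hFu bFu).sub ((integrableOn_fdPlane hc hFv bFv).const_mul _)
  -- the total `u`-derivative
  have hGcont : ContinuousOn (Function.uncurry G) (Icc (-(1 / 2)) (1 / 2) ×ˢ Ioi 0) := by
    have hm : MapsTo (fun z : ℝ × ℝ => (z.1, arc z.1 + z.2)) (Icc (-(1 / 2)) (1 / 2) ×ˢ Ioi 0)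
        {z | 1 / 2 < z.2} := by
      rintro ⟨u, s⟩ ⟨hu, hs⟩
      have := half_lt_arc (abs_le.2 hu)
      simp only [mem_Ioi, mem_ofPred_eq] at hs ⊢
      linarith
    have hcont : ContinuousOn (fun z : ℝ × ℝ => (z.1, arc z.1 + z.2))
        (Icc (-(1 / 2)) (1 / 2) ×ˢ Ioi 0) := by
      have := continuous_arc
      fun_prop
    refine (hFu.comp hcont hm).add (ContinuousOn.mul ?_ (hFv.comp hcont hm))
    refine continuous_ofReal.comp_continuousOn (ContinuousOn.div (by fun_prop)
      (continuous_arc.comp continuous_fst).continuousOn ?_)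
    rintro ⟨u, s⟩ ⟨hu, hs⟩
    have := half_lt_arc (abs_le.2 hu)
    simp only
    linarith
  have hGb : ∀ u s, |u| ≤ 1 / 2 → 0 < s → ‖G u s‖ ≤ 2 * C * Real.exp (-(c * s)) := by
    intro u s hu hs
    have h1 := half_lt_arc hu
    have h2 : C * Real.exp (-(c * (arc u + s))) ≤ C * Real.exp (-(c * s)) :=
      mul_le_mul_of_nonneg_left (Real.exp_le_exp.2 (by nlinarith)) hC
    have h3 := (bFu (u, arc u + s) (by simp only; linarith)).trans h2
    have h4 := (bFv (u, arc u + s) (by simp only; linarith)).trans h2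
    have h5 : ‖((-u / arc u : ℝ) : ℂ)‖ ≤ 1 := by
      rw [norm_real, Real.norm_eq_abs, abs_div, abs_neg, abs_of_pos (by linarith : 0 < arc u),
        div_le_one (by linarith)]
      linarith
    calc ‖G u s‖ ≤ ‖Fu (u, arc u + s)‖ + ‖((-u / arc u : ℝ) : ℂ)‖ * ‖Fv (u, arc u + s)‖ := by
          simp only [G]; rw [← norm_mul]; exact norm_add_le _ _
      _ ≤ C * Real.exp (-(c * s)) + 1 * (C * Real.exp (-(c * s))) := by gcongr
      _ = _ := by ring
  have hGint : Integrable (Function.uncurry G)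
      ((volume.restrict (Icc (-(1 / 2) : ℝ) (1 / 2))).prod (volume.restrict (Ioi (0 : ℝ)))) := by
    have h1 : Integrable (fun _ : ℝ => 2 * C) (volume.restrict (Icc (-(1 / 2) : ℝ) (1 / 2))) :=
      integrable_const _
    have h2 : IntegrableOn (fun v : ℝ => Real.exp (-c * v)) (Ioi 0) :=
      integrableOn_exp_mul_Ioi (by linarith) _
    refine Integrable.mono' (h1.mul_prod h2) ?_ ?_
    · rw [Measure.prod_restrict]
      exact hGcont.aestronglyMeasurable (measurableSet_Icc.prod measurableSet_Ioi)
    · rw [Measure.prod_restrict]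
      refine (ae_restrict_iff' (measurableSet_Icc.prod measurableSet_Ioi)).2
        (Eventually.of_forall fun z hz => ?_)
      have := hGb z.1 z.2 (abs_le.2 hz.1) hz.2
      simpa [Function.uncurry, neg_mul] using this
  have hGzero : ∫ u in Icc (-(1 / 2) : ℝ) (1 / 2), ∫ s in Ioi (0 : ℝ), G u s = 0 := by
    rw [integral_integral_swap hGint]
    refine (setIntegral_congr_fun measurableSet_Ioi (g := fun _ => 0) fun s hs => ?_).trans
      (by simp)
    simp only
    rw [integral_Icc_eq_integral_Ioc, ← intervalIntegral.integral_of_le (by norm_num),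
      intervalIntegral.integral_eq_sub_of_hasDerivAt (f := fun u => F (u, arc u + s))]
    · have h1 := hT (-(1 / 2)) (arc (1 / 2) + s)
      rw [arc_neg, ← h1]
      norm_num
    · intro u hu
      rw [uIcc_of_le (by norm_num)] at hu
      exact hgu u (abs_le.2 hu) s hs
    · refine ContinuousOn.intervalIntegrable ?_
      rw [uIcc_of_le (by norm_num)]
      exact hGcont.comp (f := fun u : ℝ => (u, s)) (by fun_prop) fun u hu => ⟨hu, hs⟩
  have hBcont : ContinuousOn B (Icc (-(1 / 2)) (1 / 2)) := by
    have hFc : ContinuousOn F {z | 1 / 2 < z.2} := fun z hz =>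
      (hF z hz).continuousAt.continuousWithinAt
    refine ContinuousOn.mul (ContinuousOn.sub (continuous_ofReal.comp_continuousOn
      (ContinuousOn.div (by fun_prop) continuous_arc.continuousOn ?_)) (by fun_prop)) ?_
    · intro u hu
      have := half_lt_arc (abs_le.2 hu)
      linarith
    · refine hFc.comp (f := fun u => (u, arc u)) ?_ fun u hu => half_lt_arc (abs_le.2 hu)
      have := continuous_arc
      fun_prop
  have hBzero : ∫ u in Icc (-(1 / 2) : ℝ) (1 / 2), B u = 0 := by
    rw [integral_Icc_eq_integral_Ioc, ← intervalIntegral.integral_of_le (by norm_num)]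
    have h1 : ∫ u in (-(1 / 2) : ℝ)..(1 / 2), B (-u) = ∫ u in (-(1 / 2) : ℝ)..(1 / 2), B u := by
      rw [intervalIntegral.integral_comp_neg]; simp
    have h2 : ∫ u in (-(1 / 2) : ℝ)..(1 / 2), B (-u) =
        ∫ u in (-(1 / 2) : ℝ)..(1 / 2), -B u := by
      refine intervalIntegral.integral_congr fun u hu => ?_
      rw [uIcc_of_le (by norm_num)] at hu
      have hu' : |u| ≤ 1 / 2 := abs_le.2 hu
      have h3 := half_lt_arc hu'
      have h4 := sq_arc hu'
      have h5 : (arc u : ℂ) ≠ 0 := by exact_mod_cast (by linarith : arc u ≠ 0)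
      have h6 : (arc u : ℂ) ^ 2 = 1 - (u : ℂ) ^ 2 := by exact_mod_cast h4
      simp only [B, arc_neg]
      rw [hS u (arc u) (by linarith) (by linarith)]
      push_cast
      field_simp
      have : (u : ℂ) ^ 2 + (arc u : ℂ) ^ 2 = 1 := by rw [h6]; ring
      have h7 : ((u : ℂ) + arc u * I) * (u - I * arc u) = 1 := by
        linear_combination this - (arc u : ℂ) ^ 2 * I_sq
      linear_combination (-(u - I * arc u) * F (u, arc u)) * h7
    rw [h1, intervalIntegral.integral_neg] at h2
    exact self_eq_neg.1 h2
  rw [setIntegral_fdPlane hint, setIntegral_congr_fun measurableSet_Icc hinner, integral_sub,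
    hGzero, hBzero, sub_zero]
  · exact hGint.integral_prod_left
  · exact hBcont.integrableOn_Icc

end HeckeTheta

end

noncomputable section

namespace HeckeTheta

open MeasureTheory Complex Set Filter Topology
open scoped Real

/-! ### Theta series attached to a family of pairs -/

/-- A kernel on pairs of vectors that is continuous in the parameters and dominated by
`pairBound`. -/
structure IsPairKernel (f : ℝ × ℝ → ℝ × ℝ → ℝ → ℝ → ℝ → ℝ → ℂ) : Prop where
  cont : ∀ p q, Continuous fun x : (ℝ × ℝ) × ℝ × ℝ => f p q x.1.1 x.1.2 x.2.1 x.2.2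
  bound : ∀ p q {v : ℝ}, 0 < v → ∀ u t s, ‖f p q u v t s‖ ≤ pairBound p q v t s

/-- The theta series of a kernel, as a function of `(u, v)` and `(t, s)`. -/
def pairTheta {ι : Type*} (f : ℝ × ℝ → ℝ × ℝ → ℝ → ℝ → ℝ → ℝ → ℂ) (p q : ι → ℝ × ℝ)
    (x : (ℝ × ℝ) × ℝ × ℝ) : ℂ :=
  ∑' i, f (p i) (q i) x.1.1 x.1.2 x.2.1 x.2.2

lemma continuous_posCoord (p : ℝ × ℝ) : Continuous (posCoord p) := by
  unfold posCoord; fun_prop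

lemma continuous_negCoord (p : ℝ × ℝ) : Continuous (negCoord p) := by
  unfold negCoord; fun_prop

lemma continuous_majorant (p : ℝ × ℝ) : Continuous (majorant p) := by
  have := continuous_posCoord p
  have := continuous_negCoord p
  unfold majorant; fun_prop

lemma continuous_pairExp (p q : ℝ × ℝ) :
    Continuous fun x : (ℝ × ℝ) × ℝ × ℝ => pairExp p q x.1.1 x.1.2 x.2.1 x.2.2 := by
  have := continuous_majorant p
  have := continuous_majorant q
  unfold pairExp; fun_prop

lemma continuous_real_mul_pairExp {g : (ℝ × ℝ) × ℝ × ℝ → ℝ} (hg : Continuous g) (p q : ℝ × ℝ) :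
    Continuous fun x : (ℝ × ℝ) × ℝ × ℝ =>
      (g x : ℂ) * pairExp p q x.1.1 x.1.2 x.2.1 x.2.2 :=
  (continuous_ofReal.comp hg).mul (continuous_pairExp p q)

lemma isPairKernel_wTerm : IsPairKernel wTerm where
  cont p q := by
    have := continuous_posCoord p
    have := continuous_posCoord q
    exact continuous_real_mul_pairExp (by fun_prop) p q
  bound p q _ hv := norm_wTerm_le p q hv

lemma isPairKernel_nTerm : IsPairKernel nTerm where
  cont p q := by
    have := continuous_negCoord p
    have := continuous_negCoord q
    exact continuous_real_mul_pairExp (by fun_prop) p q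
  bound p q _ hv := norm_nTerm_le p q hv

lemma isPairKernel_kTerm : IsPairKernel kTerm where
  cont p q := by
    have := continuous_posCoord p
    have := continuous_negCoord q
    exact continuous_real_mul_pairExp (by fun_prop) p q
  bound p q _ hv := norm_kTerm_le p q hv

lemma isPairKernel_wTermDs : IsPairKernel wTermDs where
  cont p q := by
    have := continuous_posCoord p
    have := continuous_posCoord q
    have := continuous_negCoord q
    exact continuous_real_mul_pairExp (by fun_prop) p q
  bound p q _ hv := norm_wTermDs_le p q hv

lemma isPairKernel_nTermDt : IsPairKernel nTermDt where
  cont p q := by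
    have := continuous_posCoord p
    have := continuous_negCoord p
    have := continuous_negCoord q
    exact continuous_real_mul_pairExp (by fun_prop) p q
  bound p q _ hv := norm_nTermDt_le p q hv

lemma isPairKernel_kTermDu : IsPairKernel kTermDu where
  cont p q := by
    have := continuous_posCoord p
    have := continuous_negCoord q
    have := continuous_pairExp p q
    unfold kTermDu
    fun_prop
  bound p q _ hv := norm_kTermDu_le p q hv

lemma isPairKernel_kTermDv : IsPairKernel kTermDv where
  cont p q := by
    have := continuous_posCoord p
    have := continuous_negCoord q
    have := continuous_majorant p
    have := continuous_majorant q
    exact continuous_real_mul_pairExp (by fun_prop) p q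
  bound p q _ hv := norm_kTermDv_le p q hv

variable {ι : Type*} {p q : ι → ℝ × ℝ} {f : ℝ × ℝ → ℝ × ℝ → ℝ → ℝ → ℝ → ℝ → ℂ}

lemma IsPairKernel.summable_norm (hf : IsPairKernel f) (h : GaussSummable p q) {v : ℝ}
    (hv : 0 < v) (u t s : ℝ) : Summable fun i => ‖f (p i) (q i) u v t s‖ := by
  obtain ⟨g, c, hg, -, -, hb⟩ := h.exists_bound hv (max |t| |s|)
  exact Summable.of_nonneg_of_le (fun i => norm_nonneg _) (fun i => (hf.bound _ _ hv u t s).trans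
    (hb i v t s le_rfl (le_max_left _ _) (le_max_right _ _))) (hg.mul_right _)

lemma IsPairKernel.summable (hf : IsPairKernel f) (h : GaussSummable p q) {v : ℝ}
    (hv : 0 < v) (u t s : ℝ) : Summable fun i => f (p i) (q i) u v t s :=
  (hf.summable_norm h hv u t s).of_norm

lemma IsPairKernel.exists_bound (hf : IsPairKernel f) (h : GaussSummable p q) {v₀ : ℝ}
    (hv₀ : 0 < v₀) (R : ℝ) :
    ∃ C c : ℝ, 0 ≤ C ∧ 0 < c ∧ ∀ x : (ℝ × ℝ) × ℝ × ℝ, v₀ ≤ x.1.2 → |x.2.1| ≤ R → |x.2.2| ≤ R →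
      ‖pairTheta f p q x‖ ≤ C * Real.exp (-(c * x.1.2)) := by
  obtain ⟨g, c, hg, hg0, hc, hb⟩ := h.exists_bound hv₀ R
  refine ⟨∑' i, g i, c, tsum_nonneg hg0, hc, fun x hv ht hs => ?_⟩
  rw [← tsum_mul_right]
  exact tsum_of_norm_bounded (hg.mul_right _).hasSum fun i =>
    (hf.bound _ _ (hv₀.trans_le hv) _ _ _).trans (hb i _ _ _ hv ht hs)

lemma IsPairKernel.continuousOn (hf : IsPairKernel f) (h : GaussSummable p q) :
    ContinuousOn (pairTheta f p q) {x | 0 < x.1.2} := by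
  intro x hx
  refine ContinuousAt.continuousWithinAt ?_
  have hx' : 0 < x.1.2 := hx
  set R := |x.2.1| + |x.2.2| + 1
  obtain ⟨g, c, hg, hg0, hc, hb⟩ := h.exists_bound (half_pos hx') R
  have hU : IsOpen {y : (ℝ × ℝ) × ℝ × ℝ | x.1.2 / 2 < y.1.2 ∧ |y.2.1| < R ∧ |y.2.2| < R} := by
    have c1 : Continuous fun y : (ℝ × ℝ) × ℝ × ℝ => y.1.2 := by fun_prop
    have c2 : Continuous fun y : (ℝ × ℝ) × ℝ × ℝ => |y.2.1| := by fun_prop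
    have c3 : Continuous fun y : (ℝ × ℝ) × ℝ × ℝ => |y.2.2| := by fun_prop
    exact (isOpen_lt continuous_const c1).inter
      ((isOpen_lt c2 continuous_const).inter (isOpen_lt c3 continuous_const))
  refine (continuousOn_tsum (fun i => (hf.cont (p i) (q i)).continuousOn) hg ?_).continuousAt
    (hU.mem_nhds ⟨?_, ?_, ?_⟩)
  · rintro i y ⟨h1, h2, h3⟩
    have h4 : 0 < y.1.2 := (half_pos hx').trans h1
    refine (hf.bound _ _ h4 _ _ _).trans ((hb i _ _ _ h1.le h2.le h3.le).trans ?_)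
    exact mul_le_of_le_one_right (hg0 i) (Real.exp_le_one_iff.2 (by nlinarith))
  · exact half_lt_self hx'
  · simp only [R]; linarith [abs_nonneg x.2.2]
  · simp only [R]; linarith [abs_nonneg x.2.1]

lemma IsPairKernel.integrable_prod (hf : IsPairKernel f) (h : GaussSummable p q)
    {S : Set (ℝ × ℝ)} (hS : MeasurableSet S) {R : ℝ}
    (hR : ∀ y ∈ S, |y.1| ≤ R ∧ |y.2| ≤ R) :
    Integrable (pairTheta f p q) ((volume.restrict fdPlane).prod (volume.restrict S)) := by
  obtain ⟨C, c, hC, hc, hb⟩ := hf.exists_bound h one_half_pos R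
  have hfin : volume S ≠ ⊤ := by
    refine (measure_mono_top (s₂ := Icc (-R) R ×ˢ Icc (-R) R) fun y hy => ?_).mt ?_
    · exact ⟨abs_le.1 (hR y hy).1, abs_le.1 (hR y hy).2⟩
    · exact (isCompact_Icc.prod isCompact_Icc).measure_lt_top.ne
  have h1 : Integrable (fun _ : ℝ × ℝ => (1 : ℝ)) (volume.restrict S) := by
    rw [← IntegrableOn, integrableOn_const_iff]
    exact Or.inr hfin.lt_top
  have h2 := ((integrableOn_exp_strip C hc).mono_set fdPlane_subset).integrable.mul_prod h1
  have hms := measurableSet_fdPlane.prod hS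
  rw [Measure.prod_restrict] at h2 ⊢
  refine Integrable.mono' h2 ?_ ?_
  · refine ContinuousOn.aestronglyMeasurable ((hf.continuousOn h).mono fun x hx => ?_) hms
    exact one_half_pos.trans (half_lt_of_mem_fdPlane hx.1)
  · refine (ae_restrict_iff' hms).2 (Eventually.of_forall fun x hx => ?_)
    simpa using hb x (half_lt_of_mem_fdPlane hx.1).le (hR _ hx.2).1 (hR _ hx.2).2

lemma IsPairKernel.integrable_prod_slice (hf : IsPairKernel f) (h : GaussSummable p q)
    (a b s : ℝ) : Integrable (fun x : (ℝ × ℝ) × ℝ => pairTheta f p q (x.1, x.2, s))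
      ((volume.restrict fdPlane).prod (volume.restrict (Ioc a b))) := by
  set R := max (max |a| |b|) |s|
  obtain ⟨C, c, hC, hc, hb⟩ := hf.exists_bound h one_half_pos R
  have h1 : Integrable (fun _ : ℝ => (1 : ℝ)) (volume.restrict (Ioc a b)) := integrable_const _
  have h2 := ((integrableOn_exp_strip C hc).mono_set fdPlane_subset).integrable.mul_prod h1
  have hms := measurableSet_fdPlane.prod (measurableSet_Ioc (a := a) (b := b))
  rw [Measure.prod_restrict] at h2 ⊢
  refine Integrable.mono' h2 ?_ ?_
  · refine ContinuousOn.aestronglyMeasurable ((hf.continuousOn h).comp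
      (f := fun x : (ℝ × ℝ) × ℝ => (x.1, x.2, s)) (by fun_prop) fun x hx => ?_) hms
    exact one_half_pos.trans (half_lt_of_mem_fdPlane hx.1)
  · refine (ae_restrict_iff' hms).2 (Eventually.of_forall fun x hx => ?_)
    have hx2 : |x.2| ≤ R := (abs_le_max_abs_abs hx.2.1.le hx.2.2).trans (le_max_left _ _)
    simpa using hb (x.1, x.2, s) (half_lt_of_mem_fdPlane hx.1).le hx2 (le_max_right _ _)

lemma IsPairKernel.integrableOn_fdPlane (hf : IsPairKernel f) (h : GaussSummable p q)
    (y : ℝ × ℝ) : IntegrableOn (fun z => pairTheta f p q (z, y)) fdPlane := by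
  obtain ⟨C, c, -, hc, hb⟩ := hf.exists_bound h one_half_pos (max |y.1| |y.2|)
  exact HeckeTheta.integrableOn_fdPlane hc ((hf.continuousOn h).comp (by fun_prop)
    fun z (hz : 1 / 2 < z.2) => one_half_pos.trans hz)
    fun z hz => hb (z, y) hz.le (le_max_left _ _) (le_max_right _ _)

lemma hasDerivAt_pairTheta_wTerm (h : GaussSummable p q) {z : ℝ × ℝ} (hz : 0 < z.2) (t s : ℝ) :
    HasDerivAt (fun s => pairTheta wTerm p q (z, t, s)) (pairTheta wTermDs p q (z, t, s)) s := by
  set R := |t| + |s| + 1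
  obtain ⟨g, c, hg, hg0, hc, hb⟩ := h.exists_bound hz R
  refine hasDerivAt_tsum_of_isPreconnected (hg.mul_right (Real.exp (-(c * z.2))))
    (isOpen_Ioo (a := -R) (b := R)) isPreconnected_Ioo
    (fun i y _ => hasDerivAt_wTerm (p i) (q i) z.1 z.2 t y) (fun i y hy => ?_) (y₀ := s) ?_
    (isPairKernel_wTerm.summable h hz _ _ _) ?_
  · refine (norm_wTermDs_le _ _ hz _ _ _).trans (hb i _ _ _ le_rfl ?_ (abs_lt.2 hy).le)
    simp only [R]; linarith [abs_nonneg s]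
  all_goals exact abs_lt.1 (by simp only [R]; linarith [abs_nonneg t])

lemma hasDerivAt_pairTheta_nTerm (h : GaussSummable p q) {z : ℝ × ℝ} (hz : 0 < z.2) (t s : ℝ) :
    HasDerivAt (fun t => pairTheta nTerm p q (z, t, s)) (pairTheta nTermDt p q (z, t, s)) t := by
  set R := |t| + |s| + 1
  obtain ⟨g, c, hg, hg0, hc, hb⟩ := h.exists_bound hz R
  refine hasDerivAt_tsum_of_isPreconnected (hg.mul_right (Real.exp (-(c * z.2))))
    (isOpen_Ioo (a := -R) (b := R)) isPreconnected_Ioo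
    (fun i y _ => hasDerivAt_nTerm (p i) (q i) z.1 z.2 y s) (fun i y hy => ?_) (y₀ := t) ?_
    (isPairKernel_nTerm.summable h hz _ _ _) ?_
  · refine (norm_nTermDt_le _ _ hz _ _ _).trans (hb i _ _ _ le_rfl (abs_lt.2 hy).le ?_)
    simp only [R]; linarith [abs_nonneg t]
  all_goals exact abs_lt.1 (by simp only [R]; linarith [abs_nonneg s])

lemma hasFDerivAt_pairTheta_kTerm (h : GaussSummable p q) {z : ℝ × ℝ} (hz : 0 < z.2) (t s : ℝ) :
    HasFDerivAt (fun z => pairTheta kTerm p q (z, t, s))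
      ((ContinuousLinearMap.fst ℝ ℝ ℝ).smulRight (pairTheta kTermDu p q (z, t, s)) +
        (ContinuousLinearMap.snd ℝ ℝ ℝ).smulRight (pairTheta kTermDv p q (z, t, s))) z := by
  set R := |t| + |s|
  obtain ⟨g, c, hg, hg0, hc, hb⟩ := h.exists_bound (half_pos hz) R
  have hpre : IsPreconnected {y : ℝ × ℝ | z.2 / 2 < y.2} := by
    have : {y : ℝ × ℝ | z.2 / 2 < y.2} = univ ×ˢ Ioi (z.2 / 2) := by ext; simp
    rw [this]
    exact isPreconnected_univ.prod isPreconnected_Ioi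
  have hmem : z ∈ {y : ℝ × ℝ | z.2 / 2 < y.2} := half_lt_self hz
  have key : ∀ (k : ℝ × ℝ → ℝ × ℝ → ℝ → ℝ → ℝ → ℝ → ℂ), IsPairKernel k →
      ∀ i, ∀ y ∈ {y : ℝ × ℝ | z.2 / 2 < y.2}, ‖k (p i) (q i) y.1 y.2 t s‖ ≤ g i := by
    intro k hk i y hy
    have hy' : 0 < y.2 := (half_pos hz).trans hy
    refine (hk.bound _ _ hy' _ _ _).trans ((hb i y.2 _ _ (le_of_lt hy)
      (by simp only [R]; linarith [abs_nonneg s])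
      (by simp only [R]; linarith [abs_nonneg t])).trans ?_)
    exact mul_le_of_le_one_right (hg0 i) (Real.exp_le_one_iff.2 (by nlinarith))
  have hfst : ‖ContinuousLinearMap.fst ℝ ℝ ℝ‖ ≤ 1 := ContinuousLinearMap.norm_fst_le ℝ ℝ ℝ
  have hsnd : ‖ContinuousLinearMap.snd ℝ ℝ ℝ‖ ≤ 1 := ContinuousLinearMap.norm_snd_le ℝ ℝ ℝ
  have hmain := hasFDerivAt_tsum_of_isPreconnected (hg.mul_left 2)
    (isOpen_lt continuous_const continuous_snd) hpre
    (fun i y _ => hasFDerivAt_kTerm (p i) (q i) y t s) (fun i y hy => ?_) hmem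
    (isPairKernel_kTerm.summable h hz _ _ _) hmem
  · refine hmain.congr_fderiv ?_
    have s1 := (isPairKernel_kTermDu.summable h hz z.1 t s).hasSum
    have s2 := (isPairKernel_kTermDv.summable h hz z.1 t s).hasSum
    have s3 := s1.mapL (ContinuousLinearMap.smulRightL ℝ (ℝ × ℝ) ℂ
      (ContinuousLinearMap.fst ℝ ℝ ℝ))
    have s4 := s2.mapL (ContinuousLinearMap.smulRightL ℝ (ℝ × ℝ) ℂ
      (ContinuousLinearMap.snd ℝ ℝ ℝ))
    exact (s3.add s4).tsum_eq
  · refine (norm_add_le _ _).trans ?_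
    rw [ContinuousLinearMap.norm_smulRight_apply, ContinuousLinearMap.norm_smulRight_apply,
      two_mul]
    exact add_le_add
      ((mul_le_of_le_one_left (norm_nonneg _) hfst).trans (key _ isPairKernel_kTermDu i y hy))
      ((mul_le_of_le_one_left (norm_nonneg _) hsnd).trans (key _ isPairKernel_kTermDv i y hy))

lemma pairTheta_wTermDs_add_nTermDt (h : GaussSummable p q) {x : (ℝ × ℝ) × ℝ × ℝ}
    (hx : 0 < x.1.2) :
    pairTheta wTermDs p q x + pairTheta nTermDt p q x =
      2 * I * (pairTheta kTermDu p q x - I * pairTheta kTermDv p q x) := by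
  simp only [pairTheta]
  rw [← (isPairKernel_wTermDs.summable h hx _ _ _).tsum_add
    (isPairKernel_nTermDt.summable h hx _ _ _), ← tsum_mul_left,
    ← (isPairKernel_kTermDu.summable h hx _ _ _).tsum_sub
    ((isPairKernel_kTermDv.summable h hx _ _ _).mul_left I), ← tsum_mul_left]
  exact tsum_congr fun i => wTermDs_add_nTermDt _ _ _ _ _ _

lemma kTerm_add_one {p q : ℝ × ℝ} (h : ∃ n : ℤ, q.1 * q.2 - p.1 * p.2 = n) (u v t s : ℝ) :
    kTerm p q (u + 1) v t s = kTerm p q u v t s := by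
  obtain ⟨n, hn⟩ := h
  simp only [kTerm, pairExp, hn]
  congr 1
  rw [show 2 * (π : ℂ) * I * ((u + 1 : ℝ) : ℂ) * ((n : ℝ) : ℂ) -
    ((π * v * (majorant p t + majorant q s) : ℝ) : ℂ) = 2 * (π : ℂ) * I * (u : ℂ) * ((n : ℝ) : ℂ) -
    ((π * v * (majorant p t + majorant q s) : ℝ) : ℂ) + n * (2 * π * I) by push_cast; ring]
  exact Complex.exp_periodic.int_mul n _

/-- The integral of the theta lift along a closed geodesic does not depend on the second
parameter. -/
theorem integral_pairTheta_wTerm_eq (h : GaussSummable p q)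
    (hQ : ∀ i, ∃ n : ℤ, (q i).1 * (q i).2 - (p i).1 * (p i).2 = n)
    (hS : ∀ u v t s : ℝ, u ^ 2 + v ^ 2 = 1 → 0 < v → pairTheta kTerm p q ((-u, v), t, s) =
      (u - I * v) ^ 2 * pairTheta kTerm p q ((u, v), t, s))
    {T : ℝ} (hT : 0 ≤ T)
    (hper : ∀ (z : ℝ × ℝ) (s : ℝ), pairTheta nTerm p q (z, T, s) = pairTheta nTerm p q (z, 0, s))
    {s₀ s₁ : ℝ} (hs : s₀ ≤ s₁) :
    ∫ z in fdPlane, ∫ t in (0 : ℝ)..T, pairTheta wTerm p q (z, t, s₁) =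
      ∫ z in fdPlane, ∫ t in (0 : ℝ)..T, pairTheta wTerm p q (z, t, s₀) := by
  set R := |T| + |s₀| + |s₁|
  set D : (ℝ × ℝ) × ℝ × ℝ → ℂ := fun x =>
    2 * I * (pairTheta kTermDu p q x - I * pairTheta kTermDv p q x) with hD
  set S : Set (ℝ × ℝ) := Ioc 0 T ×ˢ Ioc s₀ s₁
  have hSm : MeasurableSet S := measurableSet_Ioc.prod measurableSet_Ioc
  have hSR : ∀ y ∈ S, |y.1| ≤ R ∧ |y.2| ≤ R := by
    rintro y ⟨⟨h1, h2⟩, h3, h4⟩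
    constructor
    · rw [abs_le]
      constructor <;> simp only [R] <;>
        linarith [abs_nonneg s₀, abs_nonneg s₁, le_abs_self T, neg_abs_le T]
    · rw [abs_le]
      constructor <;> simp only [R] <;>
        linarith [abs_nonneg T, abs_nonneg s₀, abs_nonneg s₁, le_abs_self s₁, neg_abs_le s₀]
  -- joint integrability of slices in `(z, t)`
  have hWint : ∀ s : ℝ,
      IntegrableOn (fun z => ∫ t in (0 : ℝ)..T, pairTheta wTerm p q (z, t, s)) fdPlane := by
    intro s
    have := (isPairKernel_wTerm.integrable_prod_slice h 0 T s).integral_prod_left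
    simpa only [intervalIntegral.integral_of_le hT] using! this
  have hcW := (isPairKernel_wTerm.continuousOn h)
  have hcWs := (isPairKernel_wTermDs.continuousOn h)
  have hcNt := (isPairKernel_nTermDt.continuousOn h)
  have hcD : ContinuousOn D {x | 0 < x.1.2} := continuousOn_const.mul
    ((isPairKernel_kTermDu.continuousOn h).sub
      (continuousOn_const.mul (isPairKernel_kTermDv.continuousOn h)))
  -- pointwise identity in `z`
  have hpt : ∀ z : ℝ × ℝ, 0 < z.2 → (∫ t in (0 : ℝ)..T, pairTheta wTerm p q (z, t, s₁)) -
      ∫ t in (0 : ℝ)..T, pairTheta wTerm p q (z, t, s₀) = ∫ y in S, D (z, y) := by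
    intro z hz
    have hcz : ∀ {φ : (ℝ × ℝ) × ℝ × ℝ → ℂ}, ContinuousOn φ {x | 0 < x.1.2} →
        Continuous fun y : ℝ × ℝ => φ (z, y) := fun hφ =>
      hφ.comp_continuous (by fun_prop) fun _ => hz
    have hIS : ∀ {φ : ℝ × ℝ → ℂ}, Continuous φ → IntegrableOn φ S := fun hφ =>
      (hφ.continuousOn.integrableOn_compact (isCompact_Icc.prod isCompact_Icc)).mono_set
        (prod_mono Ioc_subset_Icc_self Ioc_subset_Icc_self)
    have hws : ∫ y in S, pairTheta wTermDs p q (z, y) =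
        (∫ t in (0 : ℝ)..T, pairTheta wTerm p q (z, t, s₁)) -
          ∫ t in (0 : ℝ)..T, pairTheta wTerm p q (z, t, s₀) := by
      rw [Measure.volume_eq_prod, setIntegral_prod _ (hIS (hcz hcWs)),
        ← intervalIntegral.integral_of_le hT, ← intervalIntegral.integral_sub]
      · refine intervalIntegral.integral_congr fun t _ => ?_
        rw [← intervalIntegral.integral_of_le hs]
        exact intervalIntegral.integral_eq_sub_of_hasDerivAt
          (fun s _ => hasDerivAt_pairTheta_wTerm h hz t s)
          (((hcz hcWs).comp (by fun_prop : Continuous fun s : ℝ => (t, s))).intervalIntegrable _ _)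
      · exact ((hcz hcW).comp (by fun_prop : Continuous fun t : ℝ => (t, s₁))).intervalIntegrable
          _ _
      · exact ((hcz hcW).comp (by fun_prop : Continuous fun t : ℝ => (t, s₀))).intervalIntegrable
          _ _
    have hnt : ∫ y in S, pairTheta nTermDt p q (z, y) = 0 := by
      rw [Measure.volume_eq_prod, setIntegral_prod _ (hIS (hcz hcNt)),
        integral_integral_swap]
      · have : ∀ s, ∫ t in Ioc 0 T, pairTheta nTermDt p q (z, t, s) = 0 := by
          intro s
          rw [← intervalIntegral.integral_of_le hT, intervalIntegral.integral_eq_sub_of_hasDerivAt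
            (fun t _ => hasDerivAt_pairTheta_nTerm h hz t s)
            (((hcz hcNt).comp
              (by fun_prop : Continuous fun t : ℝ => (t, s))).intervalIntegrable _ _), hper,
            sub_self]
        simp [this]
      · have := hIS (hcz hcNt)
        rw [IntegrableOn, Measure.volume_eq_prod, ← Measure.prod_restrict] at this
        exact this
    rw [← hws, ← add_zero (∫ y in S, pairTheta wTermDs p q (z, y)), ← hnt,
      ← integral_add (hIS (hcz hcWs)) (hIS (hcz hcNt))]
    exact integral_congr_ae (Eventually.of_forall fun y =>
      pairTheta_wTermDs_add_nTermDt h (x := (z, y)) hz)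
  -- Stokes for fixed `(t, s)`
  have hst : ∀ y : ℝ × ℝ, ∫ z in fdPlane, D (z, y) = 0 := by
    intro y
    obtain ⟨C₁, c₁, hC₁, hc₁, hb₁⟩ := isPairKernel_kTerm.exists_bound h one_half_pos
      (max |y.1| |y.2|)
    obtain ⟨C₂, c₂, hC₂, hc₂, hb₂⟩ := isPairKernel_kTermDu.exists_bound h one_half_pos
      (max |y.1| |y.2|)
    obtain ⟨C₃, c₃, hC₃, hc₃, hb₃⟩ := isPairKernel_kTermDv.exists_bound h one_half_pos
      (max |y.1| |y.2|)
    have hb : ∀ {C c : ℝ}, 0 ≤ C → C ≤ C₁ + C₂ + C₃ → min c₁ (min c₂ c₃) ≤ c →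
        ∀ v : ℝ, 1 / 2 < v → C * Real.exp (-(c * v)) ≤
          (C₁ + C₂ + C₃) * Real.exp (-(min c₁ (min c₂ c₃) * v)) := by
      intro C c h0 h1 h2 v hv
      refine mul_le_mul h1 (Real.exp_le_exp.2 ?_) (Real.exp_pos _).le (by positivity)
      nlinarith
    have hcy : ∀ {φ : (ℝ × ℝ) × ℝ × ℝ → ℂ}, ContinuousOn φ {x | 0 < x.1.2} →
        ContinuousOn (fun z : ℝ × ℝ => φ (z, y)) {z | 1 / 2 < z.2} := fun hφ =>
      hφ.comp (by fun_prop) fun z (hz : 1 / 2 < z.2) => one_half_pos.trans hz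
    have := integral_fdPlane_del_eq_zero (F := fun z => pairTheta kTerm p q (z, y))
      (Fu := fun z => pairTheta kTermDu p q (z, y)) (Fv := fun z => pairTheta kTermDv p q (z, y))
      (C := C₁ + C₂ + C₃) (lt_min hc₁ (lt_min hc₂ hc₃))
      (fun z hz => hasFDerivAt_pairTheta_kTerm h (one_half_pos.trans hz) y.1 y.2)
      (hcy (isPairKernel_kTermDu.continuousOn h)) (hcy (isPairKernel_kTermDv.continuousOn h))
      (fun z hz => (hb₁ (z, y) hz.le (le_max_left _ _) (le_max_right _ _)).trans
        (hb hC₁ (by linarith) (min_le_left _ _) _ hz))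
      (fun z hz => (hb₂ (z, y) hz.le (le_max_left _ _) (le_max_right _ _)).trans
        (hb hC₂ (by linarith) ((min_le_right _ _).trans (min_le_left _ _)) _ hz))
      (fun z hz => (hb₃ (z, y) hz.le (le_max_left _ _) (le_max_right _ _)).trans
        (hb hC₃ (by linarith) ((min_le_right _ _).trans (min_le_right _ _)) _ hz))
      (fun u v => tsum_congr fun i => kTerm_add_one (hQ i) u v y.1 y.2)
      (fun u v huv hv => hS u v y.1 y.2 huv hv)
    rw [hD, integral_const_mul, this, mul_zero]
  rw [← sub_eq_zero, ← integral_sub (hWint s₁) (hWint s₀),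
    setIntegral_congr_fun measurableSet_fdPlane (fun z hz => hpt z hz.2.2),
    integral_integral_swap (f := fun z y => D (z, y))]
  · simp [hst]
  · exact (((isPairKernel_kTermDu.integrable_prod h hSm hSR).sub
      ((isPairKernel_kTermDv.integrable_prod h hSm hSR).const_mul I)).const_mul (2 * I))

end HeckeTheta

end

noncomputable section

namespace HeckeTheta

open MeasureTheory Complex Set Filter Topology
open scoped Real FourierTransform

/-! ### Poisson summation in the plane -/

lemma summable_inv_one_add_int_sq : Summable fun n : ℤ => (1 + (n : ℝ) ^ 2)⁻¹ := by
  have h1 : Summable fun n : ℤ => |(n : ℝ)| ^ (-2 : ℝ) := Real.summable_abs_int_rpow one_lt_two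
  refine Summable.of_norm_bounded_eventually h1 ?_
  refine (Set.finite_singleton (0 : ℤ)).subset fun n hn => ?_
  by_contra h0
  apply hn
  have h0' : (n : ℝ) ≠ 0 := by exact_mod_cast h0
  change ‖_‖ ≤ |(n : ℝ)| ^ (-2 : ℝ)
  rw [Real.rpow_neg (abs_nonneg _), Real.rpow_two, sq_abs, Real.norm_eq_abs,
    abs_of_pos (by positivity)]
  gcongr
  linarith

lemma isBigO_of_le_inv_one_add_sq {f : ℝ → ℂ} {C : ℝ}
    (hb : ∀ x, ‖f x‖ ≤ C * (1 + x ^ 2)⁻¹) :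
    f =O[cocompact ℝ] fun x : ℝ => |x| ^ (-2 : ℝ) := by
  have hC : 0 ≤ C := by simpa using (norm_nonneg _).trans (hb 0)
  refine Asymptotics.IsBigO.of_bound C ?_
  have : ∀ᶠ x : ℝ in cocompact ℝ, x ≠ 0 := by
    have := (isCompact_singleton (x := (0 : ℝ))).compl_mem_cocompact
    filter_upwards [this] with x hx using hx
  filter_upwards [this] with x hx
  refine (hb x).trans (mul_le_mul_of_nonneg_left ?_ hC)
  rw [Real.rpow_neg (abs_nonneg _), Real.rpow_two, sq_abs, Real.norm_eq_abs,
    abs_of_pos (by positivity)]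
  have : 0 < x ^ 2 := by positivity
  gcongr
  linarith

lemma tsum_int_eq_tsum_fourier {f : ℝ → ℂ} (hc : Continuous f) {C : ℝ}
    (hb : ∀ x, ‖f x‖ ≤ C * (1 + x ^ 2)⁻¹) (hs : Summable fun n : ℤ => 𝓕 f n) :
    ∑' n : ℤ, f n = ∑' n : ℤ, 𝓕 f n := by
  have := Real.tsum_eq_tsum_fourier_of_rpow_decay_of_summable hc one_lt_two
    (isBigO_of_le_inv_one_add_sq hb) hs 0
  simpa using this

lemma fourier_int_eq (f : ℝ → ℂ) (n : ℤ) :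
    𝓕 f n = ∫ x : ℝ, f x * cexp (-(2 * π * I * (n * x))) := by
  rw [Real.fourier_real_eq_integral_exp_smul]
  congr 1
  ext x
  rw [smul_eq_mul, mul_comm]
  congr 2
  push_cast
  ring

lemma norm_cexp_neg_two_pi (n : ℤ) (x : ℝ) : ‖cexp (-(2 * π * I * (n * x)))‖ = 1 := by
  rw [show -(2 * (π : ℂ) * I * (n * x)) = ((-(2 * π * (n * x)) : ℝ) : ℂ) * I by push_cast; ring]
  exact Complex.norm_exp_ofReal_mul_I _

/-- The Fourier coefficients of a function on the plane. -/
def planeFourier (F : ℝ × ℝ → ℂ) (n : ℤ × ℤ) : ℂ :=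
  ∫ z : ℝ × ℝ, F z * cexp (-(2 * π * I * (n.1 * z.1 + n.2 * z.2)))

/-- Poisson summation for `ℤ²` in `ℝ²`. -/
theorem tsum_int_prod_eq_tsum_planeFourier {F : ℝ × ℝ → ℂ} (hc : Continuous F) {C : ℝ}
    (hb : ∀ x y, ‖F (x, y)‖ ≤ C * ((1 + x ^ 2)⁻¹ * (1 + y ^ 2)⁻¹))
    (hs : Summable (planeFourier F)) :
    ∑' n : ℤ × ℤ, F (n.1, n.2) = ∑' n : ℤ × ℤ, planeFourier F n := by
  have hC : 0 ≤ C := by simpa using (norm_nonneg _).trans (hb 0 0)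
  set S := ∑' n : ℤ, (1 + (n : ℝ) ^ 2)⁻¹
  have hinv : ∀ y : ℝ, (1 + y ^ 2)⁻¹ ≤ 1 := fun y => inv_le_one_of_one_le₀ (by nlinarith)
  have hpos : ∀ y : ℝ, 0 < (1 + y ^ 2)⁻¹ := fun y => by positivity
  have hFint : Integrable F := by
    refine Integrable.mono' ((integrable_inv_one_add_sq.const_mul C).mul_prod
      integrable_inv_one_add_sq) hc.aestronglyMeasurable (Eventually.of_forall fun z => ?_)
    rw [mul_assoc]
    exact hb z.1 z.2
  -- summation over the second variable
  set g : ℝ → ℂ := fun x => ∑' n : ℤ, F (x, n)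
  have hgc : Continuous g := by
    refine continuous_tsum (fun n => by fun_prop)
      (summable_inv_one_add_int_sq.mul_left C) fun n x => (hb x n).trans ?_
    exact mul_le_mul_of_nonneg_left (mul_le_of_le_one_left (hpos _).le (hinv x)) hC
  have hgb : ∀ x, ‖g x‖ ≤ C * S * (1 + x ^ 2)⁻¹ := by
    intro x
    have := tsum_of_norm_bounded (f := fun n : ℤ => F (x, n))
      ((summable_inv_one_add_int_sq.mul_left (C * (1 + x ^ 2)⁻¹))).hasSum
      fun n => (hb x n).trans_eq (by ring)
    refine this.trans_eq ?_
    rw [tsum_mul_left]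
    ring
  -- the partial Fourier transform
  set F₁ : ℤ → ℝ → ℂ := fun j y => ∫ x : ℝ, F (x, y) * cexp (-(2 * π * I * (j * x)))
  have hF₁c : ∀ j, Continuous (F₁ j) := by
    intro j
    refine continuous_of_dominated (bound := fun x => C * (1 + x ^ 2)⁻¹)
      (fun y => by fun_prop) (fun y => Eventually.of_forall fun x => ?_)
      (integrable_inv_one_add_sq.const_mul C) (Eventually.of_forall fun x => by fun_prop)
    rw [norm_mul, norm_cexp_neg_two_pi, mul_one]
    exact (hb x y).trans (mul_le_mul_of_nonneg_left
      (mul_le_of_le_one_right (hpos _).le (hinv y)) hC)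
  have hF₁b : ∀ j y, ‖F₁ j y‖ ≤ C * π * (1 + y ^ 2)⁻¹ := by
    intro j y
    refine (norm_integral_le_of_norm_le (integrable_inv_one_add_sq.const_mul
      (C * (1 + y ^ 2)⁻¹)) (Eventually.of_forall fun x => ?_)).trans_eq ?_
    · rw [norm_mul, norm_cexp_neg_two_pi, mul_one]
      exact (hb x y).trans_eq (by ring)
    · rw [integral_const_mul, integral_univ_inv_one_add_sq]
      ring
  have hF₁F : ∀ j k : ℤ, 𝓕 (F₁ j) k = planeFourier F (j, k) := by
    intro j k
    have hint : Integrable (fun z : ℝ × ℝ => F z * cexp (-(2 * π * I * (j * z.1 + k * z.2)))) := by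
      refine hFint.mono (by fun_prop) (Eventually.of_forall fun z => le_of_eq ?_)
      rw [norm_mul, mul_add, neg_add, Complex.exp_add, norm_mul, norm_cexp_neg_two_pi,
        norm_cexp_neg_two_pi, mul_one, mul_one]
    rw [fourier_int_eq, planeFourier, Measure.volume_eq_prod, integral_prod_symm _ hint]
    congr 1
    ext y
    simp only [F₁]
    rw [← integral_mul_const]
    congr 1
    ext x
    rw [mul_assoc, ← Complex.exp_add]
    ring_nf
  have hgF : ∀ j : ℤ, 𝓕 g j = ∑' k : ℤ, planeFourier F (j, k) := by
    intro j
    have h1 : 𝓕 g j = ∑' n : ℤ, F₁ j n := by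
      rw [fourier_int_eq]
      simp only [g, ← tsum_mul_right]
      have hdom : ∀ n : ℤ, Integrable fun x : ℝ => F (x, n) * cexp (-(2 * π * I * (j * x))) := by
        intro n
        refine Integrable.mono' (integrable_inv_one_add_sq.const_mul C) (by fun_prop)
          (Eventually.of_forall fun x => ?_)
        rw [norm_mul, norm_cexp_neg_two_pi, mul_one]
        exact (hb x n).trans (mul_le_mul_of_nonneg_left
          (mul_le_of_le_one_right (hpos _).le (hinv _)) hC)
      rw [← integral_tsum_of_summable_integral_norm hdom]
      refine Summable.of_nonneg_of_le (fun n => integral_nonneg fun x => norm_nonneg _)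
        (fun n => ?_) (summable_inv_one_add_int_sq.mul_left (C * π))
      have h2 : ∀ x : ℝ, ‖F (x, n) * cexp (-(2 * π * I * (j * x)))‖ ≤
          C * (1 + (n : ℝ) ^ 2)⁻¹ * (1 + x ^ 2)⁻¹ := fun x => by
        rw [norm_mul, norm_cexp_neg_two_pi, mul_one]
        exact (hb x n).trans_eq (by ring)
      refine (integral_mono (hdom n).norm (integrable_inv_one_add_sq.const_mul _) h2).trans_eq ?_
      rw [integral_const_mul, integral_univ_inv_one_add_sq]
      ring
    rw [h1, tsum_int_eq_tsum_fourier (hF₁c j) (hF₁b j)]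
    · simp_rw [hF₁F]
    · simp_rw [hF₁F]
      exact hs.prod_factor j
  have hFsum : Summable fun n : ℤ × ℤ => F (n.1, n.2) := by
    refine Summable.of_norm_bounded (g := fun n : ℤ × ℤ =>
      C * ((1 + (n.1 : ℝ) ^ 2)⁻¹ * (1 + (n.2 : ℝ) ^ 2)⁻¹)) ?_ fun n => hb _ _
    exact (summable_inv_one_add_int_sq.mul_of_nonneg summable_inv_one_add_int_sq
      (fun n => (hpos _).le) (fun n => (hpos _).le)).mul_left C
  rw [hFsum.tsum_prod, hs.tsum_prod]
  simp_rw [← hgF]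
  refine tsum_int_eq_tsum_fourier hgc hgb ?_
  simp_rw [hgF]
  exact hs.prod

end HeckeTheta

end

noncomputable section

namespace HeckeTheta

open MeasureTheory Complex Set Filter Topology
open scoped Real

/-! ### Moments of Gaussians -/

/-- The Gaussian `exp(-b x² + c x)`. -/
def gauss (b : ℝ) (c : ℂ) (x : ℝ) : ℂ := cexp (-b * x ^ 2 + c * x)

lemma integrable_gauss {b : ℝ} (hb : 0 < b) (c : ℂ) : Integrable (gauss b c) := by
  have := integrable_cexp_quadratic (b := (b : ℂ)) (by simpa using hb) c 0
  simp only [add_zero] at this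
  exact this

lemma integrable_mul_gauss {b : ℝ} (hb : 0 < b) (c : ℂ) {f : ℝ → ℂ} (hf : Continuous f)
    (hfb : ∀ x, ‖f x‖ ≤ 1 + x ^ 2) : Integrable fun x => f x * gauss b c x := by
  have h1 : ∀ x : ℝ, f x * gauss b c x =
      (f x * ((Real.exp (-(b / 2 * x ^ 2)) : ℝ) : ℂ)) * gauss (b / 2) c x := by
    intro x
    rw [mul_assoc, gauss, gauss, Complex.ofReal_exp, ← Complex.exp_add]
    congr 2
    push_cast
    ring
  simp_rw [h1]
  refine (integrable_gauss (half_pos hb) c).bdd_mul (c := 1 + 2 / b)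
    (Continuous.aestronglyMeasurable (by fun_prop)) (Eventually.of_forall fun x => ?_)
  rw [norm_mul, norm_real, Real.norm_eq_abs, abs_of_pos (Real.exp_pos _), Real.exp_neg,
    ← div_eq_mul_inv, div_le_iff₀ (Real.exp_pos _)]
  refine (hfb x).trans ?_
  have h2 := Real.add_one_le_exp (b / 2 * x ^ 2)
  have h3 : 1 + x ^ 2 ≤ (1 + 2 / b) * (b / 2 * x ^ 2 + 1) := by
    have : (1 + 2 / b) * (b / 2 * x ^ 2 + 1) = 1 + x ^ 2 + (b / 2 * x ^ 2 + 2 / b) := by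
      field_simp
      ring
    rw [this]
    have : 0 ≤ b / 2 * x ^ 2 + 2 / b := by positivity
    linarith
  exact h3.trans (by gcongr)

lemma integrable_id_mul_gauss {b : ℝ} (hb : 0 < b) (c : ℂ) :
    Integrable fun x : ℝ => (x : ℂ) * gauss b c x :=
  integrable_mul_gauss hb c continuous_ofReal fun x => by
    rw [norm_real, Real.norm_eq_abs, ← sq_abs]
    nlinarith [sq_nonneg (|x| - 1)]

lemma integrable_sq_mul_gauss {b : ℝ} (hb : 0 < b) (c : ℂ) :
    Integrable fun x : ℝ => (x : ℂ) ^ 2 * gauss b c x :=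
  integrable_mul_gauss hb c (by fun_prop) fun x => by
    rw [norm_pow, norm_real, Real.norm_eq_abs, sq_abs]
    linarith

lemma hasDerivAt_gauss (b : ℝ) (c : ℂ) (x : ℝ) :
    HasDerivAt (gauss b c) ((-2 * b * x + c) * gauss b c x) x := by
  have h0 : HasDerivAt (fun x : ℝ => (x : ℂ)) 1 x := Complex.ofRealCLM.hasDerivAt
  have := (((h0.pow 2).const_mul (-(b : ℂ))).add (h0.const_mul c)).cexp
  convert! this using 1
  simp only [gauss, Pi.add_apply, Pi.pow_apply]
  push_cast
  ring

lemma integral_gauss {b : ℝ} (hb : 0 < b) (c : ℂ) :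
    ∫ x, gauss b c x = ((√(π / b) : ℝ) : ℂ) * cexp (c ^ 2 / (4 * b)) := by
  have := integral_cexp_quadratic (b := -(b : ℂ)) (by simpa using hb) c 0
  simp only [add_zero, neg_neg, zero_sub] at this
  simp only [gauss]
  rw [this, Real.sqrt_eq_rpow, Complex.ofReal_cpow (by positivity)]
  push_cast
  congr 2
  rw [mul_neg, div_neg, neg_neg]

lemma integral_id_mul_gauss {b : ℝ} (hb : 0 < b) (c : ℂ) :
    ∫ x : ℝ, (x : ℂ) * gauss b c x = c / (2 * b) * ∫ x, gauss b c x := by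
  have i0 := integrable_gauss hb c
  have i1 := integrable_id_mul_gauss hb c
  have hb' : (b : ℂ) ≠ 0 := by exact_mod_cast hb.ne'
  have e : (fun x : ℝ => (-2 * b * x + c) * gauss b c x) =
      fun x : ℝ => (-2 * b : ℂ) * (x * gauss b c x) + c * gauss b c x := by ext x; ring
  have h := integral_eq_zero_of_hasDerivAt_of_integrable (hasDerivAt_gauss b c)
    (by rw [e]; exact (i1.const_mul _).add (i0.const_mul _)) i0
  rw [e, integral_add (i1.const_mul _) (i0.const_mul _), integral_const_mul,
    integral_const_mul] at h
  field_simp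
  linear_combination -h

lemma integral_sq_mul_gauss {b : ℝ} (hb : 0 < b) (c : ℂ) :
    ∫ x : ℝ, (x : ℂ) ^ 2 * gauss b c x =
      (1 / (2 * b) + (c / (2 * b)) ^ 2) * ∫ x, gauss b c x := by
  have i0 := integrable_gauss hb c
  have i1 := integrable_id_mul_gauss hb c
  have i2 := integrable_sq_mul_gauss hb c
  have hb' : (b : ℂ) ≠ 0 := by exact_mod_cast hb.ne'
  have hd : ∀ x : ℝ, HasDerivAt (fun x : ℝ => (x : ℂ) * gauss b c x)
      (gauss b c x + (-2 * b : ℂ) * ((x : ℂ) ^ 2 * gauss b c x) + c * (x * gauss b c x)) x := by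
    intro x
    have h0 : HasDerivAt (fun x : ℝ => (x : ℂ)) 1 x := Complex.ofRealCLM.hasDerivAt
    convert! h0.mul (hasDerivAt_gauss b c x) using 1
    ring
  have i02 : Integrable fun x : ℝ => gauss b c x + (-2 * b : ℂ) * ((x : ℂ) ^ 2 * gauss b c x) :=
    i0.add (i2.const_mul _)
  have h := integral_eq_zero_of_hasDerivAt_of_integrable hd (i02.add (i1.const_mul _)) i1
  rw [integral_add i02 (i1.const_mul _), integral_add i0 (i2.const_mul _),
    integral_const_mul, integral_const_mul, integral_id_mul_gauss hb] at h
  field_simp at h ⊢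
  linear_combination -h

/-- The integral of a product of two affine functions against a Gaussian in the plane. -/
lemma integral_quadratic_mul_gauss {b b' : ℝ} (hb : 0 < b) (hb' : 0 < b') (c c' : ℂ)
    (A A' B B' K : ℂ) :
    ∫ z : ℝ × ℝ, (A * z.1 + A' * z.2) * (-B * z.1 + B' * z.2 + K) *
        (gauss b c z.1 * gauss b' c' z.2) =
      ((A * (c / (2 * b)) + A' * (c' / (2 * b'))) *
          (-B * (c / (2 * b)) + B' * (c' / (2 * b')) + K) - A * B / (2 * b) +
        A' * B' / (2 * b')) * ((∫ x, gauss b c x) * ∫ y, gauss b' c' y) := by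
  have i0 := integrable_gauss hb c
  have i1 := integrable_id_mul_gauss hb c
  have i2 := integrable_sq_mul_gauss hb c
  have j0 := integrable_gauss hb' c'
  have j1 := integrable_id_mul_gauss hb' c'
  have j2 := integrable_sq_mul_gauss hb' c'
  have e : (fun z : ℝ × ℝ => (A * z.1 + A' * z.2) * (-B * z.1 + B' * z.2 + K) *
      (gauss b c z.1 * gauss b' c' z.2)) = fun z : ℝ × ℝ =>
      (-(A * B)) * (((z.1 : ℂ) ^ 2 * gauss b c z.1) * gauss b' c' z.2) +
      (A' * B') * (gauss b c z.1 * ((z.2 : ℂ) ^ 2 * gauss b' c' z.2)) +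
      (A * B' - A' * B) * ((z.1 * gauss b c z.1) * (z.2 * gauss b' c' z.2)) +
      (A * K) * ((z.1 * gauss b c z.1) * gauss b' c' z.2) +
      (A' * K) * (gauss b c z.1 * (z.2 * gauss b' c' z.2)) := by
    ext z; ring
  have k1 := (i2.mul_prod j0).const_mul (-(A * B))
  have k2 := (i0.mul_prod j2).const_mul (A' * B')
  have k3 := (i1.mul_prod j1).const_mul (A * B' - A' * B)
  have k4 := (i1.mul_prod j0).const_mul (A * K)
  have k5 := (i0.mul_prod j1).const_mul (A' * K)
  have h1 := integral_prod_mul (μ := (volume : Measure ℝ)) (ν := (volume : Measure ℝ))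
    (fun x : ℝ => (x : ℂ) ^ 2 * gauss b c x) (gauss b' c')
  have h2 := integral_prod_mul (μ := (volume : Measure ℝ)) (ν := (volume : Measure ℝ))
    (gauss b c) (fun y : ℝ => (y : ℂ) ^ 2 * gauss b' c' y)
  have h3 := integral_prod_mul (μ := (volume : Measure ℝ)) (ν := (volume : Measure ℝ))
    (fun x : ℝ => (x : ℂ) * gauss b c x) (fun y : ℝ => (y : ℂ) * gauss b' c' y)
  have h4 := integral_prod_mul (μ := (volume : Measure ℝ)) (ν := (volume : Measure ℝ))
    (fun x : ℝ => (x : ℂ) * gauss b c x) (gauss b' c')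
  have h5 := integral_prod_mul (μ := (volume : Measure ℝ)) (ν := (volume : Measure ℝ))
    (gauss b c) (fun y : ℝ => (y : ℂ) * gauss b' c' y)
  rw [e, Measure.volume_eq_prod]
  refine (integral_add (((k1.add k2).add k3).add k4) k5).trans ?_
  rw [integral_add' ((k1.add k2).add k3) k4, integral_add' (k1.add k2) k3, integral_add' k1 k2,
    integral_const_mul, integral_const_mul, integral_const_mul, integral_const_mul,
    integral_const_mul, h1, h2, h3, h4, h5, integral_sq_mul_gauss hb, integral_sq_mul_gauss hb',
    integral_id_mul_gauss hb, integral_id_mul_gauss hb']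
  ring

/-! ### The partial Fourier transform of the kernel `kTerm` -/

/-- The bilinear form of the quadratic form `xy`. -/
def pairing (x y : ℝ × ℝ) : ℝ := x.1 * y.2 + x.2 * y.1

/-- The Fourier transform of `ξ ↦ kTerm ξ (ξ - ℓ)` at `μ`. -/
def dualTerm (l m : ℝ × ℝ) (u v t s : ℝ) : ℂ :=
  -((Real.exp (-t) ^ 2 * Real.exp (-s) ^ 2 /
      (v ^ 2 * (Real.exp (-t) ^ 2 + Real.exp (-s) ^ 2) ^ 3) : ℝ) : ℂ) *
    ((Real.exp (-s) ^ 2 * (m.1 + (u + I * v) * l.1) + (m.2 + (u + I * v) * l.2)) *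
      (Real.exp (-t) ^ 2 * (m.1 + (u + I * v) * l.1) - (m.2 + (u + I * v) * l.2))) *
    cexp (-((π / (v * (Real.exp (-t) ^ 2 + Real.exp (-s) ^ 2)) *
        (Real.exp (-t) ^ 2 * Real.exp (-s) ^ 2 * ((m.1 + u * l.1) ^ 2 + v ^ 2 * l.1 ^ 2) +
          ((m.2 + u * l.2) ^ 2 + v ^ 2 * l.2 ^ 2)) : ℝ) : ℂ) -
      2 * π * I * (((Real.exp (-s) ^ 2 * l.1 * m.2 + Real.exp (-t) ^ 2 * l.2 * m.1) /
        (Real.exp (-t) ^ 2 + Real.exp (-s) ^ 2) : ℝ) : ℂ))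

lemma sqrt_mul_sqrt_gauss {v a b : ℝ} (hv : 0 < v) (ha : 0 < a) (hb : 0 < b) :
    √(π / (π * v * (a ^ 2 + b ^ 2))) * √(π / (π * v * (a⁻¹ ^ 2 + b⁻¹ ^ 2))) =
      a * b / (v * (a ^ 2 + b ^ 2)) := by
  have hp := Real.pi_pos
  rw [← Real.sqrt_mul (by positivity), Real.sqrt_eq_iff_mul_self_eq (by positivity)
    (by positivity)]
  field_simp
  ring

theorem integral_kTerm_mul_exp (l m : ℝ × ℝ) {v : ℝ} (hv : 0 < v) (u t s : ℝ) :
    ∫ z : ℝ × ℝ, kTerm z (z - l) u v t s * cexp (-(2 * π * I * (pairing z m : ℝ))) =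
      dualTerm l m u v t s := by
  set a := Real.exp (-t) with ha
  set b := Real.exp (-s) with hb
  have ha0 : 0 < a := Real.exp_pos _
  have hb0 : 0 < b := Real.exp_pos _
  have ha' : Real.exp t = a⁻¹ := by rw [ha, Real.exp_neg, inv_inv]
  have hb' : Real.exp s = b⁻¹ := by rw [hb, Real.exp_neg, inv_inv]
  set c₁ : ℂ := 2 * π * v * b ^ 2 * l.1 - 2 * π * I * (m.2 + u * l.2)
  set c₂ : ℂ := 2 * π * v * b⁻¹ ^ 2 * l.2 - 2 * π * I * (m.1 + u * l.1)
  set d : ℂ := v * cexp (2 * π * I * (u * (l.1 * l.2)) - π * v * (b ^ 2 * l.1 ^ 2) -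
    π * v * (b⁻¹ ^ 2 * l.2 ^ 2))
  set B₁ : ℝ := π * v * (a ^ 2 + b ^ 2) with hB₁
  set B₂ : ℝ := π * v * (a⁻¹ ^ 2 + b⁻¹ ^ 2) with hB₂
  have hp := Real.pi_pos
  have hB₁0 : 0 < B₁ := by positivity
  have hB₂0 : 0 < B₂ := by positivity
  have e : ∀ z : ℝ × ℝ, kTerm z (z - l) u v t s * cexp (-(2 * π * I * (pairing z m : ℝ))) =
      d * (((a : ℂ) * z.1 + ((a⁻¹ : ℝ) : ℂ) * z.2) * (-(b : ℂ) * z.1 + ((b⁻¹ : ℝ) : ℂ) * z.2 +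
        (b * l.1 - ((b⁻¹ : ℝ) : ℂ) * l.2)) * (gauss B₁ c₁ z.1 * gauss B₂ c₂ z.2)) := by
    intro z
    have hm1 : majorant z t = z.1 ^ 2 * a ^ 2 + z.2 ^ 2 * a⁻¹ ^ 2 := by
      simp only [majorant, posCoord, negCoord, ← ha, ha']; ring
    have hm2 : majorant (z - l) s = (z.1 - l.1) ^ 2 * b ^ 2 + (z.2 - l.2) ^ 2 * b⁻¹ ^ 2 := by
      simp only [majorant, posCoord, negCoord, ← hb, hb', Prod.fst_sub, Prod.snd_sub]; ring
    have hexp : pairExp z (z - l) u v t s * cexp (-(2 * π * I * (pairing z m : ℝ))) =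
        cexp (2 * π * I * (u * (l.1 * l.2)) - π * v * (b ^ 2 * l.1 ^ 2) -
          π * v * (b⁻¹ ^ 2 * l.2 ^ 2)) * (gauss B₁ c₁ z.1 * gauss B₂ c₂ z.2) := by
      rw [pairExp, gauss, gauss, hm1, hm2, ← Complex.exp_add, ← Complex.exp_add, ← Complex.exp_add]
      congr 1
      simp only [c₁, c₂, hB₁, hB₂, pairing, Prod.fst_sub, Prod.snd_sub]
      push_cast
      ring
    rw [kTerm, mul_assoc, hexp]
    simp only [posCoord, negCoord, ← ha, ha', ← hb, hb', d, Prod.fst_sub, Prod.snd_sub]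
    push_cast
    ring
  simp_rw [e]
  rw [integral_const_mul, integral_quadratic_mul_gauss hB₁0 hB₂0, integral_gauss hB₁0,
    integral_gauss hB₂0]
  have hac : (a : ℂ) ≠ 0 := by exact_mod_cast ha0.ne'
  have hbc : (b : ℂ) ≠ 0 := by exact_mod_cast hb0.ne'
  have hvc : (v : ℂ) ≠ 0 := by exact_mod_cast hv.ne'
  have hpc : (π : ℂ) ≠ 0 := by exact_mod_cast hp.ne'
  have hsc : (a : ℂ) ^ 2 + (b : ℂ) ^ 2 ≠ 0 := by
    exact_mod_cast (by positivity : (a ^ 2 + b ^ 2 : ℝ) ≠ 0)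
  have hsc' : (b : ℂ) ^ 2 + (a : ℂ) ^ 2 ≠ 0 := by rwa [add_comm]
  have hB₁c : (B₁ : ℂ) = π * v * (a ^ 2 + b ^ 2) := by rw [hB₁]; push_cast; ring
  have hB₂c : (B₂ : ℂ) = π * v * (a ^ 2 + b ^ 2) / (a ^ 2 * b ^ 2) := by
    rw [hB₂]; push_cast; field_simp; ring
  have hroot : ((√(π / B₁) : ℝ) : ℂ) * ((√(π / B₂) : ℝ) : ℂ) = a * b / (v * (a ^ 2 + b ^ 2)) := by
    rw [← Complex.ofReal_mul, hB₁, hB₂, sqrt_mul_sqrt_gauss hv ha0 hb0]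
    push_cast
    ring
  have hpoly : ((a : ℂ) * (c₁ / (2 * B₁)) + ((a⁻¹ : ℝ) : ℂ) * (c₂ / (2 * B₂))) *
        (-(b : ℂ) * (c₁ / (2 * B₁)) + ((b⁻¹ : ℝ) : ℂ) * (c₂ / (2 * B₂)) +
          (b * l.1 - ((b⁻¹ : ℝ) : ℂ) * l.2)) - a * b / (2 * B₁) +
        ((a⁻¹ : ℝ) : ℂ) * ((b⁻¹ : ℝ) : ℂ) / (2 * B₂) =
      -(a * b / (v ^ 2 * (a ^ 2 + b ^ 2) ^ 2)) *
        ((b ^ 2 * (m.1 + (u + I * v) * l.1) + (m.2 + (u + I * v) * l.2)) *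
      (a ^ 2 * (m.1 + (u + I * v) * l.1) - (m.2 + (u + I * v) * l.2))) := by
    have x1 : (a : ℂ) * (c₁ / (2 * B₁)) + ((a⁻¹ : ℝ) : ℂ) * (c₂ / (2 * B₂)) =
        -I * a / (v * (a ^ 2 + b ^ 2)) *
          (b ^ 2 * (m.1 + (u + I * v) * l.1) + (m.2 + (u + I * v) * l.2)) := by
      rw [hB₁c, hB₂c]
      simp only [c₁, c₂]
      push_cast
      field_simp
      linear_combination ((b : ℂ) ^ 2 * v * l.1 + v * l.2) * I_sq
    have x2 : -(b : ℂ) * (c₁ / (2 * B₁)) + ((b⁻¹ : ℝ) : ℂ) * (c₂ / (2 * B₂)) +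
          (b * l.1 - ((b⁻¹ : ℝ) : ℂ) * l.2) = -I * b / (v * (a ^ 2 + b ^ 2)) *
          (a ^ 2 * (m.1 + (u + I * v) * l.1) - (m.2 + (u + I * v) * l.2)) := by
      rw [hB₁c, hB₂c]
      simp only [c₁, c₂]
      push_cast
      field_simp
      linear_combination ((b : ℂ) ^ 2 * v * (a ^ 2 * l.1 - l.2)) * I_sq
    have x3 : (a : ℂ) * b / (2 * B₁) = ((a⁻¹ : ℝ) : ℂ) * ((b⁻¹ : ℝ) : ℂ) / (2 * B₂) := by
      rw [hB₁c, hB₂c]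
      push_cast
      field_simp
    rw [x1, x2, x3, sub_add_cancel]
    rw [show (v : ℂ) ^ 2 * (a ^ 2 + b ^ 2) ^ 2 = (v * (a ^ 2 + b ^ 2)) ^ 2 by ring]
    generalize (v : ℂ) * (a ^ 2 + b ^ 2) = D
    generalize (b : ℂ) ^ 2 * (m.1 + (u + I * v) * l.1) + (m.2 + (u + I * v) * l.2) = P
    generalize (a : ℂ) ^ 2 * (m.1 + (u + I * v) * l.1) - (m.2 + (u + I * v) * l.2) = R
    linear_combination (a * b / D ^ 2 * P * R) * I_sq
  have hexpo : cexp (2 * π * I * (u * (l.1 * l.2)) - π * v * (b ^ 2 * l.1 ^ 2) -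
        π * v * ((b : ℂ)⁻¹ ^ 2 * l.2 ^ 2)) *
        (cexp (c₁ ^ 2 / (4 * B₁)) * cexp (c₂ ^ 2 / (4 * B₂))) =
      cexp (-((π / (v * (a ^ 2 + b ^ 2)) *
        (a ^ 2 * b ^ 2 * ((m.1 + u * l.1) ^ 2 + v ^ 2 * l.1 ^ 2) +
          ((m.2 + u * l.2) ^ 2 + v ^ 2 * l.2 ^ 2)) : ℝ) : ℂ) -
      2 * π * I * (((b ^ 2 * l.1 * m.2 + a ^ 2 * l.2 * m.1) / (a ^ 2 + b ^ 2) : ℝ) : ℂ)) := by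
    rw [← Complex.exp_add, ← Complex.exp_add]
    congr 1
    rw [hB₁c, hB₂c]
    simp only [c₁, c₂]
    push_cast
    field_simp
    linear_combination (4 * (b : ℂ) ^ 2 * (a ^ 2 * b ^ 2 * (m.1 + u * l.1) ^ 2 +
      (m.2 + u * l.2) ^ 2)) * I_sq
  rw [hpoly, dualTerm]
  simp only [← ha, ← hb]
  rw [← hexpo]
  simp only [d]
  rw [show ∀ X Y Z W R₁ R₂ : ℂ, v * X * (Y * (R₁ * Z * (R₂ * W))) =
    (v * Y * (R₁ * R₂)) * (X * (Z * W)) by intros; ring, hroot]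
  push_cast
  field_simp

end HeckeTheta

end

noncomputable section

namespace HeckeTheta

open MeasureTheory Complex Set Filter Topology
open scoped Real

/-! ### Lattices in the plane -/

/-- The integral combination of two vectors. -/
def latVec (e₁ e₂ : ℝ × ℝ) (n : ℤ × ℤ) : ℝ × ℝ :=
  ((n.1 : ℝ) * e₁.1 + n.2 * e₂.1, (n.1 : ℝ) * e₁.2 + n.2 * e₂.2)

/-- Two bases of the plane that are dual to each other for the form `xy`. -/
structure IsDualPair (e₁ e₂ f₁ f₂ : ℝ × ℝ) : Prop where
  h11 : pairing e₁ f₁ = 1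
  h12 : pairing e₁ f₂ = 0
  h21 : pairing e₂ f₁ = 0
  h22 : pairing e₂ f₂ = 1

lemma pairing_comm (x y : ℝ × ℝ) : pairing x y = pairing y x := by
  simp only [pairing]; ring

lemma IsDualPair.symm {e₁ e₂ f₁ f₂ : ℝ × ℝ} (h : IsDualPair e₁ e₂ f₁ f₂) :
    IsDualPair f₁ f₂ e₁ e₂ :=
  ⟨pairing_comm _ _ ▸ h.h11, pairing_comm _ _ ▸ h.h21, pairing_comm _ _ ▸ h.h12,
    pairing_comm _ _ ▸ h.h22⟩

lemma pairing_sq_le (x y : ℝ × ℝ) : pairing x y ^ 2 ≤ normSq2 x * normSq2 y := by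
  simp only [pairing, normSq2]
  nlinarith [sq_nonneg (x.1 * y.1 - x.2 * y.2)]

lemma IsDualPair.sq_add_sq_le {e₁ e₂ f₁ f₂ : ℝ × ℝ} (h : IsDualPair e₁ e₂ f₁ f₂) (a b : ℝ) :
    a ^ 2 + b ^ 2 ≤ (normSq2 f₁ + normSq2 f₂) *
      normSq2 (a * e₁.1 + b * e₂.1, a * e₁.2 + b * e₂.2) := by
  have h1 := pairing_sq_le (a * e₁.1 + b * e₂.1, a * e₁.2 + b * e₂.2) f₁
  have h2 := pairing_sq_le (a * e₁.1 + b * e₂.1, a * e₁.2 + b * e₂.2) f₂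
  have e1 : pairing (a * e₁.1 + b * e₂.1, a * e₁.2 + b * e₂.2) f₁ = a := by
    have h11 := h.h11
    have h21 := h.h21
    simp only [pairing] at *
    linear_combination a * h11 + b * h21
  have e2 : pairing (a * e₁.1 + b * e₂.1, a * e₁.2 + b * e₂.2) f₂ = b := by
    have h12 := h.h12
    have h22 := h.h22
    simp only [pairing] at *
    linear_combination a * h12 + b * h22
  rw [e1] at h1
  rw [e2] at h2
  linarith

lemma IsDualPair.pos {e₁ e₂ f₁ f₂ : ℝ × ℝ} (h : IsDualPair e₁ e₂ f₁ f₂) :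
    0 < normSq2 f₁ + normSq2 f₂ := by
  have h1 := h.sq_add_sq_le 1 1
  have h2 := normSq2_nonneg f₁
  have h3 := normSq2_nonneg f₂
  by_contra h0
  have : normSq2 f₁ + normSq2 f₂ = 0 := by linarith
  rw [this] at h1
  norm_num at h1

lemma exp_neg_mul_sq_le {c : ℝ} (hc : 0 < c) (x : ℝ) :
    Real.exp (-(c * x ^ 2)) ≤ (1 + 1 / c) * (1 + x ^ 2)⁻¹ := by
  rw [Real.exp_neg, inv_le_comm₀ (Real.exp_pos _) (by positivity), mul_inv, inv_inv,
    inv_mul_le_iff₀ (by positivity)]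
  have h1 := Real.add_one_le_exp (c * x ^ 2)
  have h2 : (1 + 1 / c) * (c * x ^ 2 + 1) = 1 + x ^ 2 + (c * x ^ 2 + 1 / c) := by
    field_simp
    ring
  have h3 : 0 ≤ c * x ^ 2 + 1 / c := by positivity
  have h4 : 0 < 1 + 1 / c := by positivity
  nlinarith

lemma summable_exp_neg_int {c : ℝ} (hc : 0 < c) :
    Summable fun n : ℤ => Real.exp (-(c * (n : ℝ) ^ 2)) :=
  Summable.of_nonneg_of_le (fun _ => (Real.exp_pos _).le) (fun n => exp_neg_mul_sq_le hc n)
    (summable_inv_one_add_int_sq.mul_left _)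

lemma summable_exp_neg_int_prod {c : ℝ} (hc : 0 < c) :
    Summable fun n : ℤ × ℤ => Real.exp (-(c * ((n.1 : ℝ) ^ 2 + (n.2 : ℝ) ^ 2))) := by
  have := (summable_exp_neg_int hc).mul_of_nonneg (summable_exp_neg_int hc)
    (fun n => (Real.exp_pos _).le) (fun n => (Real.exp_pos _).le)
  refine this.congr fun n => ?_
  rw [← Real.exp_add]
  ring_nf

/-- Gaussian sums over a product of two lattices converge. -/
lemma summable_exp_neg_latVec {e₁ e₂ f₁ f₂ e₁' e₂' f₁' f₂' : ℝ × ℝ} (h : IsDualPair e₁ e₂ f₁ f₂)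
    (h' : IsDualPair e₁' e₂' f₁' f₂') {c : ℝ} (hc : 0 < c) :
    Summable fun i : (ℤ × ℤ) × ℤ × ℤ =>
      Real.exp (-(c * (normSq2 (latVec e₁ e₂ i.1) + normSq2 (latVec e₁' e₂' i.2)))) := by
  have h1 := h.pos
  have h2 := h'.pos
  have := (summable_exp_neg_int_prod (div_pos hc h1)).mul_of_nonneg
    (summable_exp_neg_int_prod (div_pos hc h2))
    (fun n => (Real.exp_pos _).le) (fun n => (Real.exp_pos _).le)
  refine Summable.of_nonneg_of_le (fun i => (Real.exp_pos _).le) (fun i => ?_) this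
  rw [← Real.exp_add]
  apply Real.exp_le_exp.2
  have k1 := h.sq_add_sq_le i.1.1 i.1.2
  have k2 := h'.sq_add_sq_le i.2.1 i.2.2
  have l1 : c / (normSq2 f₁ + normSq2 f₂) * ((i.1.1 : ℝ) ^ 2 + (i.1.2 : ℝ) ^ 2) ≤
      c * normSq2 (latVec e₁ e₂ i.1) := by
    rw [div_mul_eq_mul_div, div_le_iff₀ h1]
    simp only [latVec]
    nlinarith [mul_le_mul_of_nonneg_left k1 hc.le]
  have l2 : c / (normSq2 f₁' + normSq2 f₂') * ((i.2.1 : ℝ) ^ 2 + (i.2.2 : ℝ) ^ 2) ≤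
      c * normSq2 (latVec e₁' e₂' i.2) := by
    rw [div_mul_eq_mul_div, div_le_iff₀ h2]
    simp only [latVec]
    nlinarith [mul_le_mul_of_nonneg_left k2 hc.le]
  linarith

lemma gaussSummable_latVec {e₁ e₂ f₁ f₂ : ℝ × ℝ} (h : IsDualPair e₁ e₂ f₁ f₂) :
    GaussSummable (fun i : (ℤ × ℤ) × ℤ × ℤ => latVec f₁ f₂ i.2)
      (fun i => latVec f₁ f₂ i.2 - latVec e₁ e₂ i.1) := by
  intro c hc
  refine Summable.of_nonneg_of_le (fun i => (Real.exp_pos _).le) (fun i => ?_)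
    (summable_exp_neg_latVec h h.symm (c := c / 3) (by positivity))
  apply Real.exp_le_exp.2
  set x := latVec f₁ f₂ i.2
  set y := latVec e₁ e₂ i.1
  have : normSq2 y + normSq2 x ≤ 3 * (normSq2 x + normSq2 (x - y)) := by
    simp only [normSq2, Prod.fst_sub, Prod.snd_sub]
    nlinarith [sq_nonneg (2 * x.1 - y.1), sq_nonneg (2 * x.2 - y.2)]
  nlinarith

/-! ### The Fourier dual series -/

lemma dualTerm_neg {l m : ℝ × ℝ} {u v : ℝ} (huv : u ^ 2 + v ^ 2 = 1)
    (h : ∃ k : ℤ, pairing l m = k) (t s : ℝ) :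
    dualTerm l m (-u) v t s = (u - I * v) ^ 2 * dualTerm m (-l) u v t s := by
  obtain ⟨k, hk⟩ := h
  set a := Real.exp (-t) with ha
  set b := Real.exp (-s) with hb
  have ha0 : 0 < a := Real.exp_pos _
  have hb0 : 0 < b := Real.exp_pos _
  have huvc : (u : ℂ) ^ 2 + (v : ℂ) ^ 2 = 1 := by exact_mod_cast huv
  have z : ∀ x y : ℂ, x + (((-u : ℝ) : ℂ) + I * v) * y =
      (u - I * v) * (((-y : ℂ)) + (u + I * v) * x) := by
    intro x y
    push_cast
    linear_combination (-x) * huvc + (v : ℂ) ^ 2 * x * I_sq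
  have n : ∀ x y : ℝ, (x + -u * y) ^ 2 + v ^ 2 * y ^ 2 = (-y + u * x) ^ 2 + v ^ 2 * x ^ 2 := by
    intro x y
    linear_combination (y ^ 2 - x ^ 2) * huv
  have hphase : ((b ^ 2 * l.1 * m.2 + a ^ 2 * l.2 * m.1) / (a ^ 2 + b ^ 2) : ℝ) =
      (b ^ 2 * m.1 * -l.2 + a ^ 2 * m.2 * -l.1) / (a ^ 2 + b ^ 2) + k := by
    rw [← hk, pairing]
    field_simp
    ring
  simp only [dualTerm, ← ha, ← hb, Prod.fst_neg, Prod.snd_neg, n, hphase]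
  rw [z m.1 l.1, z m.2 l.2]
  have hexp : ∀ A B : ℂ, cexp (A - 2 * π * I * (B + (k : ℂ))) = cexp (A - 2 * π * I * B) := by
    intro A B
    rw [show A - 2 * π * I * (B + (k : ℂ)) = A - 2 * π * I * B - k * (2 * π * I) by ring]
    exact Complex.exp_periodic.sub_int_mul_eq k
  rw [Complex.ofReal_add _ (k : ℝ), Complex.ofReal_intCast, hexp]
  push_cast
  ring

lemma norm_sq_add_mul (x y u v : ℝ) :
    ‖(x : ℂ) + (u + I * v) * y‖ ^ 2 = (x + u * y) ^ 2 + v ^ 2 * y ^ 2 := by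
  rw [← Complex.normSq_eq_norm_sq, Complex.normSq_apply]
  simp
  ring

lemma sq_mul_sq_add_sq_le (u v x y : ℝ) : v ^ 2 * (y ^ 2 + x ^ 2) ≤
    (3 * v ^ 2 + 2 * u ^ 2 + 1) * ((x + u * y) ^ 2 + v ^ 2 * y ^ 2) := by
  have : 0 ≤ (v * (x + 2 * u * y)) ^ 2 + (v * (x + u * y)) ^ 2 + 2 * (u * (x + u * y)) ^ 2 +
    (x + u * y) ^ 2 + 3 * (v ^ 2 * y) ^ 2 := by positivity
  linarith

lemma exists_norm_dualTerm_le (u t s : ℝ) {v : ℝ} (hv : 0 < v) :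
    ∃ C c : ℝ, 0 < c ∧ ∀ l m : ℝ × ℝ,
      ‖dualTerm l m u v t s‖ ≤ C * Real.exp (-(c * (normSq2 l + normSq2 m))) := by
  set a := Real.exp (-t) with ha
  set b := Real.exp (-s) with hb
  have ha0 : 0 < a := Real.exp_pos _
  have hb0 : 0 < b := Real.exp_pos _
  have hp := Real.pi_pos
  set D := a ^ 2 * b ^ 2 / (v ^ 2 * (a ^ 2 + b ^ 2) ^ 3)
  have hD : 0 < D := by positivity
  set c₀ := π / (v * (a ^ 2 + b ^ 2)) * min (a ^ 2 * b ^ 2) 1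
  have hc₀ : 0 < c₀ := by positivity
  set κ := v ^ 2 / (3 * v ^ 2 + 2 * u ^ 2 + 1)
  have hκ : 0 < κ := by positivity
  refine ⟨D * ((b ^ 4 + a ^ 4 + 2) * (2 / c₀)), c₀ / 2 * κ, by positivity, fun l m => ?_⟩
  set Z₁ := (m.1 + u * l.1) ^ 2 + v ^ 2 * l.1 ^ 2
  set Z₂ := (m.2 + u * l.2) ^ 2 + v ^ 2 * l.2 ^ 2
  set ζ₁ : ℂ := m.1 + (u + I * v) * l.1
  set ζ₂ : ℂ := m.2 + (u + I * v) * l.2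
  have hζ₁ : ‖ζ₁‖ ^ 2 = Z₁ := norm_sq_add_mul _ _ _ _
  have hζ₂ : ‖ζ₂‖ ^ 2 = Z₂ := norm_sq_add_mul _ _ _ _
  have hZ₁ : 0 ≤ Z₁ := by positivity
  have hZ₂ : 0 ≤ Z₂ := by positivity
  have hnorm : ‖dualTerm l m u v t s‖ = D * ‖((b : ℂ) ^ 2 * ζ₁ + ζ₂) * ((a : ℂ) ^ 2 * ζ₁ - ζ₂)‖ *
      Real.exp (-(π / (v * (a ^ 2 + b ^ 2)) * (a ^ 2 * b ^ 2 * Z₁ + Z₂))) := by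
    rw [dualTerm, norm_mul, norm_mul, norm_neg, Complex.norm_real, Real.norm_eq_abs,
      Complex.norm_exp]
    simp only [← ha, ← hb]
    rw [abs_of_pos hD]
    congr 2
    simp only [Complex.sub_re, Complex.neg_re, Complex.ofReal_re, Complex.mul_re, Complex.mul_im,
      Complex.I_re, Complex.I_im, Complex.ofReal_im]
    simp [Z₁, Z₂]
  have hpoly : ‖((b : ℂ) ^ 2 * ζ₁ + ζ₂) * ((a : ℂ) ^ 2 * ζ₁ - ζ₂)‖ ≤
      (b ^ 4 + a ^ 4 + 2) * (Z₁ + Z₂) := by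
    have h1 : ‖(b : ℂ) ^ 2 * ζ₁ + ζ₂‖ ≤ b ^ 2 * ‖ζ₁‖ + ‖ζ₂‖ := by
      refine (norm_add_le _ _).trans_eq ?_
      rw [norm_mul, norm_pow, norm_real, Real.norm_eq_abs, sq_abs]
    have h2 : ‖(a : ℂ) ^ 2 * ζ₁ - ζ₂‖ ≤ a ^ 2 * ‖ζ₁‖ + ‖ζ₂‖ := by
      refine (norm_sub_le _ _).trans_eq ?_
      rw [norm_mul, norm_pow, norm_real, Real.norm_eq_abs, sq_abs]
    rw [norm_mul]
    refine (mul_le_mul h1 h2 (norm_nonneg _) (by positivity)).trans ?_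
    rw [← hζ₁, ← hζ₂]
    have n1 := norm_nonneg ζ₁
    have n2 := norm_nonneg ζ₂
    have e1 : (b ^ 2 * ‖ζ₁‖ + ‖ζ₂‖) * (a ^ 2 * ‖ζ₁‖ + ‖ζ₂‖) ≤
        (b ^ 4 + a ^ 4) * ‖ζ₁‖ ^ 2 + 2 * ‖ζ₂‖ ^ 2 := by
      nlinarith [sq_nonneg (b ^ 2 * ‖ζ₁‖ - ‖ζ₂‖), sq_nonneg (a ^ 2 * ‖ζ₁‖ - ‖ζ₂‖),
        sq_nonneg (a ^ 2 * ‖ζ₁‖ - b ^ 2 * ‖ζ₁‖)]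
    nlinarith [pow_pos ha0 4, pow_pos hb0 4, sq_nonneg ‖ζ₁‖, sq_nonneg ‖ζ₂‖,
      mul_nonneg (pow_pos ha0 4).le (sq_nonneg ‖ζ₂‖), mul_nonneg (pow_pos hb0 4).le
        (sq_nonneg ‖ζ₂‖)]
  have hexp : Real.exp (-(π / (v * (a ^ 2 + b ^ 2)) * (a ^ 2 * b ^ 2 * Z₁ + Z₂))) ≤
      Real.exp (-(c₀ * (Z₁ + Z₂))) := by
    apply Real.exp_le_exp.2
    rw [neg_le_neg_iff, mul_assoc]
    refine mul_le_mul_of_nonneg_left ?_ (by positivity)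
    nlinarith [min_le_left (a ^ 2 * b ^ 2) 1, min_le_right (a ^ 2 * b ^ 2) 1]
  have hX : (Z₁ + Z₂) * Real.exp (-(c₀ * (Z₁ + Z₂))) ≤
      2 / c₀ * Real.exp (-(c₀ / 2 * (Z₁ + Z₂))) := by
    have h1 := Real.add_one_le_exp (c₀ / 2 * (Z₁ + Z₂))
    have h2 : Z₁ + Z₂ ≤ 2 / c₀ * Real.exp (c₀ / 2 * (Z₁ + Z₂)) := by
      rw [div_mul_eq_mul_div, le_div_iff₀ hc₀]
      nlinarith
    calc (Z₁ + Z₂) * Real.exp (-(c₀ * (Z₁ + Z₂)))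
        ≤ 2 / c₀ * Real.exp (c₀ / 2 * (Z₁ + Z₂)) * Real.exp (-(c₀ * (Z₁ + Z₂))) := by gcongr
      _ = _ := by rw [mul_assoc, ← Real.exp_add]; ring_nf
  have hlow : κ * (normSq2 l + normSq2 m) ≤ Z₁ + Z₂ := by
    rw [div_mul_eq_mul_div, div_le_iff₀ (by positivity)]
    have k1 := sq_mul_sq_add_sq_le u v m.1 l.1
    have k2 := sq_mul_sq_add_sq_le u v m.2 l.2
    simp only [normSq2, Z₁, Z₂]
    linarith
  rw [hnorm]
  calc D * ‖((b : ℂ) ^ 2 * ζ₁ + ζ₂) * ((a : ℂ) ^ 2 * ζ₁ - ζ₂)‖ *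
        Real.exp (-(π / (v * (a ^ 2 + b ^ 2)) * (a ^ 2 * b ^ 2 * Z₁ + Z₂)))
      ≤ D * ((b ^ 4 + a ^ 4 + 2) * (Z₁ + Z₂)) * Real.exp (-(c₀ * (Z₁ + Z₂))) := by gcongr
    _ = D * (b ^ 4 + a ^ 4 + 2) * ((Z₁ + Z₂) * Real.exp (-(c₀ * (Z₁ + Z₂)))) := by ring
    _ ≤ D * (b ^ 4 + a ^ 4 + 2) * (2 / c₀ * Real.exp (-(c₀ / 2 * (Z₁ + Z₂)))) := by gcongr
    _ ≤ D * (b ^ 4 + a ^ 4 + 2) *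
        (2 / c₀ * Real.exp (-(c₀ / 2 * κ * (normSq2 l + normSq2 m)))) := by
      refine mul_le_mul_of_nonneg_left (mul_le_mul_of_nonneg_left (Real.exp_le_exp.2 ?_)
        (by positivity)) (by positivity)
      rw [neg_le_neg_iff, mul_assoc]
      exact mul_le_mul_of_nonneg_left hlow (by positivity)
    _ = _ := by ring

lemma summable_dualTerm {e₁ e₂ f₁ f₂ : ℝ × ℝ} (h : IsDualPair e₁ e₂ f₁ f₂) (u t s : ℝ) {v : ℝ}
    (hv : 0 < v) : Summable fun i : (ℤ × ℤ) × ℤ × ℤ =>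
      dualTerm (latVec e₁ e₂ i.1) (latVec e₁ e₂ i.2) u v t s := by
  obtain ⟨C, c, hc, hb⟩ := exists_norm_dualTerm_le u t s hv
  exact Summable.of_norm_bounded ((summable_exp_neg_latVec h h hc).mul_left C) fun i => hb _ _

/-! ### The transformation under inversion -/

/-- The linear automorphism of the plane attached to a basis. -/
def planeMap (f₁ f₂ : ℝ × ℝ) : ℝ × ℝ →ₗ[ℝ] ℝ × ℝ where
  toFun z := (z.1 * f₁.1 + z.2 * f₂.1, z.1 * f₁.2 + z.2 * f₂.2)
  map_add' x y := by ext <;> simp <;> ring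
  map_smul' c x := by ext <;> simp <;> ring

lemma IsDualPair.exists_integral_comp {e₁ e₂ f₁ f₂ : ℝ × ℝ} (h : IsDualPair e₁ e₂ f₁ f₂) :
    ∃ c : ℂ, ∀ H : ℝ × ℝ → ℂ, ∫ z, H (planeMap f₁ f₂ z) = c * ∫ z, H z := by
  have hinj : Function.Injective (planeMap f₁ f₂) := by
    rw [← LinearMap.ker_eq_bot, LinearMap.ker_eq_bot']
    intro z hz
    have := h.symm.sq_add_sq_le z.1 z.2
    have hz' : (z.1 * f₁.1 + z.2 * f₂.1, z.1 * f₁.2 + z.2 * f₂.2) = (0 : ℝ × ℝ) := hz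
    rw [hz'] at this
    simp only [normSq2, Prod.fst_zero, Prod.snd_zero] at this
    norm_num at this
    ext
    · simp only [Prod.fst_zero]; nlinarith [sq_nonneg z.1, sq_nonneg z.2]
    · simp only [Prod.snd_zero]; nlinarith [sq_nonneg z.1, sq_nonneg z.2]
  set E := LinearEquiv.ofInjectiveEndo (planeMap f₁ f₂) hinj
  have hE : ∀ z, E z = planeMap f₁ f₂ z := fun z => by simp [E]
  have hdet : LinearMap.det (E : ℝ × ℝ →ₗ[ℝ] ℝ × ℝ) ≠ 0 := (LinearEquiv.isUnit_det' E).ne_zero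
  have hmap := Measure.map_linearMap_addHaar_eq_smul_addHaar (volume : Measure (ℝ × ℝ)) hdet
  set M := E.toContinuousLinearEquiv.toHomeomorph.toMeasurableEquiv
  refine ⟨(ENNReal.ofReal |(LinearMap.det (E : ℝ × ℝ →ₗ[ℝ] ℝ × ℝ))⁻¹|).toReal, fun H => ?_⟩
  have h1 := MeasureTheory.integral_map_equiv (μ := (volume : Measure (ℝ × ℝ))) M H
  have h2 : Measure.map M (volume : Measure (ℝ × ℝ)) =
      ENNReal.ofReal |(LinearMap.det (E : ℝ × ℝ →ₗ[ℝ] ℝ × ℝ))⁻¹| • volume := hmap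
  rw [h2, integral_smul_measure] at h1
  rw [← Complex.real_smul, h1]
  exact integral_congr_ae (Eventually.of_forall fun z => by simp only [← hE]; rfl)

lemma continuous_kTerm_sub (l : ℝ × ℝ) (u v t s : ℝ) :
    Continuous fun z : ℝ × ℝ => kTerm z (z - l) u v t s := by
  unfold kTerm pairExp majorant posCoord negCoord
  fun_prop

/-- Poisson summation for the kernel `kTerm` in its first variable. -/
lemma IsDualPair.exists_tsum_kTerm {e₁ e₂ f₁ f₂ : ℝ × ℝ} (h : IsDualPair e₁ e₂ f₁ f₂) :
    ∃ c : ℂ, ∀ (j : ℤ × ℤ) (u t s : ℝ) {v : ℝ}, 0 < v →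
      ∑' n : ℤ × ℤ, kTerm (latVec f₁ f₂ n) (latVec f₁ f₂ n - latVec e₁ e₂ j) u v t s =
        c * ∑' n : ℤ × ℤ, dualTerm (latVec e₁ e₂ j) (latVec e₁ e₂ n) u v t s := by
  obtain ⟨c, hcomp⟩ := h.exists_integral_comp
  refine ⟨c, fun j u t s {v} hv => ?_⟩
  set l := latVec e₁ e₂ j
  set F : ℝ × ℝ → ℂ := fun z => kTerm (planeMap f₁ f₂ z) (planeMap f₁ f₂ z - l) u v t s
  have hFcont : Continuous F := by
    have : Continuous (planeMap f₁ f₂) := (planeMap f₁ f₂).continuous_of_finiteDimensional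
    exact (continuous_kTerm_sub l u v t s).comp this
  have hfourier : ∀ n : ℤ × ℤ, planeFourier F n =
      c * dualTerm l (latVec e₁ e₂ n) u v t s := by
    intro n
    rw [← integral_kTerm_mul_exp l (latVec e₁ e₂ n) hv, ← hcomp, planeFourier]
    refine integral_congr_ae (Eventually.of_forall fun z => ?_)
    have : pairing (planeMap f₁ f₂ z) (latVec e₁ e₂ n) = n.1 * z.1 + n.2 * z.2 := by
      have h11 := h.h11
      have h12 := h.h12
      have h21 := h.h21
      have h22 := h.h22
      simp only [pairing, planeMap, latVec, LinearMap.coe_mk, AddHom.coe_mk] at *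
      linear_combination z.1 * n.1 * h11 + z.2 * n.1 * h12 + z.1 * n.2 * h21 + z.2 * n.2 * h22
    simp only [F, this]
    push_cast
    rfl
  have hsum : Summable (planeFourier F) := by
    simp_rw [funext hfourier]
    exact ((summable_dualTerm h u t s hv).prod_factor j).mul_left c
  set R := max |t| |s|
  set c₁ := v * Real.exp (-(2 * R)) / (normSq2 e₁ + normSq2 e₂)
  have hpos := h.symm.pos
  have hc₁ : 0 < c₁ := by positivity
  have hbound : ∀ x y : ℝ, ‖F (x, y)‖ ≤
      26 * (1 + 1 / v) * (1 + 1 / c₁) ^ 2 * ((1 + x ^ 2)⁻¹ * (1 + y ^ 2)⁻¹) := by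
    intro x y
    set ξ := planeMap f₁ f₂ (x, y)
    have h1 := (norm_kTerm_le ξ (ξ - l) hv u t s).trans (pairBound_le (δ := 0) hv
      (Or.inr (add_nonneg (normSq2_nonneg _) (normSq2_nonneg _))) le_rfl (le_max_left |t| |s|)
      (le_max_right |t| |s|))
    refine h1.trans ?_
    simp only [mul_zero, zero_mul, neg_zero, Real.exp_zero, mul_one]
    have h2 : c₁ * x ^ 2 + c₁ * y ^ 2 ≤
        v * Real.exp (-(2 * R)) * (normSq2 ξ + normSq2 (ξ - l)) := by
      have k1 : x ^ 2 + y ^ 2 ≤ (normSq2 e₁ + normSq2 e₂) * normSq2 ξ := h.symm.sq_add_sq_le x y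
      have k2 := normSq2_nonneg (ξ - l)
      have k3 : 0 < v * Real.exp (-(2 * R)) := by positivity
      rw [← mul_add, div_mul_eq_mul_div, div_le_iff₀ hpos]
      calc v * Real.exp (-(2 * R)) * (x ^ 2 + y ^ 2)
          ≤ v * Real.exp (-(2 * R)) * ((normSq2 e₁ + normSq2 e₂) * normSq2 ξ) := by gcongr
        _ ≤ v * Real.exp (-(2 * R)) * ((normSq2 e₁ + normSq2 e₂) *
              (normSq2 ξ + normSq2 (ξ - l))) := by gcongr; linarith
        _ = _ := by ring
    calc 26 * (1 + 1 / v) * Real.exp (-(v * Real.exp (-(2 * R)) * (normSq2 ξ + normSq2 (ξ - l))))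
        ≤ 26 * (1 + 1 / v) * (Real.exp (-(c₁ * x ^ 2)) * Real.exp (-(c₁ * y ^ 2))) := by
          rw [← Real.exp_add]
          gcongr
          linarith
      _ ≤ 26 * (1 + 1 / v) * (((1 + 1 / c₁) * (1 + x ^ 2)⁻¹) * ((1 + 1 / c₁) * (1 + y ^ 2)⁻¹)) := by
          gcongr
          · exact exp_neg_mul_sq_le hc₁ x
          · exact exp_neg_mul_sq_le hc₁ y
      _ = _ := by ring
  have := tsum_int_prod_eq_tsum_planeFourier hFcont hbound hsum
  simp_rw [hfourier] at this
  rw [tsum_mul_left] at this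
  exact this

/-- The family of pairs `(λ, λ - ℓ)` with `λ` in the dual lattice and `ℓ` in the lattice has a
theta series `kTerm` of weight `(0, 2)`. -/
theorem pairTheta_kTerm_inversion {e₁ e₂ f₁ f₂ : ℝ × ℝ} (h : IsDualPair e₁ e₂ f₁ f₂)
    (hint : ∀ m n, ∃ k : ℤ, pairing (latVec e₁ e₂ m) (latVec e₁ e₂ n) = k) {u v : ℝ} (t s : ℝ)
    (huv : u ^ 2 + v ^ 2 = 1) (hv : 0 < v) :
    pairTheta kTerm (fun i : (ℤ × ℤ) × ℤ × ℤ => latVec f₁ f₂ i.2)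
      (fun i => latVec f₁ f₂ i.2 - latVec e₁ e₂ i.1) ((-u, v), t, s) =
    (u - I * v) ^ 2 * pairTheta kTerm (fun i : (ℤ × ℤ) × ℤ × ℤ => latVec f₁ f₂ i.2)
      (fun i => latVec f₁ f₂ i.2 - latVec e₁ e₂ i.1) ((u, v), t, s) := by
  obtain ⟨c, hc⟩ := h.exists_tsum_kTerm
  have hK : ∀ u : ℝ, pairTheta kTerm (fun i : (ℤ × ℤ) × ℤ × ℤ => latVec f₁ f₂ i.2)
      (fun i => latVec f₁ f₂ i.2 - latVec e₁ e₂ i.1) ((u, v), t, s) =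
      c * ∑' i : (ℤ × ℤ) × ℤ × ℤ, dualTerm (latVec e₁ e₂ i.1) (latVec e₁ e₂ i.2) u v t s := by
    intro u
    rw [pairTheta, (isPairKernel_kTerm.summable (gaussSummable_latVec h) hv u t s).tsum_prod,
      (summable_dualTerm h u t s hv).tsum_prod, ← tsum_mul_left]
    exact tsum_congr fun j => hc j u t s hv
  rw [hK, hK]
  set σ : (ℤ × ℤ) × ℤ × ℤ ≃ (ℤ × ℤ) × ℤ × ℤ :=
    { toFun := fun i => (i.2, -i.1)
      invFun := fun i => (-i.2, i.1)
      left_inv := fun i => by simp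
      right_inv := fun i => by simp }
  have hneg : ∀ n : ℤ × ℤ, latVec e₁ e₂ (-n) = -latVec e₁ e₂ n := by
    intro n
    ext <;> simp [latVec] <;> ring
  have hinv : ∑' i : (ℤ × ℤ) × ℤ × ℤ, dualTerm (latVec e₁ e₂ i.1) (latVec e₁ e₂ i.2) (-u) v t s =
      (u - I * v) ^ 2 *
        ∑' i : (ℤ × ℤ) × ℤ × ℤ, dualTerm (latVec e₁ e₂ i.1) (latVec e₁ e₂ i.2) u v t s := by
    rw [← σ.tsum_eq (fun i => dualTerm (latVec e₁ e₂ i.1) (latVec e₁ e₂ i.2) u v t s),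
      ← tsum_mul_left]
    refine tsum_congr fun i => ?_
    simp only [σ, Equiv.coe_fn_mk, hneg]
    exact dualTerm_neg huv (hint _ _) t s
  rw [hinv]
  ring

end HeckeTheta

end

noncomputable section

namespace HeckeTheta

open Module NumberField
open scoped nonZeroDivisors NumberField

/-! ### Real quadratic fields -/

section Quadratic

variable {F : Type*} [Field F] [NumberField F] {σ σ' : F →+* ℝ}

/-- The complex embeddings of a quadratic field with two real embeddings. -/
lemma univ_algHom_eq (hF : finrank ℚ F = 2) (hσ : σ ≠ σ') :
    ∃ τ τ' : F →ₐ[ℚ] ℂ, τ ≠ τ' ∧ (∀ x, τ x = σ x) ∧ (∀ x, τ' x = σ' x) ∧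
      ∀ φ : F →ₐ[ℚ] ℂ, φ = τ ∨ φ = τ' := by
  classical
  set τ : F →ₐ[ℚ] ℂ := (Complex.ofRealHom.comp σ).toRatAlgHom
  set τ' : F →ₐ[ℚ] ℂ := (Complex.ofRealHom.comp σ').toRatAlgHom
  have hne : τ ≠ τ' := by
    intro h
    apply hσ
    ext x
    have := DFunLike.congr_fun h x
    exact Complex.ofReal_injective this
  refine ⟨τ, τ', hne, fun x => rfl, fun x => rfl, fun φ => ?_⟩
  have hcard : Fintype.card (F →ₐ[ℚ] ℂ) = 2 := by rw [AlgHom.card, hF]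
  have huniv : ({τ, τ'} : Finset (F →ₐ[ℚ] ℂ)) = Finset.univ := by
    apply Finset.eq_univ_of_card
    rw [Finset.card_pair hne, hcard]
  have : φ ∈ ({τ, τ'} : Finset (F →ₐ[ℚ] ℂ)) := huniv ▸ Finset.mem_univ φ
  simpa using this

lemma trace_eq (hF : finrank ℚ F = 2) (hσ : σ ≠ σ') (x : F) :
    ((Algebra.trace ℚ F x : ℚ) : ℝ) = σ x + σ' x := by
  classical
  obtain ⟨τ, τ', hne, h1, h2, h3⟩ := univ_algHom_eq hF hσ
  have huniv : (Finset.univ : Finset (F →ₐ[ℚ] ℂ)) = {τ, τ'} := by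
    ext φ; simpa using h3 φ
  have := trace_eq_sum_embeddings (K := ℚ) ℂ (x := x)
  rw [huniv, Finset.sum_pair hne, h1, h2] at this
  simp only [eq_ratCast] at this
  exact_mod_cast this

lemma norm_eq (hF : finrank ℚ F = 2) (hσ : σ ≠ σ') (x : F) :
    ((Algebra.norm ℚ x : ℚ) : ℝ) = σ x * σ' x := by
  classical
  obtain ⟨τ, τ', hne, h1, h2, h3⟩ := univ_algHom_eq hF hσ
  have huniv : (Finset.univ : Finset (F →ₐ[ℚ] ℂ)) = {τ, τ'} := by
    ext φ; simpa using h3 φ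
  have := Algebra.norm_eq_prod_embeddings ℚ (E := ℂ) x
  rw [huniv, Finset.prod_pair hne, h1, h2] at this
  simp only [eq_ratCast] at this
  exact_mod_cast this

/-- The Galois conjugate. -/
def galConj (x : F) : F := (Algebra.trace ℚ F x : ℚ) - x

lemma map_galConj (hF : finrank ℚ F = 2) (hσ : σ ≠ σ') (x : F) : σ (galConj x) = σ' x := by
  rw [galConj, map_sub, map_ratCast, trace_eq hF hσ]; ring

lemma map_galConj' (hF : finrank ℚ F = 2) (hσ : σ ≠ σ') (x : F) : σ' (galConj x) = σ x := by
  rw [galConj, map_sub, map_ratCast, trace_eq hF hσ]; ring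

lemma galConj_mem_integers (x : 𝓞 F) : ∃ y : 𝓞 F, (y : F) = galConj (x : F) := by
  have h : IsIntegral ℤ (galConj (x : F)) := by
    rw [galConj, ← eq_ratCast (algebraMap ℚ F)]
    exact ((Algebra.isIntegral_trace x.isIntegral_coe).map (IsScalarTower.toAlgHom ℤ ℚ F)).sub
      x.isIntegral_coe
  exact ⟨⟨_, h⟩, rfl⟩

/-- The determinant `x y' - y x'` of the two embeddings. -/
def embDet (σ σ' : F →+* ℝ) (x y : F) : ℝ := σ x * σ' y - σ y * σ' x

lemma embDet_smul_add (a b c d : ℚ) (x y : F) :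
    embDet σ σ' (a * x + b * y) (c * x + d * y) = (a * d - b * c : ℚ) * embDet σ σ' x y := by
  simp only [embDet, map_add, map_mul, map_ratCast]
  push_cast
  ring

/-- `ℤ`-bases of all fractional ideals, with their determinants. -/
lemma exists_ideal_bases (hF : finrank ℚ F = 2) (hσ : σ ≠ σ') :
    ∃ w₁ w₂ : F, embDet σ σ' w₁ w₂ ≠ 0 ∧ ∀ I : FractionalIdeal (𝓞 F)⁰ F, I ≠ 0 → ∃ e₁ e₂ : F,
      (∀ x, x ∈ I ↔ ∃ m n : ℤ, x = m * e₁ + n * e₂) ∧ (∀ x, ∃ a b : ℚ, x = a * e₁ + b * e₂) ∧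
      |embDet σ σ' e₁ e₂| = ((FractionalIdeal.absNorm I : ℚ) : ℝ) * |embDet σ σ' w₁ w₂| := by
  classical
  have hrank : finrank ℤ (𝓞 F) = 2 := by rw [RingOfIntegers.rank, hF]
  set B := Module.finBasisOfFinrankEq ℤ (𝓞 F) hrank
  set W : Basis (Fin 2) ℚ F := B.localizationLocalization ℚ ℤ⁰ F
  have hW : ∀ x : F, x = (W.repr x 0 : F) * W 0 + (W.repr x 1 : F) * W 1 := by
    intro x
    have := W.sum_repr x
    rw [Fin.sum_univ_two, Rat.smul_def, Rat.smul_def] at this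
    exact this.symm
  have hne : embDet σ σ' (W 0) (W 1) ≠ 0 := by
    intro h0
    have key : ∀ x, embDet σ σ' (W 0) x = 0 := by
      intro x
      have := embDet_smul_add (σ := σ) (σ' := σ') 1 0 (W.repr x 0) (W.repr x 1) (W 0) (W 1)
      rw [← hW x, h0] at this
      simpa using this
    have h1 := key 1
    have hw : σ (W 0) ≠ 0 := (map_ne_zero σ).2 (W.ne_zero 0)
    simp only [embDet, map_one, mul_one, one_mul] at h1
    apply hσ
    ext x
    have hx := key x
    simp only [embDet] at hx
    have h2 : σ' (W 0) = σ (W 0) := by linarith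
    rw [h2] at hx
    have : σ (W 0) * (σ' x - σ x) = 0 := by linarith
    rcases mul_eq_zero.1 this with h | h
    · exact absurd h hw
    · linarith
  refine ⟨W 0, W 1, hne, fun I hI => ?_⟩
  have hrankI : finrank ℤ I = 2 := by
    have := fractionalIdeal_rank F (Units.mk0 I hI)
    rw [hrank] at this
    exact this
  set bI := Module.finBasisOfFinrankEq ℤ I hrankI
  have habs := FractionalIdeal.abs_det_basis_change B I bI
  have hdet : embDet σ σ' (bI 0 : F) (bI 1 : F) =
      ((W.det ((↑) ∘ bI) : ℚ) : ℝ) * embDet σ σ' (W 0) (W 1) := by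
    have h0 := hW (bI 0 : F)
    have h1 := hW (bI 1 : F)
    have := embDet_smul_add (σ := σ) (σ' := σ') (W.repr (bI 0 : F) 0) (W.repr (bI 0 : F) 1)
      (W.repr (bI 1 : F) 0) (W.repr (bI 1 : F) 1) (W 0) (W 1)
    rw [← h0, ← h1] at this
    rw [this, Basis.det_apply, Matrix.det_fin_two]
    simp only [Basis.toMatrix_apply, Function.comp_apply]
    push_cast
    ring
  have habs' : |embDet σ σ' (bI 0 : F) (bI 1 : F)| =
      ((FractionalIdeal.absNorm I : ℚ) : ℝ) * |embDet σ σ' (W 0) (W 1)| := by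
    rw [hdet, abs_mul, ← habs]
    push_cast
    rfl
  refine ⟨bI 0, bI 1, fun x => ⟨fun hx => ?_, ?_⟩, fun x => ?_, habs'⟩
  · refine ⟨bI.repr ⟨x, hx⟩ 0, bI.repr ⟨x, hx⟩ 1, ?_⟩
    have := congrArg (fun y : I => (y : F)) (bI.sum_repr ⟨x, hx⟩)
    simp only [Fin.sum_univ_two] at this
    refine this.symm.trans ?_
    simp [zsmul_eq_mul]
  · rintro ⟨m, n, rfl⟩
    have := (m • bI 0 + n • bI 1).2
    simpa [zsmul_eq_mul] using this
  · set d := W.det ((↑) ∘ bI)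
    have hd : d ≠ 0 := by
      have h0 : FractionalIdeal.absNorm I ≠ 0 := by
        rw [Ne, FractionalIdeal.absNorm_eq_zero_iff]; exact hI
      intro h
      apply h0
      rw [← habs]
      rw [h, abs_zero]
    have hd' : d = W.repr (bI 0 : F) 0 * W.repr (bI 1 : F) 1 -
        W.repr (bI 1 : F) 0 * W.repr (bI 0 : F) 1 := by
      simp only [d]
      rw [Basis.det_apply, Matrix.det_fin_two]
      simp only [Basis.toMatrix_apply, Function.comp_apply]
    have h0 := hW (bI 0 : F)
    have h1 := hW (bI 1 : F)
    have hx := hW x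
    generalize W.repr (bI 0 : F) 0 = a at *
    generalize W.repr (bI 0 : F) 1 = b at *
    generalize W.repr (bI 1 : F) 0 = a' at *
    generalize W.repr (bI 1 : F) 1 = b' at *
    refine ⟨(W.repr x 0 * b' - W.repr x 1 * a') / d, (W.repr x 1 * a - W.repr x 0 * b) / d, ?_⟩
    have hdF : (d : F) ≠ 0 := by exact_mod_cast hd
    have hdF' : (d : F) = a * b' - a' * b := by rw [hd']; push_cast; ring
    conv_lhs => rw [hx]
    rw [h0, h1]
    push_cast
    field_simp
    rw [hdF']
    ring

/-- Membership in a fractional ideal in terms of `embDet`. -/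
lemma mem_iff_embDet {I : FractionalIdeal (𝓞 F)⁰ F} (hI : I ≠ 0) {d : ℝ} (hd : d ≠ 0)
    {e₁ e₂ : F} (hmem : ∀ x, x ∈ I ↔ ∃ m n : ℤ, x = m * e₁ + n * e₂)
    (hspan : ∀ x, ∃ a b : ℚ, x = a * e₁ + b * e₂)
    (hdet : |embDet σ σ' e₁ e₂| = ((FractionalIdeal.absNorm I : ℚ) : ℝ) * |d|) (y : F) :
    (∀ l ∈ I, ∃ n : ℤ,
      embDet σ σ' l y = n * (((FractionalIdeal.absNorm I : ℚ) : ℝ) * d)) ↔ y ∈ I := by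
  have hA : ((FractionalIdeal.absNorm I : ℚ) : ℝ) ≠ 0 := by
    rw [Ne, Rat.cast_eq_zero, FractionalIdeal.absNorm_eq_zero_iff]
    exact hI
  have hA0 : (0 : ℝ) ≤ ((FractionalIdeal.absNorm I : ℚ) : ℝ) := by
    exact_mod_cast FractionalIdeal.absNorm_nonneg I
  have hε : ∃ ε : ℤ, ε * ε = 1 ∧
      embDet σ σ' e₁ e₂ = ε * (((FractionalIdeal.absNorm I : ℚ) : ℝ) * d) := by
    have h1 : |embDet σ σ' e₁ e₂| = |((FractionalIdeal.absNorm I : ℚ) : ℝ) * d| := by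
      rw [hdet, abs_mul, abs_of_nonneg hA0]
    rcases abs_eq_abs.1 h1 with h | h
    · exact ⟨1, by norm_num, by simpa using h⟩
    · exact ⟨-1, by norm_num, by simpa using h⟩
  obtain ⟨ε, hε1, hε2⟩ := hε
  set A := ((FractionalIdeal.absNorm I : ℚ) : ℝ) * d
  have hA' : A ≠ 0 := mul_ne_zero hA hd
  have hεR : (ε : ℝ) * ε = 1 := by exact_mod_cast hε1
  constructor
  · intro h
    obtain ⟨a, b, hab⟩ := hspan y
    obtain ⟨n₁, h1⟩ := h e₁ ((hmem e₁).2 ⟨1, 0, by simp⟩)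
    obtain ⟨n₂, h2⟩ := h e₂ ((hmem e₂).2 ⟨0, 1, by simp⟩)
    have k1 := embDet_smul_add (σ := σ) (σ' := σ') 1 0 a b e₁ e₂
    have k2 := embDet_smul_add (σ := σ) (σ' := σ') 0 1 a b e₁ e₂
    rw [← hab, hε2] at k1 k2
    simp only [Rat.cast_one, Rat.cast_zero, one_mul, zero_mul, add_zero, zero_add, zero_sub,
      sub_zero, Rat.cast_neg] at k1 k2
    have hb : (b : ℝ) = (ε * n₁ : ℤ) := by
      have : (b : ℝ) * ε = n₁ := mul_right_cancel₀ hA' (by rw [← h1, k1]; ring)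
      push_cast
      rw [← this]
      linear_combination (-(b : ℝ)) * hεR
    have ha : (a : ℝ) = (-(ε * n₂) : ℤ) := by
      have : -(a : ℝ) * ε = n₂ := mul_right_cancel₀ hA' (by rw [← h2, k2]; ring)
      push_cast
      rw [← this]
      linear_combination (-(a : ℝ)) * hεR
    have hb' : b = (ε * n₁ : ℤ) := by exact_mod_cast hb
    have ha' : a = (-(ε * n₂) : ℤ) := by exact_mod_cast ha
    rw [hmem]
    exact ⟨-(ε * n₂), ε * n₁, by rw [hab, ha', hb']; push_cast; ring⟩
  · intro hy l hl
    obtain ⟨m, n, rfl⟩ := (hmem y).1 hy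
    obtain ⟨m', n', rfl⟩ := (hmem l).1 hl
    refine ⟨(m' * n - n' * m) * ε, ?_⟩
    have := embDet_smul_add (σ := σ) (σ' := σ') m' n' m n e₁ e₂
    push_cast at this ⊢
    rw [this, hε2]
    ring

lemma levelN_pos {I : FractionalIdeal (𝓞 F)⁰ F} (hI : I ≠ 0) {κ : ℕ} (hκ : 0 < κ) :
    0 < levelN I κ := by
  have h : FractionalIdeal.absNorm I ≠ 0 := by
    rw [Ne, FractionalIdeal.absNorm_eq_zero_iff]; exact hI
  have h' : 0 < FractionalIdeal.absNorm I :=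
    lt_of_le_of_ne (FractionalIdeal.absNorm_nonneg I) (Ne.symm h)
  rw [levelN]
  have : (0 : ℝ) < ((FractionalIdeal.absNorm I : ℚ) : ℝ) := by exact_mod_cast h'
  positivity

omit [NumberField F] in
lemma mem_lattice {I : FractionalIdeal (𝓞 F)⁰ F} {x : F} : x ∈ lattice I ↔ x ∈ I := Iff.rfl

lemma mem_dualLattice_iff' {I : FractionalIdeal (𝓞 F)⁰ F} {κ : ℕ} {μ : F} :
    μ ∈ dualLattice σ σ' I κ ↔ ∀ l ∈ I, ∃ n : ℤ,
      planeBil (levelN I κ) (emb σ σ' l) (emb σ σ' μ) = n := Iff.rfl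

/-- A generator of the different of a real quadratic field and bases of the fractional ideals. -/
structure IsDifferentGenerator (σ σ' : F →+* ℝ) (δ : F) : Prop where
  ne_zero : σ δ ≠ 0
  conj : σ' δ = -σ δ
  span : ((differentIdeal ℤ (𝓞 F) : Ideal (𝓞 F)) : FractionalIdeal (𝓞 F)⁰ F) =
    FractionalIdeal.spanSingleton (𝓞 F)⁰ δ
  bases : ∀ I : FractionalIdeal (𝓞 F)⁰ F, I ≠ 0 → ∃ e₁ e₂ : F,
    (∀ x, x ∈ I ↔ ∃ m n : ℤ, x = m * e₁ + n * e₂) ∧ (∀ x, ∃ a b : ℚ, x = a * e₁ + b * e₂) ∧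
      |embDet σ σ' e₁ e₂| = ((FractionalIdeal.absNorm I : ℚ) : ℝ) * |σ δ|

lemma exists_isDifferentGenerator (hF : finrank ℚ F = 2) (hσ : σ ≠ σ') :
    ∃ δ : F, IsDifferentGenerator σ σ' δ := by
  obtain ⟨w₁, w₂, hw, hbases⟩ := exists_ideal_bases hF hσ
  set δ := w₁ * galConj w₂ - w₂ * galConj w₁
  have h1 : σ δ = embDet σ σ' w₁ w₂ := by
    simp only [δ, embDet, map_sub, map_mul, map_galConj hF hσ]
  have h2 : σ' δ = -σ δ := by
    rw [h1]
    simp only [δ, embDet, map_sub, map_mul, map_galConj' hF hσ]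
    ring
  have hδ : σ δ ≠ 0 := by rwa [h1]
  have hδ0 : δ ≠ 0 := by rintro h; rw [h, map_zero] at hδ; exact hδ rfl
  refine ⟨δ, hδ, h2, ?_, by rw [h1]; exact hbases⟩
  have hdual : FractionalIdeal.dual ℤ ℚ (1 : FractionalIdeal (𝓞 F)⁰ F) =
      FractionalIdeal.spanSingleton (𝓞 F)⁰ δ⁻¹ := by
    have h10 : (1 : FractionalIdeal (𝓞 F)⁰ F) ≠ 0 := by
      rw [← FractionalIdeal.coeIdeal_top, Ne, FractionalIdeal.coeIdeal_eq_zero]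
      exact top_ne_bot
    ext x
    obtain ⟨e₁, e₂, hm, hs, hd⟩ := hbases 1 h10
    rw [← h1] at hd
    have key := mem_iff_embDet (σ := σ) (σ' := σ') h10 hδ hm hs hd (δ * x)
    simp only [map_one, Rat.cast_one, one_mul] at key
    have hspan : x ∈ FractionalIdeal.spanSingleton (𝓞 F)⁰ δ⁻¹ ↔
        δ * x ∈ (1 : FractionalIdeal (𝓞 F)⁰ F) := by
      rw [FractionalIdeal.mem_spanSingleton, FractionalIdeal.mem_one_iff]
      refine exists_congr fun z => ?_
      rw [Algebra.smul_def, ← div_eq_mul_inv, div_eq_iff hδ0, mul_comm x]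
    rw [hspan, ← key, FractionalIdeal.mem_dual h10]
    have hdet : ∀ l : F, embDet σ σ' l (δ * x) =
        -(((Algebra.trace ℚ F (x * galConj l) : ℚ) : ℝ) * σ δ) := by
      intro l
      rw [trace_eq hF hσ]
      simp only [embDet, map_mul, map_galConj hF hσ, map_galConj' hF hσ, h2]
      ring
    constructor
    · intro h l hl
      obtain ⟨z, rfl⟩ := (FractionalIdeal.mem_one_iff _).1 hl
      obtain ⟨y, hy⟩ := galConj_mem_integers z
      obtain ⟨n, hn⟩ := h _ ((FractionalIdeal.mem_one_iff _).2 ⟨y, rfl⟩)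
      rw [Algebra.traceForm_apply] at hn
      refine ⟨-n, ?_⟩
      have hn' : Algebra.trace ℚ F (x * galConj (algebraMap (𝓞 F) F z)) = n := by
        rw [← hy]; simpa using hn.symm
      rw [hdet, hn']
      push_cast
      ring
    · intro h l hl
      obtain ⟨z, rfl⟩ := (FractionalIdeal.mem_one_iff _).1 hl
      obtain ⟨y, hy⟩ := galConj_mem_integers z
      have hyz : galConj (y : F) = z := by
        apply σ.injective
        rw [map_galConj hF hσ, hy, map_galConj' hF hσ]
      obtain ⟨n, hn⟩ := h _ ((FractionalIdeal.mem_one_iff _).2 ⟨y, rfl⟩)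
      rw [hdet, hyz] at hn
      refine ⟨-n, ?_⟩
      rw [Algebra.traceForm_apply]
      have h3 : ((Algebra.trace ℚ F (x * z) : ℚ) : ℝ) = -n := by
        apply mul_right_cancel₀ hδ
        linarith
      have h4 : Algebra.trace ℚ F (x * (z : F)) = -n := by exact_mod_cast h3
      rw [h4]
      simp
  rw [coeIdeal_differentIdeal ℤ ℚ F (𝓞 F), hdual, FractionalIdeal.spanSingleton_inv, inv_inv]

namespace IsDifferentGenerator

variable {δ : F}

lemma ne_zero' (h : IsDifferentGenerator σ σ' δ) : δ ≠ 0 := by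
  intro h0
  have := h.ne_zero
  rw [h0, map_zero] at this
  exact this rfl

lemma mem_dualLattice_iff (h : IsDifferentGenerator σ σ' δ) {I : FractionalIdeal (𝓞 F)⁰ F}
    (hI : I ≠ 0) {κ : ℕ} (hκ : 0 < κ) {x : F} :
    x ∈ dualLattice σ σ' I κ ↔ κ * δ * x ∈ I := by
  obtain ⟨e₁, e₂, hm, hs, hd⟩ := h.bases I hI
  rw [← mem_iff_embDet hI h.ne_zero hm hs hd, mem_dualLattice_iff']
  have hN := levelN_pos hI hκ
  have hκ' : (κ : ℝ) ≠ 0 := by positivity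
  have hA : ((FractionalIdeal.absNorm I : ℚ) : ℝ) ≠ 0 := by
    rw [Ne, Rat.cast_eq_zero, FractionalIdeal.absNorm_eq_zero_iff]
    exact hI
  have hδ := h.ne_zero
  have key : ∀ l, embDet σ σ' l (κ * δ * x) =
      -(planeBil (levelN I κ) (emb σ σ' l) (emb σ σ' x) *
        (((FractionalIdeal.absNorm I : ℚ) : ℝ) * σ δ)) := by
    intro l
    simp only [embDet, planeBil, emb, levelN, map_mul, map_natCast, h.conj]
    field_simp
    ring
  refine forall₂_congr fun l _ => ?_
  constructor
  · rintro ⟨n, hn⟩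
    exact ⟨-n, by rw [key, hn]; push_cast; ring⟩
  · rintro ⟨n, hn⟩
    refine ⟨-n, ?_⟩
    rw [key] at hn
    apply mul_right_cancel₀ (mul_ne_zero hA hδ)
    push_cast
    linarith

end IsDifferentGenerator

end Quadratic

end HeckeTheta

end

noncomputable section

namespace HeckeTheta

open Module NumberField
open scoped nonZeroDivisors NumberField

/-! ### The lattices of a real quadratic field in the plane -/

section Quadratic

variable {F : Type*} [Field F] [NumberField F] {σ σ' : F →+* ℝ}

/-- The embedding of `F` into the plane that turns `Nm / N` into the form `xy`. -/
def nemb (σ σ' : F →+* ℝ) (N : ℝ) (x : F) : ℝ × ℝ := (σ x / √N, σ' x / √N)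

omit [NumberField F] in
lemma pairing_nemb {N : ℝ} (hN : 0 < N) (x y : F) :
    pairing (nemb σ σ' N x) (nemb σ σ' N y) = planeBil N (emb σ σ' x) (emb σ σ' y) := by
  have h : √N * √N = N := Real.mul_self_sqrt hN.le
  have h0 : √N ≠ 0 := (Real.sqrt_pos.2 hN).ne'
  simp only [pairing, nemb, planeBil, emb]
  conv_rhs => rw [← h]
  field_simp

omit [NumberField F] in
lemma nemb_comb (N : ℝ) (e₁ e₂ : F) (m n : ℤ) :
    nemb σ σ' N (m * e₁ + n * e₂) = latVec (nemb σ σ' N e₁) (nemb σ σ' N e₂) (m, n) := by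
  simp only [nemb, latVec, map_add, map_mul, map_intCast, Prod.mk.injEq]
  constructor <;> ring

omit [NumberField F] in
lemma nemb_sub (N : ℝ) (x y : F) :
    nemb σ σ' N (x - y) = nemb σ σ' N x - nemb σ σ' N y := by
  simp only [nemb, map_sub, Prod.mk_sub_mk, sub_div]

omit [NumberField F] in
lemma coe_mul_mem {I : FractionalIdeal (𝓞 F)⁰ F} (c : 𝓞 F) {x : F} (hx : x ∈ I) :
    (c : F) * x ∈ I := by
  have := Submodule.smul_mem (I : Submodule (𝓞 F) F) c hx
  rwa [Algebra.smul_def] at this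

/-- Pairs of elements of `L^∨` in the same coset of `L`. -/
abbrev PairIdx (σ σ' : F →+* ℝ) (I : FractionalIdeal (𝓞 F)⁰ F) (κ : ℕ) : Type _ :=
  {x : F × F // x.1 ∈ dualLattice σ σ' I κ ∧ x.2 ∈ dualLattice σ σ' I κ ∧
    x.1 - x.2 ∈ lattice I}

namespace PairIdx

variable {I : FractionalIdeal (𝓞 F)⁰ F} {κ : ℕ}

/-- The first vector of a pair, normalized. -/
def fstVec (i : PairIdx σ σ' I κ) : ℝ × ℝ := nemb σ σ' (levelN I κ) i.1.1

/-- The second vector of a pair, normalized. -/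
def sndVec (i : PairIdx σ σ' I κ) : ℝ × ℝ := nemb σ σ' (levelN I κ) i.1.2

end PairIdx

/-- Dual bases of `L` and `L^∨`. -/
lemma IsDifferentGenerator.exists_dual_bases {δ : F} (h : IsDifferentGenerator σ σ' δ)
    {I : FractionalIdeal (𝓞 F)⁰ F} (hI : I ≠ 0) {κ : ℕ} (hκ : 0 < κ) :
    ∃ e₁ e₂ f₁ f₂ : F, (∀ x, x ∈ lattice I ↔ ∃ m n : ℤ, x = m * e₁ + n * e₂) ∧
      (∀ x, x ∈ dualLattice σ σ' I κ ↔ ∃ m n : ℤ, x = m * f₁ + n * f₂) ∧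
      IsDualPair (nemb σ σ' (levelN I κ) e₁) (nemb σ σ' (levelN I κ) e₂)
        (nemb σ σ' (levelN I κ) f₁) (nemb σ σ' (levelN I κ) f₂) := by
  obtain ⟨e₁, e₂, hm, -, hd⟩ := h.bases I hI
  have hN := levelN_pos hI hκ
  have hκ' : (κ : ℝ) ≠ 0 := by positivity
  have hκF : (κ : F) ≠ 0 := by exact_mod_cast hκ.ne'
  have hδF := h.ne_zero'
  have hδ := h.ne_zero
  have hA : ((FractionalIdeal.absNorm I : ℚ) : ℝ) ≠ 0 := by
    rw [Ne, Rat.cast_eq_zero, FractionalIdeal.absNorm_eq_zero_iff]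
    exact hI
  have hA0 : (0 : ℝ) ≤ ((FractionalIdeal.absNorm I : ℚ) : ℝ) := by
    exact_mod_cast FractionalIdeal.absNorm_nonneg I
  obtain ⟨ε, hε1, hε2⟩ : ∃ ε : ℤ, ε * ε = 1 ∧
      embDet σ σ' e₁ e₂ = ε * (((FractionalIdeal.absNorm I : ℚ) : ℝ) * σ δ) := by
    have h1 : |embDet σ σ' e₁ e₂| = |((FractionalIdeal.absNorm I : ℚ) : ℝ) * σ δ| := by
      rw [hd, abs_mul, abs_of_nonneg hA0]
    rcases abs_eq_abs.1 h1 with h | h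
    · exact ⟨1, by norm_num, by simpa using h⟩
    · exact ⟨-1, by norm_num, by simpa using h⟩
  have hεR : (ε : ℝ) * ε = 1 := by exact_mod_cast hε1
  have hεF : (ε : F) * ε = 1 := by exact_mod_cast congrArg (Int.cast (R := F)) hε1
  have hp : ∀ (l y : F) (s : ℤ), pairing (nemb σ σ' (levelN I κ) l)
      (nemb σ σ' (levelN I κ) (s * y / (κ * δ))) =
        -(s * embDet σ σ' l y / (((FractionalIdeal.absNorm I : ℚ) : ℝ) * σ δ)) := by
    intro l y s
    rw [pairing_nemb hN]
    simp only [embDet, planeBil, emb, levelN, map_mul, map_div₀, map_natCast, map_intCast, h.conj]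
    field_simp
    ring
  have hself : ∀ y, embDet σ σ' y y = 0 := fun y => by simp only [embDet]; ring
  have hanti : embDet σ σ' e₂ e₁ = -embDet σ σ' e₁ e₂ := by simp only [embDet]; ring
  refine ⟨e₁, e₂, (-ε : ℤ) * e₂ / (κ * δ), ε * e₁ / (κ * δ), hm, fun x => ?_, ?_, ?_, ?_, ?_⟩
  · rw [h.mem_dualLattice_iff hI hκ, hm]
    constructor
    · rintro ⟨m, n, hx⟩
      refine ⟨-(ε * n), ε * m, ?_⟩
      have : x = (κ * δ * x) / (κ * δ) := by field_simp
      rw [this, hx]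
      push_cast
      field_simp
      linear_combination (-(m * e₁ + n * e₂)) * hεF
    · rintro ⟨m, n, rfl⟩
      refine ⟨ε * n, -(ε * m), ?_⟩
      push_cast
      field_simp
      ring
  · rw [hp, hε2]
    push_cast
    field_simp
    linear_combination hεR
  · rw [hp, hself]; simp
  · rw [hp, hself]; simp
  · rw [hp, hanti, hε2]
    field_simp
    linear_combination hεR

/-- The norm form is integral on an integral ideal. -/
lemma exists_int_norm_eq (hF : finrank ℚ F = 2) (hσ : σ ≠ σ') {𝔞 : Ideal (𝓞 F)} (h𝔞 : 𝔞 ≠ ⊥)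
    {κ : ℕ} (hκ : 0 < κ) {l : F} (hl : l ∈ lattice (𝔞 : FractionalIdeal (𝓞 F)⁰ F)) :
    ∃ n : ℤ, (nemb σ σ' (levelN (𝔞 : FractionalIdeal (𝓞 F)⁰ F) κ) l).1 *
      (nemb σ σ' (levelN (𝔞 : FractionalIdeal (𝓞 F)⁰ F) κ) l).2 = n := by
  obtain ⟨y, hy, rfl⟩ := (FractionalIdeal.mem_coeIdeal _).1 (mem_lattice.1 hl)
  obtain ⟨k, hk⟩ := Ideal.absNorm_dvd_norm_of_mem hy
  have hN := levelN_pos (FractionalIdeal.coeIdeal_ne_zero.2 h𝔞 :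
    (𝔞 : FractionalIdeal (𝓞 F)⁰ F) ≠ 0) hκ
  have hs : √(levelN (𝔞 : FractionalIdeal (𝓞 F)⁰ F) κ) * √(levelN (𝔞 : FractionalIdeal (𝓞 F)⁰ F) κ)
    = levelN (𝔞 : FractionalIdeal (𝓞 F)⁰ F) κ := Real.mul_self_sqrt hN.le
  refine ⟨κ * k, ?_⟩
  simp only [nemb]
  rw [div_mul_div_comm, hs, ← norm_eq hF hσ, div_eq_iff hN.ne', levelN,
    FractionalIdeal.coeIdeal_absNorm]
  have h1 : Algebra.norm ℚ (algebraMap (𝓞 F) F y) = ((Algebra.norm ℤ y : ℤ) : ℚ) :=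
    (Algebra.coe_norm_int y).symm
  have hκ' : (κ : ℝ) ≠ 0 := by positivity
  rw [h1, hk]
  push_cast
  field_simp

lemma lattice_le_dualLattice (hF : finrank ℚ F = 2) (hσ : σ ≠ σ') {𝔞 : Ideal (𝓞 F)}
    (h𝔞 : 𝔞 ≠ ⊥) {κ : ℕ} (hκ : 0 < κ) :
    lattice (𝔞 : FractionalIdeal (𝓞 F)⁰ F) ≤
      dualLattice σ σ' (𝔞 : FractionalIdeal (𝓞 F)⁰ F) κ := by
  intro x hx l hl
  have hN := levelN_pos (FractionalIdeal.coeIdeal_ne_zero.2 h𝔞 :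
    (𝔞 : FractionalIdeal (𝓞 F)⁰ F) ≠ 0) hκ
  obtain ⟨a, ha⟩ := exists_int_norm_eq hF hσ h𝔞 hκ hx
  obtain ⟨b, hb⟩ := exists_int_norm_eq hF hσ h𝔞 hκ hl
  obtain ⟨c, hc⟩ := exists_int_norm_eq hF hσ h𝔞 hκ (add_mem hx hl)
  refine ⟨c - a - b, ?_⟩
  rw [← pairing_nemb hN]
  push_cast
  rw [← ha, ← hb, ← hc]
  simp only [nemb, pairing, map_add]
  ring

lemma IsDualPair.pairing_latVec {e₁ e₂ f₁ f₂ : ℝ × ℝ} (h : IsDualPair e₁ e₂ f₁ f₂) (n : ℤ × ℤ) :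
    pairing (latVec e₁ e₂ n) f₁ = n.1 ∧ pairing (latVec e₁ e₂ n) f₂ = n.2 := by
  have h11 := h.h11
  have h12 := h.h12
  have h21 := h.h21
  have h22 := h.h22
  simp only [pairing, latVec] at *
  constructor
  · linear_combination n.1 * h11 + n.2 * h21
  · linear_combination n.1 * h12 + n.2 * h22

lemma IsDualPair.latVec_injective {e₁ e₂ f₁ f₂ : ℝ × ℝ} (h : IsDualPair e₁ e₂ f₁ f₂) :
    Function.Injective (latVec e₁ e₂) := by
  intro m n hmn
  have h1 := h.pairing_latVec m
  have h2 := h.pairing_latVec n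
  rw [hmn] at h1
  refine Prod.ext ?_ ?_
  · exact_mod_cast h1.1.symm.trans h2.1
  · exact_mod_cast h1.2.symm.trans h2.2

/-- The family of pairs in terms of dual bases. -/
lemma IsDifferentGenerator.exists_pairIdx_equiv {δ : F} (h : IsDifferentGenerator σ σ' δ)
    {I : FractionalIdeal (𝓞 F)⁰ F} (hI : I ≠ 0) {κ : ℕ} (hκ : 0 < κ)
    (hsub : lattice I ≤ dualLattice σ σ' I κ) :
    ∃ (e₁ e₂ f₁ f₂ : F) (Φ : (ℤ × ℤ) × ℤ × ℤ ≃ PairIdx σ σ' I κ),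
      e₁ ∈ lattice I ∧ e₂ ∈ lattice I ∧
      IsDualPair (nemb σ σ' (levelN I κ) e₁) (nemb σ σ' (levelN I κ) e₂)
        (nemb σ σ' (levelN I κ) f₁) (nemb σ σ' (levelN I κ) f₂) ∧
      (∀ i, (Φ i).fstVec =
        latVec (nemb σ σ' (levelN I κ) f₁) (nemb σ σ' (levelN I κ) f₂) i.2) ∧
      ∀ i, (Φ i).sndVec =
        latVec (nemb σ σ' (levelN I κ) f₁) (nemb σ σ' (levelN I κ) f₂) i.2 -
          latVec (nemb σ σ' (levelN I κ) e₁) (nemb σ σ' (levelN I κ) e₂) i.1 := by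
  obtain ⟨e₁, e₂, f₁, f₂, he, hf, hd⟩ := h.exists_dual_bases hI hκ
  have hN := levelN_pos hI hκ
  have hl : ∀ m n : ℤ, m * e₁ + n * e₂ ∈ lattice I := fun m n => (he _).2 ⟨m, n, rfl⟩
  have hd' : ∀ m n : ℤ, m * f₁ + n * f₂ ∈ dualLattice σ σ' I κ := fun m n => (hf _).2 ⟨m, n, rfl⟩
  set Φ₀ : (ℤ × ℤ) × ℤ × ℤ → PairIdx σ σ' I κ := fun i =>
    ⟨(i.2.1 * f₁ + i.2.2 * f₂, i.2.1 * f₁ + i.2.2 * f₂ - (i.1.1 * e₁ + i.1.2 * e₂)),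
      hd' _ _, sub_mem (hd' _ _) (hsub (hl _ _)), by rw [sub_sub_cancel]; exact hl _ _⟩
  have h1 : ∀ i, (Φ₀ i).fstVec =
      latVec (nemb σ σ' (levelN I κ) f₁) (nemb σ σ' (levelN I κ) f₂) i.2 :=
    fun i => nemb_comb _ _ _ _ _
  have h2 : ∀ i, (Φ₀ i).sndVec =
        latVec (nemb σ σ' (levelN I κ) f₁) (nemb σ σ' (levelN I κ) f₂) i.2 -
          latVec (nemb σ σ' (levelN I κ) e₁) (nemb σ σ' (levelN I κ) e₂) i.1 := fun i => by
    simp only [PairIdx.sndVec, Φ₀]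
    rw [nemb_sub, nemb_comb, nemb_comb]
  have hbij : Function.Bijective Φ₀ := by
    constructor
    · intro i j hij
      have k2 : i.2 = j.2 := hd.symm.latVec_injective (by rw [← h1, ← h1, hij])
      have k1 : i.1 = j.1 := hd.latVec_injective (by
        have := h2 i
        rw [hij, h2 j, k2] at this
        exact (sub_right_injective this).symm)
      exact Prod.ext k1 k2
    · rintro ⟨⟨x, y⟩, hx, hy, hxy⟩
      obtain ⟨m, n, rfl⟩ := (hf x).1 hx
      obtain ⟨m', n', hm⟩ := (he _).1 hxy
      refine ⟨((m', n'), (m, n)), Subtype.ext (Prod.ext rfl ?_)⟩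
      simp only [Φ₀]
      rw [← hm]
      simp
  exact ⟨e₁, e₂, f₁, f₂, Equiv.ofBijective Φ₀ hbij, (he _).2 ⟨1, 0, by simp⟩,
    (he _).2 ⟨0, 1, by simp⟩, hd, h1, h2⟩

/-! ### Units -/

lemma unit_mul_conj (hF : finrank ℚ F = 2) (hσ : σ ≠ σ') {u : (𝓞 F)ˣ}
    (h1 : 0 < σ ((u : 𝓞 F) : F)) (h2 : 0 < σ' ((u : 𝓞 F) : F)) :
    σ ((u : 𝓞 F) : F) * σ' ((u : 𝓞 F) : F) = 1 := by
  have h := (NumberField.isUnit_iff_norm (K := F) (x := (u : 𝓞 F))).1 u.isUnit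
  have h3 := norm_eq hF hσ ((u : 𝓞 F) : F)
  rw [RingOfIntegers.coe_norm] at h
  have h4 : (0 : ℝ) < (Algebra.norm ℚ ((u : 𝓞 F) : F) : ℚ) := by
    rw [h3]; exact mul_pos h1 h2
  rw [← h3]
  have h5 : 0 < Algebra.norm ℚ ((u : 𝓞 F) : F) := by exact_mod_cast h4
  rw [abs_of_pos h5] at h
  rw [h, Rat.cast_one]

/-- The infimum in the definition of `ε_κ` is attained, unless its logarithm vanishes. -/
lemma log_epsUnit_eq_zero_or (σ σ' : F →+* ℝ) (κ : ℕ) : Real.log (epsUnit σ σ' κ) = 0 ∨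
    ∃ u : (𝓞 F)ˣ, epsUnit σ σ' κ = σ ((u : 𝓞 F) : F) ∧ 1 < σ ((u : 𝓞 F) : F) ∧
      0 < σ' ((u : 𝓞 F) : F) ∧
      (u : 𝓞 F) - 1 ∈ Ideal.span {(κ : 𝓞 F)} * differentIdeal ℤ (𝓞 F) := by
  by_contra! hcon
  obtain ⟨h0, hcon⟩ := hcon
  set S := {x : ℝ | ∃ u : (𝓞 F)ˣ, x = σ ((u : 𝓞 F) : F) ∧ 1 < σ ((u : 𝓞 F) : F) ∧
    0 < σ' ((u : 𝓞 F) : F) ∧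
    (u : 𝓞 F) - 1 ∈ Ideal.span {(κ : 𝓞 F)} * differentIdeal ℤ (𝓞 F)} with hS
  have heps : epsUnit σ σ' κ = sInf S := rfl
  have hne : S.Nonempty := by
    by_contra h
    rw [Set.not_nonempty_iff_eq_empty] at h
    rw [heps, h] at h0
    simp at h0
  have hbdd : BddBelow S := ⟨1, by rintro x ⟨u, rfl, h, -⟩; exact h.le⟩
  have hle : 1 ≤ sInf S := le_csInf hne (by rintro x ⟨u, rfl, h, -⟩; exact h.le)
  have hnot : ∀ x ∈ S, sInf S < x := by
    intro x hx
    refine lt_of_le_of_ne (csInf_le hbdd hx) fun h => ?_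
    obtain ⟨u, rfl, h1, h2, h3⟩ := hx
    exact hcon u (heps.trans h) h1 h2 h3
  have hlt : 1 < sInf S := by
    refine lt_of_le_of_ne hle fun h => h0 ?_
    rw [heps, ← h, Real.log_one]
  obtain ⟨x, hx, hx2⟩ := exists_lt_of_csInf_lt hne
    (show sInf S < sInf S * sInf S by nlinarith)
  obtain ⟨y, hy, hyx⟩ := exists_lt_of_csInf_lt hne (hnot x hx)
  have hy' := hnot y hy
  have hmem : x / y ∈ S := by
    obtain ⟨u, rfl, h1, h2, h3⟩ := hx
    obtain ⟨w, rfl, k1, k2, k3⟩ := hy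
    have hw : ((w⁻¹ : (𝓞 F)ˣ) : 𝓞 F) * (w : 𝓞 F) = 1 := by rw [← Units.val_mul]; simp
    have hwF : (((w⁻¹ : (𝓞 F)ˣ) : 𝓞 F) : F) = (((w : 𝓞 F)) : F)⁻¹ := by
      refine eq_inv_of_mul_eq_one_left ?_
      exact_mod_cast congrArg (algebraMap (𝓞 F) F) hw
    have hco : (((u * w⁻¹ : (𝓞 F)ˣ) : 𝓞 F) : F) = ((u : 𝓞 F) : F) / ((w : 𝓞 F) : F) := by
      rw [Units.val_mul, div_eq_mul_inv, ← hwF]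
      exact map_mul (algebraMap (𝓞 F) F) _ _
    refine ⟨u * w⁻¹, ?_, ?_, ?_, ?_⟩
    · rw [hco, map_div₀]
    · rw [hco, map_div₀, one_lt_div (by linarith)]; exact hyx
    · rw [hco, map_div₀]; positivity
    · have : ((u * w⁻¹ : (𝓞 F)ˣ) : 𝓞 F) - 1 =
          ((w⁻¹ : (𝓞 F)ˣ) : 𝓞 F) * (((u : 𝓞 F) - 1) - ((w : 𝓞 F) - 1)) := by
        rw [Units.val_mul]
        linear_combination hw
      rw [this]
      exact Ideal.mul_mem_left _ _ (sub_mem h3 k3)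
  have h4 := hnot _ hmem
  rw [lt_div_iff₀ (by linarith)] at h4
  nlinarith

lemma IsDifferentGenerator.unit_sub_one_mul_mem {δ : F} (h : IsDifferentGenerator σ σ' δ)
    {I : FractionalIdeal (𝓞 F)⁰ F} (hI : I ≠ 0) {κ : ℕ} (hκ : 0 < κ) {w : 𝓞 F}
    (hw : w ∈ Ideal.span {(κ : 𝓞 F)} * differentIdeal ℤ (𝓞 F)) {x : F}
    (hx : x ∈ dualLattice σ σ' I κ) : (w : F) * x ∈ lattice I := by
  obtain ⟨z, hz, rfl⟩ := Ideal.mem_span_singleton_mul.1 hw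
  have hz' : (z : F) ∈ ((differentIdeal ℤ (𝓞 F) : Ideal (𝓞 F)) : FractionalIdeal (𝓞 F)⁰ F) :=
    (FractionalIdeal.mem_coeIdeal _).2 ⟨z, hz, rfl⟩
  rw [h.span, FractionalIdeal.mem_spanSingleton] at hz'
  obtain ⟨c, hc⟩ := hz'
  have := coe_mul_mem c ((h.mem_dualLattice_iff hI hκ).1 hx)
  rw [mem_lattice]
  convert this using 1
  have h1 : ((κ * z : 𝓞 F) : F) = κ * (z : F) := by simp
  rw [h1, ← hc, Algebra.smul_def]
  ring

lemma IsDifferentGenerator.coe_mul_mem_dualLattice {δ : F} (h : IsDifferentGenerator σ σ' δ)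
    {I : FractionalIdeal (𝓞 F)⁰ F} (hI : I ≠ 0) {κ : ℕ} (hκ : 0 < κ) (w : 𝓞 F) {x : F}
    (hx : x ∈ dualLattice σ σ' I κ) : (w : F) * x ∈ dualLattice σ σ' I κ := by
  rw [h.mem_dualLattice_iff hI hκ] at hx ⊢
  have := coe_mul_mem w hx
  convert this using 1
  ring

/-- Multiplication of the first vector by a unit. -/
lemma IsDifferentGenerator.exists_unit_equiv {δ : F} (h : IsDifferentGenerator σ σ' δ)
    {I : FractionalIdeal (𝓞 F)⁰ F} (hI : I ≠ 0) {κ : ℕ} (hκ : 0 < κ) {u : (𝓞 F)ˣ}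
    (hu : (u : 𝓞 F) - 1 ∈ Ideal.span {(κ : 𝓞 F)} * differentIdeal ℤ (𝓞 F)) :
    ∃ Ψ : PairIdx σ σ' I κ ≃ PairIdx σ σ' I κ, ∀ i,
      (Ψ i).1 = (((u : 𝓞 F) : F) * i.1.1, i.1.2) := by
  have key : ∀ w : (𝓞 F)ˣ, (w : 𝓞 F) - 1 ∈ Ideal.span {(κ : 𝓞 F)} * differentIdeal ℤ (𝓞 F) →
      ∀ i : PairIdx σ σ' I κ, ((w : 𝓞 F) : F) * i.1.1 ∈ dualLattice σ σ' I κ ∧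
        i.1.2 ∈ dualLattice σ σ' I κ ∧ ((w : 𝓞 F) : F) * i.1.1 - i.1.2 ∈ lattice I := by
    intro w hw i
    refine ⟨h.coe_mul_mem_dualLattice hI hκ _ i.2.1, i.2.2.1, ?_⟩
    have := add_mem (h.unit_sub_one_mul_mem hI hκ hw i.2.1) i.2.2.2
    convert this using 1
    have h1 : (((w : 𝓞 F) - 1 : 𝓞 F) : F) = ((w : 𝓞 F) : F) - 1 := by simp
    rw [h1]
    ring
  have hw : ((u⁻¹ : (𝓞 F)ˣ) : 𝓞 F) * (u : 𝓞 F) = 1 := by rw [← Units.val_mul]; simp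
  have hwF : (((u⁻¹ : (𝓞 F)ˣ) : 𝓞 F) : F) * ((u : 𝓞 F) : F) = 1 := by
    exact_mod_cast congrArg (algebraMap (𝓞 F) F) hw
  have hu' : ((u⁻¹ : (𝓞 F)ˣ) : 𝓞 F) - 1 ∈
      Ideal.span {(κ : 𝓞 F)} * differentIdeal ℤ (𝓞 F) := by
    have : ((u⁻¹ : (𝓞 F)ˣ) : 𝓞 F) - 1 = -((u⁻¹ : (𝓞 F)ˣ) : 𝓞 F) * ((u : 𝓞 F) - 1) := by
      linear_combination hw
    rw [this]
    exact Ideal.mul_mem_left _ _ hu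
  refine ⟨⟨fun i => ⟨(((u : 𝓞 F) : F) * i.1.1, i.1.2), key u hu i⟩,
    fun i => ⟨((((u⁻¹ : (𝓞 F)ˣ) : 𝓞 F) : F) * i.1.1, i.1.2), key u⁻¹ hu' i⟩, fun i => ?_, fun i => ?_⟩,
    fun i => rfl⟩
  · refine Subtype.ext (Prod.ext ?_ rfl)
    simp only [← mul_assoc, hwF, one_mul]
  · refine Subtype.ext (Prod.ext ?_ rfl)
    change ((u : 𝓞 F) : F) * ((((u⁻¹ : (𝓞 F)ˣ) : 𝓞 F) : F) * i.1.1) = i.1.1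
    linear_combination i.1.1 * hwF

end Quadratic

end HeckeTheta

end

noncomputable section

namespace HeckeTheta

open Module NumberField MeasureTheory
open scoped nonZeroDivisors NumberField

/-! ### The theta series of a real quadratic field -/

lemma posCoord_add (p : ℝ × ℝ) (t T : ℝ) :
    posCoord p (t + T) = posCoord (p.1 * Real.exp (-T), p.2 * Real.exp T) t := by
  simp only [posCoord, neg_add, Real.exp_add]; ring

lemma negCoord_add (p : ℝ × ℝ) (t T : ℝ) :
    negCoord p (t + T) = negCoord (p.1 * Real.exp (-T), p.2 * Real.exp T) t := by
  simp only [negCoord, neg_add, Real.exp_add]; ring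

lemma majorant_add (p : ℝ × ℝ) (t T : ℝ) :
    majorant p (t + T) = majorant (p.1 * Real.exp (-T), p.2 * Real.exp T) t := by
  simp only [majorant, posCoord_add, negCoord_add]

lemma exp_neg_mul_exp_mul (p : ℝ × ℝ) (T : ℝ) :
    (p.1 * Real.exp (-T)) * (p.2 * Real.exp T) = p.1 * p.2 := by
  have : Real.exp (-T) * Real.exp T = 1 := by rw [← Real.exp_add]; simp
  linear_combination p.1 * p.2 * this

lemma wTerm_add (p q : ℝ × ℝ) (u v t s T : ℝ) :
    wTerm p q u v (t + T) s = wTerm (p.1 * Real.exp (-T), p.2 * Real.exp T) q u v t s := by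
  simp only [wTerm, pairExp, posCoord_add, majorant_add, exp_neg_mul_exp_mul]

lemma nTerm_add (p q : ℝ × ℝ) (u v t s T : ℝ) :
    nTerm p q u v (t + T) s = nTerm (p.1 * Real.exp (-T), p.2 * Real.exp T) q u v t s := by
  simp only [nTerm, pairExp, negCoord_add, majorant_add, exp_neg_mul_exp_mul]

section Quadratic

variable {F : Type*} [Field F] [NumberField F] {σ σ' : F →+* ℝ}

lemma GaussSummable.comp_equiv {ι ι' : Type*} {p q : ι → ℝ × ℝ} (Φ : ι' ≃ ι)
    (h : GaussSummable (p ∘ Φ) (q ∘ Φ)) : GaussSummable p q := fun c hc =>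
  (Equiv.summable_iff Φ).1 (h c hc)

lemma pairTheta_comp_equiv {ι ι' : Type*} (f : ℝ × ℝ → ℝ × ℝ → ℝ → ℝ → ℝ → ℝ → ℂ)
    (p q : ι → ℝ × ℝ) (Φ : ι' ≃ ι) : pairTheta f (p ∘ Φ) (q ∘ Φ) = pairTheta f p q := by
  funext x
  exact Φ.tsum_eq fun i => f (p i) (q i) x.1.1 x.1.2 x.2.1 x.2.2

lemma log_epsUnit_nonneg (σ σ' : F →+* ℝ) (κ : ℕ) : 0 ≤ Real.log (epsUnit σ σ' κ) := by
  rcases log_epsUnit_eq_zero_or σ σ' κ with h | ⟨u, h, h1, -⟩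
  · exact h.ge
  · rw [h]; exact Real.log_nonneg h1.le

/-- The theta series of a kernel over the pairs in `L^∨` that agree modulo `L`. -/
def idealTheta (σ σ' : F →+* ℝ) (I : FractionalIdeal (𝓞 F)⁰ F) (κ : ℕ)
    (f : ℝ × ℝ → ℝ × ℝ → ℝ → ℝ → ℝ → ℝ → ℂ) (x : (ℝ × ℝ) × ℝ × ℝ) : ℂ :=
  pairTheta f (PairIdx.fstVec (σ := σ) (σ' := σ') (I := I) (κ := κ)) PairIdx.sndVec x

/-- The theta series of the pairs in `L^∨` that agree modulo `L` are periodic. -/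
lemma idealTheta_add_log_epsUnit (hF : finrank ℚ F = 2) (hσ : σ ≠ σ')
    {I : FractionalIdeal (𝓞 F)⁰ F} (hI : I ≠ 0) {κ : ℕ} (hκ : 0 < κ)
    {f : ℝ × ℝ → ℝ × ℝ → ℝ → ℝ → ℝ → ℝ → ℂ}
    (hf : ∀ (p q : ℝ × ℝ) (u v t s T : ℝ), f p q u v (t + T) s =
      f (p.1 * Real.exp (-T), p.2 * Real.exp T) q u v t s) (z : ℝ × ℝ) (t s : ℝ) :
    idealTheta σ σ' I κ f (z, t + Real.log (epsUnit σ σ' κ), s) =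
      idealTheta σ σ' I κ f (z, t, s) := by
  rcases log_epsUnit_eq_zero_or σ σ' κ with h | ⟨u, h, h1, h2, hu⟩
  · rw [h, add_zero]
  obtain ⟨δ, hδ⟩ := exists_isDifferentGenerator hF hσ
  obtain ⟨Ψ, hΨ⟩ := hδ.exists_unit_equiv hI hκ hu
  have hmul := unit_mul_conj hF hσ (by linarith) h2
  have hexp : Real.exp (Real.log (epsUnit σ σ' κ)) = σ ((u : 𝓞 F) : F) := by
    rw [h, Real.exp_log (by linarith)]
  have hexp' : Real.exp (-Real.log (epsUnit σ σ' κ)) = σ' ((u : 𝓞 F) : F) := by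
    rw [Real.exp_neg, hexp]; exact inv_eq_of_mul_eq_one_right hmul
  simp only [idealTheta, pairTheta]
  rw [← Ψ.tsum_eq]
  refine tsum_congr fun i => ?_
  have e2 : (Ψ i).sndVec = i.sndVec := by simp only [PairIdx.sndVec, hΨ]
  have e1 : ((Ψ i).fstVec.1 * σ' ((u : 𝓞 F) : F), (Ψ i).fstVec.2 * σ ((u : 𝓞 F) : F)) =
      i.fstVec := by
    simp only [PairIdx.fstVec, hΨ, nemb, map_mul, Prod.ext_iff]
    constructor
    · linear_combination σ i.1.1 / √(levelN I κ) * hmul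
    · linear_combination σ' i.1.1 / √(levelN I κ) * hmul
  rw [hf, hexp, hexp', e1, e2]

lemma gaussSummable_pairIdx (hF : finrank ℚ F = 2) (hσ : σ ≠ σ') {𝔞 : Ideal (𝓞 F)}
    (h𝔞 : 𝔞 ≠ ⊥) {κ : ℕ} (hκ : 0 < κ) :
    GaussSummable (PairIdx.fstVec (σ := σ) (σ' := σ') (I := (𝔞 : FractionalIdeal (𝓞 F)⁰ F))
      (κ := κ)) PairIdx.sndVec := by
  obtain ⟨δ, hδ⟩ := exists_isDifferentGenerator hF hσ
  obtain ⟨e₁, e₂, f₁, f₂, Φ, -, -, hd, h1, h2⟩ := hδ.exists_pairIdx_equiv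
    (FractionalIdeal.coeIdeal_ne_zero.2 h𝔞) hκ (lattice_le_dualLattice hF hσ h𝔞 hκ)
  refine GaussSummable.comp_equiv Φ ?_
  have := gaussSummable_latVec hd
  convert this using 1
  · funext i; exact h1 i
  · funext i; exact h2 i

/-- The integral of the theta lift over a closed geodesic does not depend on `s`. -/
theorem integral_idealTheta_eq (hF : finrank ℚ F = 2) (hσ : σ ≠ σ') {𝔞 : Ideal (𝓞 F)}
    (h𝔞 : 𝔞 ≠ ⊥) {κ : ℕ} (hκ : 0 < κ) (s₀ s₁ : ℝ) :
    ∫ z in fdPlane, ∫ t in (0 : ℝ)..Real.log (epsUnit σ σ' κ),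
        idealTheta σ σ' (𝔞 : FractionalIdeal (𝓞 F)⁰ F) κ wTerm (z, t, s₁) =
      ∫ z in fdPlane, ∫ t in (0 : ℝ)..Real.log (epsUnit σ σ' κ),
        idealTheta σ σ' (𝔞 : FractionalIdeal (𝓞 F)⁰ F) κ wTerm (z, t, s₀) := by
  wlog hs : s₀ ≤ s₁ generalizing s₀ s₁
  · exact (this s₁ s₀ (le_of_not_ge hs)).symm
  obtain ⟨δ, hδ⟩ := exists_isDifferentGenerator hF hσ
  have hI : (𝔞 : FractionalIdeal (𝓞 F)⁰ F) ≠ 0 := FractionalIdeal.coeIdeal_ne_zero.2 h𝔞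
  have hN := levelN_pos hI hκ
  have hgs := gaussSummable_pairIdx (σ := σ) (σ' := σ') hF hσ h𝔞 hκ
  have hint : ∀ l ∈ lattice (𝔞 : FractionalIdeal (𝓞 F)⁰ F), ∀ y ∈ dualLattice σ σ'
      (𝔞 : FractionalIdeal (𝓞 F)⁰ F) κ, ∃ n : ℤ,
        pairing (nemb σ σ' (levelN (𝔞 : FractionalIdeal (𝓞 F)⁰ F) κ) l)
          (nemb σ σ' (levelN (𝔞 : FractionalIdeal (𝓞 F)⁰ F) κ) y) = n := by
    intro l hl y hy
    rw [pairing_nemb hN]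
    exact hy l hl
  refine integral_pairTheta_wTerm_eq hgs ?_ ?_ (log_epsUnit_nonneg σ σ' κ) ?_ hs
  · rintro ⟨⟨x, y⟩, hx, hy, hxy⟩
    obtain ⟨a, ha⟩ := exists_int_norm_eq (σ := σ) (σ' := σ') hF hσ h𝔞 hκ hxy
    obtain ⟨b, hb⟩ := hint _ hxy y hy
    refine ⟨-a - b, ?_⟩
    push_cast
    rw [← ha, ← hb]
    simp only [PairIdx.fstVec, PairIdx.sndVec, nemb, pairing, map_sub]
    ring
  · intro u v t s huv hv
    obtain ⟨e₁, e₂, f₁, f₂, Φ, he₁, he₂, hd, h1, h2⟩ := hδ.exists_pairIdx_equiv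
      hI hκ (lattice_le_dualLattice hF hσ h𝔞 hκ)
    rw [← pairTheta_comp_equiv kTerm _ _ Φ]
    have e1 := funext h1
    have e2 := funext h2
    have := pairTheta_kTerm_inversion hd ?_ t s huv hv
    · convert this using 1
      · congr 1
      · congr 2
    · intro m n
      have hl : ∀ m : ℤ × ℤ, m.1 * e₁ + m.2 * e₂ ∈ lattice (𝔞 : FractionalIdeal (𝓞 F)⁰ F) :=
        fun m => add_mem (by simpa using zsmul_mem he₁ m.1) (by simpa using zsmul_mem he₂ m.2)
      have := hint _ (hl m) _ (lattice_le_dualLattice hF hσ h𝔞 hκ (hl n))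
      rwa [nemb_comb, nemb_comb] at this
  · intro z s
    have := idealTheta_add_log_epsUnit (σ := σ) (σ' := σ') hF hσ hI hκ nTerm_add z 0 s
    rwa [zero_add] at this

end Quadratic

end HeckeTheta

end

noncomputable section

namespace HeckeTheta

open MeasureTheory UpperHalfPlane
open scoped Modular

/-! ### Integrals over the fundamental domain -/

/-- Real coordinates on the upper half plane. -/
def planeCoord (τ : ℍ) : ℝ × ℝ := (τ.re, τ.im)

lemma measurableEmbedding_planeCoord : MeasurableEmbedding planeCoord :=
  Complex.measurableEquivRealProd.measurableEmbedding.comp measurableEmbedding_coe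

lemma preimage_fdPlane : planeCoord ⁻¹' fdPlane = 𝒟 := by
  ext τ
  simp only [planeCoord, fdPlane, ModularGroup.fd, Set.mem_preimage, Set.mem_ofPred_eq,
    Complex.normSq_apply]
  have h1 : (τ : ℂ).re = τ.re := rfl
  have h2 : (τ : ℂ).im = τ.im := rfl
  rw [h1, h2, sq, sq]
  have := τ.im_pos
  tauto

lemma map_planeCoord_restrict :
    (((volume : Measure ℂ).comap UpperHalfPlane.coe).restrict 𝒟).map planeCoord =
      volume.restrict fdPlane := by
  rw [← preimage_fdPlane, ← measurableEmbedding_planeCoord.restrict_map]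
  have h1 : ((volume : Measure ℂ).comap UpperHalfPlane.coe).map planeCoord =
      (volume.restrict (Set.range UpperHalfPlane.coe)).map Complex.measurableEquivRealProd := by
    rw [← measurableEmbedding_coe.map_comap,
      Measure.map_map Complex.measurableEquivRealProd.measurable measurable_coe]
    rfl
  have h2 : (Set.range UpperHalfPlane.coe) =
      Complex.measurableEquivRealProd ⁻¹' {z : ℝ × ℝ | 0 < z.2} := by
    rw [UpperHalfPlane.range_coe]
    ext z
    simp [Complex.measurableEquivRealProd_apply]
  rw [h1, h2, ← Complex.measurableEquivRealProd.measurableEmbedding.restrict_map,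
    Complex.volume_preserving_equiv_real_prod.map_eq,
    Measure.restrict_restrict measurableSet_fdPlane]
  congr 1
  exact Set.inter_eq_left.2 fun z hz => hz.2.2

lemma volume_restrict_fd : (volume : Measure ℍ).restrict 𝒟 =
    (((volume : Measure ℂ).comap UpperHalfPlane.coe).restrict 𝒟).withDensity fun z ↦
      ↑((1 / NNReal.mk z.im z.im_pos.le : NNReal) ^ 2) := by
  rw [volume_def, restrict_withDensity]
  rw [← preimage_fdPlane]
  exact measurableEmbedding_planeCoord.measurable measurableSet_fdPlane

lemma measurable_density : Measurable fun z : ℍ ↦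
    ((1 / NNReal.mk z.im z.im_pos.le : NNReal) ^ 2) := by
  have : Measurable fun z : ℍ => NNReal.mk z.im z.im_pos.le :=
    (measurable_snd.comp measurableEmbedding_planeCoord.measurable).subtype_mk
  fun_prop

lemma density_smul (g : ℝ × ℝ → ℂ) (τ : ℍ) :
    ((1 / NNReal.mk τ.im τ.im_pos.le : NNReal) ^ 2) • ((τ.im : ℂ) ^ 2 * g (planeCoord τ)) =
      g (planeCoord τ) := by
  have h : (τ.im : ℂ) ≠ 0 := by exact_mod_cast τ.im_ne_zero
  rw [NNReal.smul_def, Complex.real_smul]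
  push_cast
  field_simp

/-- Integrability over the fundamental domain in real coordinates. -/
lemma integrableOn_fd_iff (g : ℝ × ℝ → ℂ) :
    IntegrableOn (fun τ : ℍ => (τ.im : ℂ) ^ 2 * g (planeCoord τ)) 𝒟 ↔
      IntegrableOn g fdPlane := by
  rw [IntegrableOn, volume_restrict_fd,
    integrable_withDensity_iff_integrable_smul measurable_density]
  simp only [density_smul]
  rw [IntegrableOn, ← map_planeCoord_restrict, measurableEmbedding_planeCoord.integrable_map_iff]
  rfl

/-- Integrals over the fundamental domain in real coordinates. -/
lemma integral_fd_eq (g : ℝ × ℝ → ℂ) :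
    ∫ τ : ℍ in 𝒟, (τ.im : ℂ) ^ 2 * g (planeCoord τ) = ∫ z in fdPlane, g z := by
  rw [volume_restrict_fd, integral_withDensity_eq_integral_smul measurable_density]
  simp only [density_smul]
  rw [← map_planeCoord_restrict, measurableEmbedding_planeCoord.integral_map]

end HeckeTheta

end

noncomputable section

namespace HeckeTheta

open Module NumberField MeasureTheory UpperHalfPlane
open scoped nonZeroDivisors NumberField Real

/-! ### The theta function of signature `(2, 2)` -/

section Quadratic

variable {F : Type*} [Field F] [NumberField F] {σ σ' : F →+* ℝ}

omit [NumberField F] in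
lemma planeBil_Zperp {N : ℝ} (hN : 0 < N) (x : F) (t : ℝ) :
    planeBil N (emb σ σ' x) (Zperp N t) = posCoord (nemb σ σ' N x) t := by
  have h : N / √N = √N := Real.div_sqrt
  simp only [planeBil, emb, Zperp, posCoord, nemb]
  rw [div_eq_iff hN.ne']
  linear_combination (-σ x * Real.exp (-t) - σ' x * Real.exp t) * h

omit [NumberField F] in
lemma planeBil_Z {N : ℝ} (hN : 0 < N) (x : F) (t : ℝ) :
    planeBil N (emb σ σ' x) (Z N t) = negCoord (nemb σ σ' N x) t := by
  have h : N / √N = √N := Real.div_sqrt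
  simp only [planeBil, emb, Z, negCoord, nemb]
  rw [div_eq_iff hN.ne']
  linear_combination (σ x * Real.exp (-t) - σ' x * Real.exp t) * h

lemma matBil_eq (N a b c d a' b' c' d' : ℝ) :
    matBil N !![a, b; c, d] !![a', b'; c', d'] = (a * d' + d * a' - b * c' - c * b') / N := by
  simp only [matBil, Matrix.det_fin_two, Matrix.add_apply, Matrix.of_apply, Matrix.cons_val',
    Matrix.cons_val_zero, Matrix.cons_val_one, Matrix.cons_val_fin_one]
  congr 1
  ring

/-- The matrix attached to a pair of elements of `F`. -/
def pairMatrix (σ σ' : F →+* ℝ) (x y : F) : Matrix (Fin 2) (Fin 2) ℝ :=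
  !![σ x, σ y; σ' y, σ' x]

omit [NumberField F] in
lemma siegelTerm_pairMatrix {N : ℝ} (hN : 0 < N) (τ : ℍ) (t t₀ : ℝ) (x y : F) :
    siegelTerm N τ t t₀ (pairMatrix σ σ' x y) =
      nTerm (nemb σ σ' N x) (nemb σ σ' N y) (-τ.re) τ.im t t₀ := by
  have h1 : matBil N (pairMatrix σ σ' x y) (X N t) = negCoord (nemb σ σ' N x) t := by
    rw [← planeBil_Z hN, pairMatrix, X, matBil_eq]
    simp only [planeBil, emb, Z]; ring
  have h2 : matBil N (pairMatrix σ σ' x y) (Xperp N t) = posCoord (nemb σ σ' N x) t := by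
    rw [← planeBil_Zperp hN, pairMatrix, Xperp, matBil_eq]
    simp only [planeBil, emb, Zperp]; ring
  have h3 : matBil N (pairMatrix σ σ' x y) (Yperp N t₀) = -negCoord (nemb σ σ' N y) t₀ := by
    rw [← planeBil_Z hN, pairMatrix, Yperp, matBil_eq]
    simp only [planeBil, emb, Z]; ring
  have h4 : matBil N (pairMatrix σ σ' x y) (Y N t₀) = -posCoord (nemb σ σ' N y) t₀ := by
    rw [← planeBil_Zperp hN, pairMatrix, Y, matBil_eq]
    simp only [planeBil, emb, Zperp]; ring
  have hτ : (τ : ℂ) = (τ.re : ℂ) + τ.im * Complex.I := (Complex.re_add_im (τ : ℂ)).symm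
  have hτ' : (starRingEnd ℂ) (τ : ℂ) = (τ.re : ℂ) - τ.im * Complex.I := by
    rw [hτ]; simp [sub_eq_add_neg]
  have k1 := posCoord_sq_sub_negCoord_sq (nemb σ σ' N x) t
  have k2 := posCoord_sq_sub_negCoord_sq (nemb σ σ' N y) t₀
  have k1' : (nemb σ σ' N x).1 * (nemb σ σ' N x).2 =
    (posCoord (nemb σ σ' N x) t ^ 2 - negCoord (nemb σ σ' N x) t ^ 2) / 4 := by linarith
  have k2' : (nemb σ σ' N y).1 * (nemb σ σ' N y).2 =
    (posCoord (nemb σ σ' N y) t₀ ^ 2 - negCoord (nemb σ σ' N y) t₀ ^ 2) / 4 := by linarith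
  simp only [siegelTerm, nTerm, pairExp, Qpos, Qneg, e, h1, h2, h3, h4, hτ', k1', k2', majorant]
  rw [hτ]
  congr 1
  · push_cast; ring
  · congr 1
    push_cast
    linear_combination (2 * π * τ.im * ((posCoord (nemb σ σ' N x) t : ℂ) ^ 2 +
      (negCoord (nemb σ σ' N y) t₀ : ℂ) ^ 2 + (negCoord (nemb σ σ' N x) t : ℂ) ^ 2 +
      (posCoord (nemb σ σ' N y) t₀ : ℂ) ^ 2) / 4) * Complex.I_sq

/-- Multiplication by an element of mixed signature exchanges the two lines. -/
lemma nTerm_scale (p q : ℝ × ℝ) (u v t s r : ℝ) {c : ℝ} (hc : c * c = 1) :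
    nTerm (c * (p.1 * Real.exp r), -(c * (p.2 * Real.exp (-r))))
      (c * (q.1 * Real.exp r), -(c * (q.2 * Real.exp (-r)))) (-u) v t s =
      wTerm p q u v (t - r) (s - r) := by
  have hn : ∀ (p : ℝ × ℝ) (t : ℝ), negCoord (c * (p.1 * Real.exp r),
      -(c * (p.2 * Real.exp (-r)))) t = -(c * posCoord p (t - r)) := by
    intro p t
    rw [sub_eq_add_neg, posCoord_add]
    simp only [negCoord, posCoord, neg_neg]
    ring
  have hp : ∀ (p : ℝ × ℝ) (t : ℝ), posCoord (c * (p.1 * Real.exp r),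
      -(c * (p.2 * Real.exp (-r)))) t = -(c * negCoord p (t - r)) := by
    intro p t
    rw [sub_eq_add_neg, negCoord_add]
    simp only [negCoord, posCoord, neg_neg]
    ring
  have hm : ∀ (p : ℝ × ℝ) (t : ℝ), majorant (c * (p.1 * Real.exp r),
      -(c * (p.2 * Real.exp (-r)))) t = majorant p (t - r) := by
    intro p t
    simp only [majorant, hn, hp]
    linear_combination (negCoord p (t - r) ^ 2 + posCoord p (t - r) ^ 2) / 2 * hc
  have hx : ∀ p : ℝ × ℝ, c * (p.1 * Real.exp r) * -(c * (p.2 * Real.exp (-r))) = -(p.1 * p.2) := by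
    intro p
    have : Real.exp r * Real.exp (-r) = 1 := by rw [← Real.exp_add]; simp
    linear_combination (-(p.1 * p.2)) * hc * (Real.exp r * Real.exp (-r)) - p.1 * p.2 * this
  simp only [nTerm, wTerm, pairExp, hn, hm, hx]
  congr 1
  · push_cast
    have : (c : ℂ) * c = 1 := by exact_mod_cast hc
    linear_combination ((posCoord p (t - r) : ℂ) * posCoord q (s - r)) * this
  · congr 1
    push_cast
    ring

lemma mem_span_mul_iff {a : F} (ha : a ≠ 0) {I : FractionalIdeal (𝓞 F)⁰ F} {x : F} :
    a * x ∈ FractionalIdeal.spanSingleton (𝓞 F)⁰ a * I ↔ x ∈ I := by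
  rw [FractionalIdeal.mem_singleton_mul]
  constructor
  · rintro ⟨y, hy, h⟩
    rwa [mul_left_cancel₀ ha h]
  · exact fun h => ⟨x, h, rfl⟩

/-- The theta function of signature `(2, 2)` of `μ𝔡𝔞` in terms of `𝔞`. -/
lemma exists_siegelTheta_eq (hF : finrank ℚ F = 2) (hσ : σ ≠ σ') {𝔞 : Ideal (𝓞 F)}
    (h𝔞 : 𝔞 ≠ ⊥) {κ : ℕ} (hκ : 0 < κ) {𝔟 : FractionalIdeal (𝓞 F)⁰ F}
    (h𝔟 : SameNarrowClass σ σ' 𝔟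
      ((𝔞 * differentIdeal ℤ (𝓞 F) : Ideal (𝓞 F)) : FractionalIdeal (𝓞 F)⁰ F)) :
    ∃ r : ℝ, ∀ (τ : ℍ) (t : ℝ),
      (Summable fun x : latticeM σ σ' 𝔟 κ =>
        siegelTerm (levelN 𝔟 κ) τ t 0 (x : Matrix (Fin 2) (Fin 2) ℝ)) ∧
      siegelTheta σ σ' 𝔟 κ τ t 0 = idealTheta σ σ' (𝔞 : FractionalIdeal (𝓞 F)⁰ F) κ wTerm
        (planeCoord τ, t - r, -r) := by
  obtain ⟨μ, hμ, hμ', h𝔟⟩ := h𝔟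
  obtain ⟨δ, hδ⟩ := exists_isDifferentGenerator hF hσ
  have hI : (𝔞 : FractionalIdeal (𝓞 F)⁰ F) ≠ 0 := FractionalIdeal.coeIdeal_ne_zero.2 h𝔞
  set I := (𝔞 : FractionalIdeal (𝓞 F)⁰ F)
  have hμ0 : μ ≠ 0 := by rintro rfl; simp at hμ
  have ha : μ * δ ≠ 0 := mul_ne_zero hμ0 hδ.ne_zero'
  have h𝔟' : 𝔟 = FractionalIdeal.spanSingleton (𝓞 F)⁰ (μ * δ) * I := by
    rw [h𝔟, FractionalIdeal.coeIdeal_mul, hδ.span, mul_comm (𝔞 : FractionalIdeal (𝓞 F)⁰ F),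
      ← mul_assoc, FractionalIdeal.spanSingleton_mul_spanSingleton]
  have h𝔟0 : 𝔟 ≠ 0 := by
    rw [h𝔟']
    exact mul_ne_zero (FractionalIdeal.spanSingleton_ne_zero_iff.2 ha) hI
  have hlat : ∀ x, μ * δ * x ∈ lattice 𝔟 ↔ x ∈ lattice I := fun x => by
    rw [mem_lattice, mem_lattice, h𝔟', mem_span_mul_iff ha]
  have hdual : ∀ x, μ * δ * x ∈ dualLattice σ σ' 𝔟 κ ↔ x ∈ dualLattice σ σ' I κ := fun x => by
    rw [hδ.mem_dualLattice_iff h𝔟0 hκ, hδ.mem_dualLattice_iff hI hκ,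
      show κ * δ * (μ * δ * x) = μ * δ * (κ * δ * x) by ring, ← mem_lattice, hlat, mem_lattice]
  have hN := levelN_pos hI hκ
  have hN' := levelN_pos h𝔟0 hκ
  have hlevel : levelN 𝔟 κ = σ μ * σ' μ * σ δ ^ 2 * levelN I κ := by
    have h1 : ((|Algebra.norm ℚ (μ * δ)| : ℚ) : ℝ) = σ μ * σ' μ * σ δ ^ 2 := by
      rw [Rat.cast_abs, norm_eq hF hσ, map_mul, map_mul, hδ.conj,
        show σ μ * σ δ * (σ' μ * -σ δ) = -(σ μ * σ' μ * σ δ ^ 2) by ring, abs_neg,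
        abs_of_nonneg (by positivity)]
    rw [levelN, levelN, h𝔟', map_mul, FractionalIdeal.absNorm_span_singleton, Rat.cast_mul, h1]
    ring
  set r : ℝ := Real.log (√(σ μ / σ' μ)) with hr
  have hexp : Real.exp r = √(σ μ / σ' μ) := Real.exp_log (Real.sqrt_pos.2 (by positivity))
  set c : ℝ := σ δ / |σ δ| with hc
  have hδ0 : |σ δ| ≠ 0 := abs_ne_zero.2 hδ.ne_zero
  have hcc : c * c = 1 := by
    rw [hc, div_mul_div_comm, abs_mul_abs_self, div_self (mul_ne_zero hδ.ne_zero hδ.ne_zero)]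
  have hsN : √(levelN 𝔟 κ) = √(σ μ) * √(σ' μ) * |σ δ| * √(levelN I κ) := by
    rw [hlevel, Real.sqrt_mul (by positivity), Real.sqrt_mul (by positivity),
      Real.sqrt_mul hμ.le, Real.sqrt_sq_eq_abs]
  have hnemb : ∀ x, nemb σ σ' (levelN 𝔟 κ) (μ * δ * x) =
      (c * ((nemb σ σ' (levelN I κ) x).1 * Real.exp r),
        -(c * ((nemb σ σ' (levelN I κ) x).2 * Real.exp (-r)))) := by
    intro x
    have s1 : √(σ μ) ≠ 0 := (Real.sqrt_pos.2 hμ).ne'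
    have s2 : √(σ' μ) ≠ 0 := (Real.sqrt_pos.2 hμ').ne'
    have s3 : √(levelN I κ) ≠ 0 := (Real.sqrt_pos.2 hN).ne'
    have q1 : √(σ μ) * √(σ μ) = σ μ := Real.mul_self_sqrt hμ.le
    have q2 : √(σ' μ) * √(σ' μ) = σ' μ := Real.mul_self_sqrt hμ'.le
    rw [Real.exp_neg, hexp, Real.sqrt_div hμ.le, hc]
    simp only [nemb, hsN, map_mul, hδ.conj]
    refine Prod.ext ?_ ?_
    · simp only
      nth_rewrite 1 [← q1]
      field_simp
    · simp only
      nth_rewrite 1 [← q2]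
      field_simp
  have hmem : ∀ i : PairIdx σ σ' I κ,
      pairMatrix σ σ' (μ * δ * i.1.1) (μ * δ * i.1.2) ∈ latticeM σ σ' 𝔟 κ := fun i =>
    ⟨_, (hdual _).2 i.2.1, _, (hdual _).2 i.2.2.1, by
      rw [← mul_sub]; exact (hlat _).2 i.2.2.2, rfl⟩
  set Φ₀ : PairIdx σ σ' I κ → latticeM σ σ' 𝔟 κ := fun i => ⟨_, hmem i⟩
  have hbij : Function.Bijective Φ₀ := by
    constructor
    · rintro ⟨⟨x, y⟩, hx⟩ ⟨⟨x', y'⟩, hx'⟩ h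
      have h' := congrArg Subtype.val h
      simp only [Φ₀, pairMatrix] at h'
      have k1 := congrFun (congrFun h' 0) 0
      have k2 := congrFun (congrFun h' 0) 1
      simp only [Matrix.of_apply, Matrix.cons_val', Matrix.cons_val_zero, Matrix.cons_val_one,
        Matrix.cons_val_fin_one] at k1 k2
      have k3 := mul_left_cancel₀ ha (σ.injective k1)
      have k4 := mul_left_cancel₀ ha (σ.injective k2)
      exact Subtype.ext (Prod.ext k3 k4)
    · rintro ⟨_, x, hx, y, hy, hxy, rfl⟩
      have ex : x = μ * δ * (x / (μ * δ)) := by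
        rw [← mul_div_assoc, mul_div_cancel_left₀ _ ha]
      have ey : y = μ * δ * (y / (μ * δ)) := by
        rw [← mul_div_assoc, mul_div_cancel_left₀ _ ha]
      rw [ex, hdual] at hx
      rw [ey, hdual] at hy
      rw [ex, ey, ← mul_sub, hlat] at hxy
      refine ⟨⟨(x / (μ * δ), y / (μ * δ)), hx, hy, hxy⟩, Subtype.ext ?_⟩
      simp only [Φ₀]
      rw [← ex, ← ey, pairMatrix]
  set Φ := Equiv.ofBijective Φ₀ hbij
  have hterm : ∀ (τ : ℍ) (t : ℝ) (i : PairIdx σ σ' I κ),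
      siegelTerm (levelN 𝔟 κ) τ t 0 (Φ i : Matrix (Fin 2) (Fin 2) ℝ) =
        wTerm i.fstVec i.sndVec τ.re τ.im (t - r) (-r) := by
    intro τ t i
    have := nTerm_scale i.fstVec i.sndVec τ.re τ.im t 0 r hcc
    rw [zero_sub] at this
    rw [← this]
    change siegelTerm (levelN 𝔟 κ) τ t 0 (pairMatrix σ σ' (μ * δ * i.1.1) (μ * δ * i.1.2)) = _
    rw [siegelTerm_pairMatrix hN', hnemb, hnemb]
    rfl
  refine ⟨r, fun τ t => ⟨?_, ?_⟩⟩
  · rw [← Equiv.summable_iff Φ]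
    refine (isPairKernel_wTerm.summable (gaussSummable_pairIdx (σ := σ) (σ' := σ') hF hσ h𝔞 hκ)
      τ.im_pos τ.re (t - r) (-r)).congr fun i => (hterm τ t i).symm
  · rw [siegelTheta, ← Φ.tsum_eq]
    exact tsum_congr fun i => hterm τ t i

end Quadratic

end HeckeTheta

end

noncomputable section

namespace HeckeTheta

open Module NumberField MeasureTheory UpperHalfPlane Set Filter
open scoped nonZeroDivisors NumberField Real ComplexConjugate

/-! ### The theta kernel of signature `(1, 1)` -/

/-- The term of the theta kernel of signature `(1, 1)` in normalized coordinates. -/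
def heckeTerm (p z : ℝ × ℝ) (t : ℝ) : ℂ :=
  (posCoord p t : ℂ) * Complex.exp (2 * π * Complex.I * z.1 * ((p.1 * p.2 : ℝ) : ℂ) -
    ((π * z.2 * majorant p t : ℝ) : ℂ))

lemma conj_heckeTerm_mul (p q z : ℝ × ℝ) (t s : ℝ) :
    conj (heckeTerm p z t) * heckeTerm q z s = wTerm p q z.1 z.2 t s := by
  simp only [heckeTerm, wTerm, pairExp, map_mul, ← Complex.exp_conj, map_sub, Complex.conj_ofReal,
    Complex.conj_I, map_ofNat]
  rw [mul_mul_mul_comm, ← Complex.exp_add, ← Complex.ofReal_mul]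
  congr 2
  push_cast
  ring

lemma norm_heckeTerm (p z : ℝ × ℝ) (t : ℝ) :
    ‖heckeTerm p z t‖ = |posCoord p t| * Real.exp (-(π * z.2 * majorant p t)) := by
  rw [heckeTerm, norm_mul, Complex.norm_real, Real.norm_eq_abs, Complex.norm_exp]
  congr 2
  simp [Complex.sub_re, Complex.mul_re]

lemma continuous_heckeTerm (p z : ℝ × ℝ) : Continuous (heckeTerm p z) := by
  have := continuous_posCoord p
  have := continuous_majorant p
  unfold heckeTerm
  fun_prop

lemma exists_norm_heckeTerm_le {v : ℝ} (hv : 0 < v) (R : ℝ) :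
    ∃ C c : ℝ, 0 ≤ C ∧ 0 < c ∧ ∀ (p : ℝ × ℝ) (u t : ℝ), |t| ≤ R →
      ‖heckeTerm p (u, v) t‖ ≤ C * Real.exp (-(c * normSq2 p)) := by
  refine ⟨1 + 4 / (π * v), π * v / 2 * Real.exp (-(2 * R)), by positivity, by positivity,
    fun p u t ht => ?_⟩
  have hm := le_majorant p ht
  have hm0 := majorant_nonneg p t
  have ha : |posCoord p t| ≤ 1 + 2 * majorant p t := by
    have : posCoord p t ^ 2 ≤ 2 * majorant p t := by
      unfold majorant; nlinarith [sq_nonneg (negCoord p t)]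
    nlinarith [sq_nonneg (|posCoord p t| - 1), sq_abs (posCoord p t), abs_nonneg (posCoord p t)]
  have he := Real.add_one_le_exp (π * v / 2 * majorant p t)
  have hb : 1 + 2 * majorant p t ≤
      (1 + 4 / (π * v)) * Real.exp (π * v / 2 * majorant p t) := by
    refine le_trans ?_ (mul_le_mul_of_nonneg_left he (by positivity))
    have : 4 / (π * v) * (π * v / 2 * majorant p t) = 2 * majorant p t := by field_simp; ring
    have h2 : 0 ≤ π * v / 2 * majorant p t := by positivity
    have h3 : 0 ≤ 4 / (π * v) := by positivity
    nlinarith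
  rw [norm_heckeTerm]
  calc |posCoord p t| * Real.exp (-(π * v * majorant p t))
      ≤ (1 + 4 / (π * v)) * Real.exp (π * v / 2 * majorant p t) *
          Real.exp (-(π * v * majorant p t)) :=
        mul_le_mul_of_nonneg_right (ha.trans hb) (Real.exp_pos _).le
    _ = (1 + 4 / (π * v)) * Real.exp (-(π * v / 2 * majorant p t)) := by
        rw [mul_assoc, ← Real.exp_add]; ring_nf
    _ ≤ _ := by
        refine mul_le_mul_of_nonneg_left (Real.exp_le_exp.2 ?_) (by positivity)
        have := mul_le_mul_of_nonneg_left hm (show 0 ≤ π * v / 2 by positivity)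
        linarith

section Quadratic

variable {F : Type*} [Field F] [NumberField F] {σ σ' : F →+* ℝ}

omit [NumberField F] in
lemma kernelTerm_eq {N : ℝ} (hN : 0 < N) (τ : ℍ) (t : ℝ) (x : F) :
    kernelTerm σ σ' N τ t x = heckeTerm (nemb σ σ' N x) (planeCoord τ) t := by
  have hτ : (τ : ℂ) = (τ.re : ℂ) + τ.im * Complex.I := (Complex.re_add_im (τ : ℂ)).symm
  have hτ' : (starRingEnd ℂ) (τ : ℂ) = (τ.re : ℂ) - τ.im * Complex.I := by
    rw [hτ]; simp [sub_eq_add_neg]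
  have k1 := posCoord_sq_sub_negCoord_sq (nemb σ σ' N x) t
  have k1' : (nemb σ σ' N x).1 * (nemb σ σ' N x).2 =
    (posCoord (nemb σ σ' N x) t ^ 2 - negCoord (nemb σ σ' N x) t ^ 2) / 4 := by linarith
  rw [kernelTerm, planeBil_Zperp hN, planeBil_Z hN, heckeTerm, k1', hτ', hτ, e, majorant,
    planeCoord]
  congr 2
  push_cast
  linear_combination (2 * π * τ.im * ((posCoord (nemb σ σ' N x) t : ℂ) ^ 2 +
      (negCoord (nemb σ σ' N x) t : ℂ) ^ 2) / 4) * Complex.I_sq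

variable {I : FractionalIdeal (𝓞 F)⁰ F} {κ : ℕ}

/-- The normalized embedding of the dual lattice. -/
def dualVec (l : dualLattice σ σ' I κ) : ℝ × ℝ := nemb σ σ' (levelN I κ) (l : F)

lemma summable_exp_dualVec (h : GaussSummable (PairIdx.fstVec (σ := σ) (σ' := σ') (I := I)
    (κ := κ)) PairIdx.sndVec) {c : ℝ} (hc : 0 < c) :
    Summable fun l : dualLattice σ σ' I κ => Real.exp (-(c * normSq2 (dualVec l))) := by
  set D : dualLattice σ σ' I κ → PairIdx σ σ' I κ := fun l =>
    ⟨(l, l), l.2, l.2, by rw [sub_self]; exact zero_mem _⟩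
  have hD : Function.Injective D := fun l m hlm =>
    Subtype.ext (congrArg (fun i : PairIdx σ σ' I κ => i.1.1) hlm)
  refine ((h (c / 2) (half_pos hc)).comp_injective hD).congr fun l => ?_
  simp only [Function.comp_apply, D, PairIdx.fstVec, PairIdx.sndVec, dualVec]
  congr 1
  ring

/-- Pairs of elements of the same coset. -/
def cosetPairEquiv (σ σ' : F →+* ℝ) (I : FractionalIdeal (𝓞 F)⁰ F) (κ : ℕ) :
    (Σ h : DiscGroup σ σ' I κ, Coset σ σ' I κ h × Coset σ σ' I κ h) ≃ PairIdx σ σ' I κ where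
  toFun x := ⟨(x.2.1.1, x.2.2.1), x.2.1.1.2, x.2.2.1.2, by
    have h : (QuotientAddGroup.mk x.2.2.1 : DiscGroup σ σ' I κ) = QuotientAddGroup.mk x.2.1.1 :=
      x.2.2.2.trans x.2.1.2.symm
    rw [QuotientAddGroup.eq, AddSubgroup.mem_addSubgroupOf] at h
    have h' : -(x.2.2.1 : F) + x.2.1.1 ∈ lattice I := h
    rwa [neg_add_eq_sub] at h'⟩
  invFun i := ⟨QuotientAddGroup.mk ⟨i.1.1, i.2.1⟩, ⟨⟨i.1.1, i.2.1⟩, rfl⟩,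
    ⟨⟨i.1.2, i.2.2.1⟩, by
      rw [QuotientAddGroup.eq, AddSubgroup.mem_addSubgroupOf]
      change -i.1.2 + i.1.1 ∈ lattice I
      rw [neg_add_eq_sub]
      exact i.2.2.2⟩⟩
  left_inv := by
    rintro ⟨h, ⟨⟨x, hx⟩, rfl⟩, ⟨⟨y, hy⟩, hxy⟩⟩
    rfl
  right_inv i := rfl

/-- The integral of a term of the theta kernel over a period. -/
def heckeCoeff (T : ℝ) (z p : ℝ × ℝ) : ℂ := ∫ t in Ioc 0 T, heckeTerm p z t

lemma norm_heckeCoeff_le {T u v C c : ℝ} (hT : 0 ≤ T)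
    (hb : ∀ (p : ℝ × ℝ) (u t : ℝ), |t| ≤ T →
      ‖heckeTerm p (u, v) t‖ ≤ C * Real.exp (-(c * normSq2 p))) (p : ℝ × ℝ) :
    ‖heckeCoeff T (u, v) p‖ ≤ C * T * Real.exp (-(c * normSq2 p)) := by
  refine (norm_setIntegral_le_of_norm_le_const measure_Ioc_lt_top fun t ht =>
    hb p u t (by rw [abs_of_pos ht.1]; exact ht.2)).trans (le_of_eq ?_)
  rw [measureReal_def, Real.volume_Ioc, sub_zero, ENNReal.toReal_ofReal hT]
  ring

lemma conj_heckeCoeff_mul (T : ℝ) (z p q : ℝ × ℝ) :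
    conj (heckeCoeff T z p) * heckeCoeff T z q =
      ∫ y in Ioc 0 T ×ˢ Ioc 0 T, wTerm p q z.1 z.2 y.1 y.2 := by
  rw [heckeCoeff, heckeCoeff, ← integral_conj, Measure.volume_eq_prod, ← Measure.prod_restrict,
    ← integral_prod_mul]
  simp only [conj_heckeTerm_mul]

/-- The coefficients of Hecke's theta function, as sums over cosets. -/
lemma heckeTheta_eq (hI : I ≠ 0) (hκ : 0 < κ)
    (hg : GaussSummable (PairIdx.fstVec (σ := σ) (σ' := σ') (I := I) (κ := κ)) PairIdx.sndVec)
    (τ : ℍ) (h : DiscGroup σ σ' I κ) :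
    (∀ t, Summable fun l : Coset σ σ' I κ h =>
      kernelTerm σ σ' (levelN I κ) τ t ((l : dualLattice σ σ' I κ) : F)) ∧
    IntervalIntegrable (fun t => thetaKernel σ σ' I κ τ t h) volume 0
      (Real.log (epsUnit σ σ' κ)) ∧
    (Summable fun l : Coset σ σ' I κ h =>
      ‖heckeCoeff (Real.log (epsUnit σ σ' κ)) (planeCoord τ) (dualVec l.1)‖) ∧
    heckeTheta σ σ' I κ τ h = (√τ.im : ℂ) * ∑' l : Coset σ σ' I κ h,
      heckeCoeff (Real.log (epsUnit σ σ' κ)) (planeCoord τ) (dualVec l.1) := by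
  have hN := levelN_pos hI hκ
  set T := Real.log (epsUnit σ σ' κ)
  have hT : 0 ≤ T := log_epsUnit_nonneg σ σ' κ
  have hsum : ∀ c : ℝ, 0 < c → Summable fun l : Coset σ σ' I κ h =>
      Real.exp (-(c * normSq2 (dualVec l.1))) := fun c hc =>
    (summable_exp_dualVec hg hc).comp_injective Subtype.val_injective
  have hcount : Countable (Coset σ σ' I κ h) := by
    have := (hsum 1 one_pos).countable_support
    have huniv : (Function.support fun l : Coset σ σ' I κ h =>
        Real.exp (-(1 * normSq2 (dualVec l.1)))) = univ :=
      eq_univ_of_forall fun l => (Real.exp_pos _).ne'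
    rwa [huniv, countable_univ_iff] at this
  have hk : ∀ t (l : Coset σ σ' I κ h), kernelTerm σ σ' (levelN I κ) τ t (l.1 : F) =
      heckeTerm (dualVec l.1) (planeCoord τ) t := fun t l => kernelTerm_eq hN τ t _
  obtain ⟨C, c, hC, hc, hb⟩ := exists_norm_heckeTerm_le τ.im_pos T
  have hbT : ∀ t ∈ uIcc 0 T, ∀ l : Coset σ σ' I κ h,
      ‖heckeTerm (dualVec l.1) (planeCoord τ) t‖ ≤
        C * Real.exp (-(c * normSq2 (dualVec l.1))) := by
    intro t ht l
    rw [uIcc_of_le hT] at ht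
    exact hb _ _ t (by rw [abs_of_nonneg ht.1]; exact ht.2)
  have hsb := (hsum c hc).mul_left C
  refine ⟨fun t => ?_, ?_, ?_, ?_⟩
  · simp only [hk]
    obtain ⟨C', c', -, hc', hb'⟩ := exists_norm_heckeTerm_le τ.im_pos |t|
    exact Summable.of_norm_bounded ((hsum c' hc').mul_left C') fun l => hb' _ _ _ le_rfl
  · refine ContinuousOn.intervalIntegrable ?_
    simp only [thetaKernel, hk]
    exact continuousOn_const.mul (continuousOn_tsum
      (fun l => (continuous_heckeTerm _ _).continuousOn) hsb fun l t ht => hbT t ht l)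
  · exact Summable.of_nonneg_of_le (fun _ => norm_nonneg _)
      (fun l => norm_heckeCoeff_le hT hb _) ((hsum c hc).mul_left (C * T))
  · simp only [heckeTheta, thetaKernel, hk]
    rw [intervalIntegral.integral_const_mul]
    congr 1
    have := intervalIntegral.hasSum_integral_of_dominated_convergence (μ := volume) (a := 0)
      (b := T) (F := fun (l : Coset σ σ' I κ h) t => heckeTerm (dualVec l.1) (planeCoord τ) t)
      (fun l _ => C * Real.exp (-(c * normSq2 (dualVec l.1))))
      (fun l => (continuous_heckeTerm _ _).aestronglyMeasurable)
      (fun l => Eventually.of_forall fun t ht => hbT t (uIoc_subset_uIcc ht) l)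
      (Eventually.of_forall fun _ _ => hsb) intervalIntegrable_const
      (Eventually.of_forall fun t ht => (Summable.of_norm_bounded hsb
        fun l => hbT t (uIoc_subset_uIcc ht) l).hasSum)
    rw [← this.tsum_eq]
    refine tsum_congr fun l => ?_
    rw [heckeCoeff, intervalIntegral.integral_of_le hT]

/-- The Petersson integrand as a double integral of a theta series of signature `(2, 2)`. -/
lemma peterssonIntegrand_eq (hI : I ≠ 0) (hκ : 0 < κ)
    (hg : GaussSummable (PairIdx.fstVec (σ := σ) (σ' := σ') (I := I) (κ := κ)) PairIdx.sndVec)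
    (τ : ℍ) : (peterssonIntegrand σ σ' I κ τ : ℂ) = (τ.im : ℂ) ^ 2 *
      ∫ y in Ioc 0 (Real.log (epsUnit σ σ' κ)) ×ˢ Ioc 0 (Real.log (epsUnit σ σ' κ)),
        idealTheta σ σ' I κ wTerm (planeCoord τ, y) := by
  have hH := heckeTheta_eq (σ := σ) (σ' := σ') hI hκ hg τ
  have hT : 0 ≤ Real.log (epsUnit σ σ' κ) := log_epsUnit_nonneg σ σ' κ
  set T := Real.log (epsUnit σ σ' κ)
  set A : PairIdx σ σ' I κ → ℂ := fun i => conj (heckeCoeff T (planeCoord τ) i.fstVec) *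
    heckeCoeff T (planeCoord τ) i.sndVec with hA
  obtain ⟨C, c, hC, hc, hb⟩ := exists_norm_heckeTerm_le τ.im_pos T
  have hcount : Countable (PairIdx σ σ' I κ) := by
    have := (hg 1 one_pos).countable_support
    have huniv : (Function.support fun i : PairIdx σ σ' I κ =>
        Real.exp (-(1 * (normSq2 i.fstVec + normSq2 i.sndVec)))) = univ :=
      eq_univ_of_forall fun l => (Real.exp_pos _).ne'
    rwa [huniv, countable_univ_iff] at this
  have hAsum : Summable A := by
    refine Summable.of_norm_bounded ((hg c hc).mul_left (C * T * (C * T))) fun i => ?_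
    rw [hA, norm_mul, RCLike.norm_conj, mul_add, neg_add, Real.exp_add, mul_mul_mul_comm]
    exact mul_le_mul (norm_heckeCoeff_le hT hb _) (norm_heckeCoeff_le hT hb _) (norm_nonneg _)
      (by positivity)
  have hAint : ∑' i, A i = ∫ y in Ioc 0 T ×ˢ Ioc 0 T,
      idealTheta σ σ' I κ wTerm (planeCoord τ, y) := by
    have hms : MeasurableSet (Ioc 0 T ×ˢ Ioc 0 T) := measurableSet_Ioc.prod measurableSet_Ioc
    have hfin : volume (Ioc 0 T ×ˢ Ioc 0 T) ≠ ⊤ := by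
      rw [Measure.volume_eq_prod, Measure.prod_prod]
      exact (ENNReal.mul_lt_top measure_Ioc_lt_top measure_Ioc_lt_top).ne
    have hsb : Summable fun i : PairIdx σ σ' I κ =>
      C * C * Real.exp (-(c * (normSq2 i.fstVec + normSq2 i.sndVec))) := (hg c hc).mul_left _
    have hbd : ∀ i : PairIdx σ σ' I κ, ∀ y ∈ Ioc 0 T ×ˢ Ioc 0 T,
        ‖wTerm i.fstVec i.sndVec τ.re τ.im y.1 y.2‖ ≤
          C * C * Real.exp (-(c * (normSq2 i.fstVec + normSq2 i.sndVec))) := by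
      rintro i y ⟨h1, h2⟩
      have := conj_heckeTerm_mul i.fstVec i.sndVec (planeCoord τ) y.1 y.2
      rw [show wTerm i.fstVec i.sndVec τ.re τ.im y.1 y.2 = _ from this.symm, norm_mul,
        RCLike.norm_conj, mul_add, neg_add, Real.exp_add, mul_mul_mul_comm]
      exact mul_le_mul (hb _ _ _ (by rw [abs_of_pos h1.1]; exact h1.2))
        (hb _ _ _ (by rw [abs_of_pos h2.1]; exact h2.2)) (norm_nonneg _) (by positivity)
    have := hasSum_integral_of_dominated_convergence (μ := volume.restrict (Ioc 0 T ×ˢ Ioc 0 T))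
      (F := fun (i : PairIdx σ σ' I κ) (y : ℝ × ℝ) =>
        wTerm i.fstVec i.sndVec τ.re τ.im y.1 y.2)
      (f := fun y => idealTheta σ σ' I κ wTerm (planeCoord τ, y))
      (fun i _ => C * C * Real.exp (-(c * (normSq2 i.fstVec + normSq2 i.sndVec))))
      (fun i => ((isPairKernel_wTerm.cont i.fstVec i.sndVec).comp
        (by fun_prop : Continuous fun y : ℝ × ℝ =>
          (((τ.re, τ.im), y) : (ℝ × ℝ) × ℝ × ℝ))).aestronglyMeasurable)
      (fun i => (ae_restrict_iff' hms).2 (Eventually.of_forall fun y hy => hbd i y hy))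
      (Eventually.of_forall fun _ => hsb)
      ((integrableOn_const_iff (by finiteness)).2 (Or.inr hfin.lt_top))
      (Eventually.of_forall fun y => (isPairKernel_wTerm.summable hg τ.im_pos _ _ _).hasSum)
    rw [← this.tsum_eq]
    exact tsum_congr fun i => conj_heckeCoeff_mul _ _ _ _
  have hv : (√τ.im : ℂ) * √τ.im = τ.im := by
    rw [← Complex.ofReal_mul, Real.mul_self_sqrt τ.im_pos.le]
  have hnorm : ∀ h : DiscGroup σ σ' I κ, ((‖heckeTheta σ σ' I κ τ h‖ ^ 2 : ℝ) : ℂ) =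
      τ.im * ∑' x : Coset σ σ' I κ h × Coset σ σ' I κ h,
        A (cosetPairEquiv σ σ' I κ ⟨h, x⟩) := by
    intro h
    obtain ⟨-, -, hs, heq⟩ := hH h
    have hs' : Summable fun l : Coset σ σ' I κ h =>
        ‖conj (heckeCoeff T (planeCoord τ) (dualVec l.1))‖ := by
      simpa only [RCLike.norm_conj] using hs
    have := tsum_mul_tsum_of_summable_norm hs' hs
    have h2 : ∑' x : Coset σ σ' I κ h × Coset σ σ' I κ h,
        A (cosetPairEquiv σ σ' I κ ⟨h, x⟩) = conj (∑' l : Coset σ σ' I κ h,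
          heckeCoeff T (planeCoord τ) (dualVec l.1)) * ∑' l : Coset σ σ' I κ h,
          heckeCoeff T (planeCoord τ) (dualVec l.1) := by
      rw [Complex.conj_tsum, this]
      rfl
    rw [h2, heq, Complex.ofReal_pow, ← Complex.conj_mul', map_mul, Complex.conj_ofReal, ← hv]
    ring
  have hsig : Summable fun x => A (cosetPairEquiv σ σ' I κ x) :=
    (Equiv.summable_iff (cosetPairEquiv σ σ' I κ)).2 hAsum
  rw [peterssonIntegrand, Complex.ofReal_mul, Complex.ofReal_tsum]
  simp only [hnorm]
  rw [tsum_mul_left, ← hsig.tsum_sigma, (cosetPairEquiv σ σ' I κ).tsum_eq, hAint]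
  ring

end Quadratic

end HeckeTheta

end

noncomputable section

namespace HeckeTheta

open Module NumberField MeasureTheory UpperHalfPlane Set Filter
open scoped nonZeroDivisors NumberField Real Modular

/-! ### The unfolded integrals -/

section Quadratic

variable {F : Type*} [Field F] [NumberField F] {σ σ' : F →+* ℝ}

/-- The theta lift as an integral over the fundamental domain in real coordinates. -/
def planeLift (σ σ' : F →+* ℝ) (I : FractionalIdeal (𝓞 F)⁰ F) (κ : ℕ) (y : ℝ × ℝ) : ℂ :=
  ∫ z in fdPlane, idealTheta σ σ' I κ wTerm (z, y)

variable {I : FractionalIdeal (𝓞 F)⁰ F} {κ : ℕ}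

lemma intervalIntegrable_planeLift
    (hg : GaussSummable (PairIdx.fstVec (σ := σ) (σ' := σ') (I := I) (κ := κ)) PairIdx.sndVec)
    (a b s : ℝ) : IntervalIntegrable (fun t => planeLift σ σ' I κ (t, s)) volume a b :=
  ⟨(isPairKernel_wTerm.integrable_prod_slice hg a b s).integral_prod_right,
    (isPairKernel_wTerm.integrable_prod_slice hg b a s).integral_prod_right⟩

lemma integral_planeLift
    (hg : GaussSummable (PairIdx.fstVec (σ := σ) (σ' := σ') (I := I) (κ := κ)) PairIdx.sndVec)
    {T : ℝ} (hT : 0 ≤ T) (s : ℝ) : ∫ t in (0 : ℝ)..T, planeLift σ σ' I κ (t, s) =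
      ∫ z in fdPlane, ∫ t in (0 : ℝ)..T, idealTheta σ σ' I κ wTerm (z, t, s) := by
  simp only [intervalIntegral.integral_of_le hT, planeLift]
  exact (integral_integral_swap (f := fun z t => idealTheta σ σ' I κ wTerm (z, t, s))
    (isPairKernel_wTerm.integrable_prod_slice hg 0 T s)).symm

/-- The integral over a square of periods is a multiple of the cycle integral. -/
lemma integral_fdPlane_integral_square (hF : finrank ℚ F = 2) (hσ : σ ≠ σ') {𝔞 : Ideal (𝓞 F)}
    (h𝔞 : 𝔞 ≠ ⊥) (hκ : 0 < κ) (s₀ : ℝ) :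
    IntegrableOn (fun z => ∫ y in Ioc 0 (Real.log (epsUnit σ σ' κ)) ×ˢ
        Ioc 0 (Real.log (epsUnit σ σ' κ)),
      idealTheta σ σ' (𝔞 : FractionalIdeal (𝓞 F)⁰ F) κ wTerm (z, y)) fdPlane ∧
    ∫ z in fdPlane, ∫ y in Ioc 0 (Real.log (epsUnit σ σ' κ)) ×ˢ
        Ioc 0 (Real.log (epsUnit σ σ' κ)),
      idealTheta σ σ' (𝔞 : FractionalIdeal (𝓞 F)⁰ F) κ wTerm (z, y) =
      (∫ t in (0 : ℝ)..Real.log (epsUnit σ σ' κ),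
        planeLift σ σ' (𝔞 : FractionalIdeal (𝓞 F)⁰ F) κ (t, s₀)) *
        Real.log (epsUnit σ σ' κ) := by
  have hg := gaussSummable_pairIdx (σ := σ) (σ' := σ') hF hσ h𝔞 hκ
  have hinv := integral_idealTheta_eq (σ := σ) (σ' := σ') hF hσ h𝔞 hκ s₀
  have hT : 0 ≤ Real.log (epsUnit σ σ' κ) := log_epsUnit_nonneg σ σ' κ
  set T := Real.log (epsUnit σ σ' κ)
  set I := (𝔞 : FractionalIdeal (𝓞 F)⁰ F)
  have hint := isPairKernel_wTerm.integrable_prod hg (S := Ioc 0 T ×ˢ Ioc 0 T) (R := T)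
    (measurableSet_Ioc.prod measurableSet_Ioc) (fun y hy =>
      ⟨by rw [abs_of_pos hy.1.1]; exact hy.1.2, by rw [abs_of_pos hy.2.1]; exact hy.2.2⟩)
  have hH : IntegrableOn (planeLift σ σ' I κ) (Ioc 0 T ×ˢ Ioc 0 T) := hint.integral_prod_right
  refine ⟨hint.integral_prod_left, ?_⟩
  rw [integral_integral_swap (f := fun z y => idealTheta σ σ' I κ wTerm (z, y)) hint]
  change ∫ y in Ioc 0 T ×ˢ Ioc 0 T, planeLift σ σ' I κ y = _
  rw [IntegrableOn, Measure.volume_eq_prod, ← Measure.prod_restrict] at hH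
  rw [Measure.volume_eq_prod, ← Measure.prod_restrict, integral_prod_symm _ hH]
  have h1 : ∀ s, ∫ t in Ioc 0 T, planeLift σ σ' I κ (t, s) =
      ∫ t in (0 : ℝ)..T, planeLift σ σ' I κ (t, s₀) := by
    intro s
    rw [← intervalIntegral.integral_of_le hT, integral_planeLift hg hT, integral_planeLift hg hT,
      hinv]
  simp only [h1]
  rw [setIntegral_const, measureReal_def, Real.volume_Ioc, sub_zero, ENNReal.toReal_ofReal hT,
    Complex.real_smul, mul_comm]

end Quadratic

end HeckeTheta

end

open HeckeTheta MeasureTheory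
open scoped nonZeroDivisors NumberField Modular

theorem proposition2p2 {F : Type*} [Field F] [NumberField F]
    (hF : Module.finrank ℚ F = 2) (σ σ' : F →+* ℝ) (hσ : σ ≠ σ')
    (𝔞 : Ideal (𝓞 F)) (h𝔞 : 𝔞 ≠ ⊥) (κ : ℕ) (hκ : 0 < κ)
    (𝔟 : FractionalIdeal (𝓞 F)⁰ F)
    (h𝔟 : SameNarrowClass σ σ' 𝔟
      ((𝔞 * differentIdeal ℤ (𝓞 F) : Ideal (𝓞 F)) : FractionalIdeal (𝓞 F)⁰ F)) :
    -- the series and integrals that define the left-hand side converge absolutely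
    ((∀ (τ : UpperHalfPlane) (t : ℝ) (h : DiscGroup σ σ' (𝔞 : FractionalIdeal (𝓞 F)⁰ F) κ),
        Summable fun l : Coset σ σ' (𝔞 : FractionalIdeal (𝓞 F)⁰ F) κ h =>
          kernelTerm σ σ' (levelN (𝔞 : FractionalIdeal (𝓞 F)⁰ F) κ) τ t
            ((l : dualLattice σ σ' (𝔞 : FractionalIdeal (𝓞 F)⁰ F) κ) : F)) ∧
      (∀ (τ : UpperHalfPlane) (h : DiscGroup σ σ' (𝔞 : FractionalIdeal (𝓞 F)⁰ F) κ),
        IntervalIntegrable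
          (fun t => thetaKernel σ σ' (𝔞 : FractionalIdeal (𝓞 F)⁰ F) κ τ t h)
          volume 0 (Real.log (epsUnit σ σ' κ))) ∧
      IntegrableOn (peterssonIntegrand σ σ' (𝔞 : FractionalIdeal (𝓞 F)⁰ F) κ) 𝒟) ∧
    -- so do those that define the right-hand side
    ((∀ (τ : UpperHalfPlane) (t : ℝ),
        Summable fun x : latticeM σ σ' 𝔟 κ =>
          siegelTerm (levelN 𝔟 κ) τ t 0 (x : Matrix (Fin 2) (Fin 2) ℝ)) ∧
      (∀ t : ℝ, IntegrableOn (liftIntegrand σ σ' 𝔟 κ t 0) 𝒟) ∧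
      IntervalIntegrable (fun t => thetaLift σ σ' 𝔟 κ t 0)
        volume 0 (Real.log (epsUnit σ σ' κ))) ∧
    -- the formula
    (peterssonNormSq σ σ' (𝔞 : FractionalIdeal (𝓞 F)⁰ F) κ : ℂ) =
      psiTilde σ σ' 𝔟 κ * (Real.log (epsUnit σ σ' κ) : ℂ) := by
  have hI : (𝔞 : FractionalIdeal (𝓞 F)⁰ F) ≠ 0 := FractionalIdeal.coeIdeal_ne_zero.2 h𝔞
  have hg := gaussSummable_pairIdx (σ := σ) (σ' := σ') hF hσ h𝔞 hκ
  have hT : 0 ≤ Real.log (epsUnit σ σ' κ) := log_epsUnit_nonneg σ σ' κ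
  obtain ⟨r, hr⟩ := exists_siegelTheta_eq hF hσ h𝔞 hκ h𝔟
  obtain ⟨hsq, hsq'⟩ := integral_fdPlane_integral_square (σ := σ) (σ' := σ') hF hσ h𝔞 hκ (-r)
  have hpet := peterssonIntegrand_eq (σ := σ) (σ' := σ') hI hκ hg
  have hlift : ∀ t τ, liftIntegrand σ σ' 𝔟 κ t 0 τ = (τ.im : ℂ) ^ 2 *
      (fun z => idealTheta σ σ' (𝔞 : FractionalIdeal (𝓞 F)⁰ F) κ wTerm (z, t - r, -r))
        (planeCoord τ) := fun t τ => by
    rw [liftIntegrand, (hr τ t).2]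
  have hthetaLift : ∀ t, thetaLift σ σ' 𝔟 κ t 0 =
      planeLift σ σ' (𝔞 : FractionalIdeal (𝓞 F)⁰ F) κ (t - r, -r) := by
    intro t
    simp only [thetaLift, hlift t]
    exact integral_fd_eq
      fun z => idealTheta σ σ' (𝔞 : FractionalIdeal (𝓞 F)⁰ F) κ wTerm (z, t - r, -r)
  have hper : Function.Periodic
      (fun t => planeLift σ σ' (𝔞 : FractionalIdeal (𝓞 F)⁰ F) κ (t, -r))
      (Real.log (epsUnit σ σ' κ)) := by
    intro t
    simp only [planeLift, idealTheta_add_log_epsUnit hF hσ hI hκ wTerm_add]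
  refine ⟨⟨fun τ t h => (heckeTheta_eq hI hκ hg τ h).1 t,
    fun τ h => (heckeTheta_eq hI hκ hg τ h).2.1, ?_⟩, ⟨fun τ t => (hr τ t).1, fun t => ?_, ?_⟩, ?_⟩
  · have h1 := (integrableOn_fd_iff _).2 hsq
    simp only [← hpet] at h1
    exact Integrable.re h1
  · simp only [funext (hlift t)]
    exact (integrableOn_fd_iff _).2 (isPairKernel_wTerm.integrableOn_fdPlane hg _)
  · simp only [hthetaLift]
    have := (intervalIntegrable_planeLift hg (0 - r) (Real.log (epsUnit σ σ' κ) - r)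
      (-r)).comp_sub_right r
    simpa using this
  · have h1 : (peterssonNormSq σ σ' (𝔞 : FractionalIdeal (𝓞 F)⁰ F) κ : ℂ) = _ :=
      (integral_ofReal (𝕜 := ℂ)).symm
    rw [h1]
    simp only [RCLike.ofReal_eq_complex_ofReal, hpet]
    rw [integral_fd_eq (fun z => ∫ y in Set.Ioc 0 (Real.log (epsUnit σ σ' κ)) ×ˢ
      Set.Ioc 0 (Real.log (epsUnit σ σ' κ)),
      idealTheta σ σ' (𝔞 : FractionalIdeal (𝓞 F)⁰ F) κ wTerm (z, y)), hsq']
    congr 1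
    simp only [psiTilde, cycleIntegral, hthetaLift]
    rw [intervalIntegral.integral_comp_sub_right
      (fun t => planeLift σ σ' (𝔞 : FractionalIdeal (𝓞 F)⁰ F) κ (t, -r))]
    have := hper.intervalIntegral_add_eq 0 (0 - r)
    rw [zero_add] at this
    rw [this]
    congr 1
    ring
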